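/- **Setting.** Let $\mathscr R$ consist of the symbol $\infty$ and of all rational functions $f(\lambda)=h_0\lambda+h+\sum_{k=1}^{d}\frac{\delta_k}{h_k-\lambda}$ with $d\ge 0$, $h_0\ge 0$, $h\in\mathbb R$, $\delta_k>0$ and real $h_1<\dots<h_d$. For $f\ne\infty$ put $f_\downarrow(\lambda)=h_0'\prod_{k}(h_k-\lambda)$, where $h_0'=1/h_0$ if $h_0>0$ and $h_0'=1$ if $h_0=0$; let $f_\uparrow=f f_\downarrow$, and let $\operatorname{ind}f=2d+1$ if $h_0>0$ and $\operatorname{ind}f=2d$ if $h_0=0$. For $f=\infty$ put $f_\uparrow=-1$, $f_\downarrow=0$, $\operatorname{ind}f=-1$. For real $s\in\mathring{\mathscr L}_2(0,\pi)=\{s\in L_2(0,\pi):\int_0^\pi s=0\}$ and $f,F\in\mathscr R$ let $\mathscr P(s,f,F)$ be the boundary value problem $$-(y^{[1]}_s)'-s\,y^{[1]}_s-s^2y=\lambda y,\qquad \frac{y^{[1]}_s(0)}{y(0)}=-f(\lambda),\qquad \frac{y^{[1]}_s(\pi)}{y(\pi)}=F(\lambda),$$ where $y$ and $y^{[1]}_s:=y'-sy$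 are absolutely continuous on $[0,\pi]$; the boundary conditions are understood as $f_\downarrow(\lambda)y^{[1]}_s(0)+f_\uparrow(\lambda)y(0)=0$ and $F_\downarrow(\lambda)y^{[1]}_s(\pi)=F_\uparrow(\lambda)y(\pi)$. Let $\varphi(x,\lambda)$, $\psi(x,\lambda)$ be the solutions of the equation with $\varphi(0,\lambda)=f_\downarrow(\lambda)$, $\varphi^{[1]}_s(0,\lambda)=-f_\uparrow(\lambda)$, $\psi(\pi,\lambda)=F_\downarrow(\lambda)$, $\psi^{[1]}_s(\pi,\lambda)=F_\uparrow(\lambda)$. The spectral data $\{\lambda_n,\gamma_n\}_{n\ge0}$ of the problem consist of all its (complex, a priori) eigenvalues, which are real, listed as $\lambda_0<\lambda_1<\dots$, and of the norming constants $$\gamma_n=\int_0^\pi\varphi^2(x,\lambda_n)\,dx+(f_\uparrow'f_\downarrow-f_\uparrow f_\downarrow')(\lambda_n)+\frac1{\beta_n^2}(F_\uparrow'F_\downarrow-F_\uparrow F_\downarrow')(\lambda_n),$$ where $\beta_n\neq0$ is defined by $\psi(\cdot,\lambda_n)=\beta_n\varphi(\cdot,\lambda_n)$ on $[0,\pi]$.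 **Transformations.** Put $\boldsymbol\Theta(\mu,\tau,\rho,f)=\frac{\mu-\lambda}{f(\lambda)-\tau}+\rho$, understood as $\infty$ if $f\equiv\tau$ and as $\rho$ if $f=\infty$; its domain consists of the $(\mu,\tau,\rho,f)$ such that $\mu$ is smaller than all poles of $f$ and $\tau\ge f(\mu)$ if $f\ne\infty$. Let $f,F\in\mathscr R$ with $\operatorname{ind}f+\operatorname{ind}F\ge-1$ (i.e. not both are $\infty$). Let $\Lambda=\lambda_0$ if $f\neq\infty$ and $F\ne\infty$, and $\Lambda=\lambda_0-2$ otherwise; let $v=\varphi(\cdot,\Lambda)$ if $f\ne\infty$ and $v=\psi(\cdot,\Lambda)$ if $f=\infty$. With $c=\frac2\pi\ln\frac{v(\pi)}{v(0)}$, $\tau_0=-\frac{v^{[1]}_s(0)}{v(0)}$ and $\tau_\pi=\frac{v^{[1]}_s(\pi)}{v(\pi)}$, define $\widehat{\mathbf T}(s,f,F)=(\widehat s,\widehat f,\widehat F)$ by $$\widehat s=s-\frac{2v'}{v}+c,\qquad \widehat f=\boldsymbol\Theta(\Lambda,\tau_0,\tau_0+c,f),\qquad \widehat F=\boldsymbol\Theta(\Lambda,\tau_\pi,\tau_\pi-c,F).$$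 **Theorem.** Let $s\in\mathring{\mathscr L}_2(0,\pi)$, let $f,F\in\mathscr R$ with $\operatorname{ind}f+\operatorname{ind}F\ge-1$, and let $\{\lambda_n,\gamma_n\}_{n\ge0}$ be the spectral data of $\mathscr P(s,f,F)$. Then $\widehat{\mathbf T}(s,f,F)=(\widehat s,\widehat f,\widehat F)$ is well defined: $v$ has no zeros on $[0,\pi]$, the arguments of $\boldsymbol\Theta$ lie in its domain, $\widehat s\in\mathring{\mathscr L}_2(0,\pi)$ and $\widehat f,\widehat F\in\mathscr R$. Moreover, $$I:=\operatorname{ind}f-\operatorname{ind}\widehat f=\begin{cases}1,&f\ne\infty,\\-1,&f=\infty,\end{cases}\qquad J:=\frac{\operatorname{ind}f+\operatorname{ind}F}2-\frac{\operatorname{ind}\widehat f+\operatorname{ind}\widehat F}2=\begin{cases}1,&f\ne\infty\text{ and }F\neq\infty,\\0,&\text{otherwise,}\end{cases}$$ and the spectral data of $\mathscr P(\widehat s,\widehat f,\widehat F)$ are $$\Bigl\{\lambda_n,\ \frac{\gamma_n}{(\lambda_n-\Lambda)^I}\Bigr\}_{n\ge J}.$$ -/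

import Mathlib

open MeasureTheory Set Polynomial
open scoped OnePoint

namespace SturmLiouville

noncomputable section

/-! ### Rational Herglotz-Nevanlinna functions -/

/-- A function `slope * l + const + ∑ p, res p / (p - l)` with `slope ≥ 0`, finitely many poles
(the support of `res`) and `res p > 0` at each pole `p`. -/
structure Herglotz where
  slope : ℝ
  const : ℝ
  res : ℝ →₀ ℝ
  slope_nonneg : 0 ≤ slope
  res_nonneg : ∀ p, 0 ≤ res p

namespace Herglotz

/-- The function as an element of the field of rational functions. -/
def toRatFunc (f : Herglotz) : RatFunc ℝ :=
  RatFunc.C f.slope * RatFunc.X + RatFunc.C f.const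
    + ∑ p ∈ f.res.support, RatFunc.C (f.res p) / (RatFunc.C p - RatFunc.X)

/-- The value at a real point that is not a pole. -/
def eval (f : Herglotz) (l : ℝ) : ℝ :=
  f.slope * l + f.const + ∑ p ∈ f.res.support, f.res p / (p - l)

/-- `1 / slope` if `slope > 0` and `1` if `slope = 0`. -/
def lead (f : Herglotz) : ℝ := if 0 < f.slope then 1 / f.slope else 1

/-- The denominator, normalized as `lead * ∏ p, (p - X)`. -/
def down (f : Herglotz) : ℝ[X] := C f.lead * ∏ p ∈ f.res.support, (C p - X)

/-- The numerator corresponding to the denominator `down`; see `toRatFunc_eq_div`. -/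
def up (f : Herglotz) : ℝ[X] :=
  (C f.slope * X + C f.const) * f.down
    + ∑ p ∈ f.res.support, C (f.lead * f.res p) * ∏ q ∈ f.res.support.erase p, (C q - X)

/-- The index: twice the number of poles, plus one if the function grows linearly at infinity.
(It is the sum of the degrees of `up` and `down`, where the degree of `up` is read as the number
of poles also when `slope = const = 0`.) -/
def index (f : Herglotz) : ℤ :=
  2 * (f.res.support.card : ℤ) + (if 0 < f.slope then 1 else 0)

lemma lead_ne_zero (f : Herglotz) : f.lead ≠ 0 := by
  unfold lead
  split_ifs with h
  · exact one_div_ne_zero h.ne'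
  · exact one_ne_zero

lemma polC_sub_X_ne_zero (p : ℝ) : (C p - X : ℝ[X]) ≠ 0 := by
  intro h
  have := congrArg (fun q => q.coeff 1) h
  simp at this

lemma ratC_sub_X (p : ℝ) :
    (RatFunc.C p - RatFunc.X : RatFunc ℝ) = algebraMap ℝ[X] (RatFunc ℝ) (C p - X) := by
  simp

lemma ratC_sub_X_ne_zero (p : ℝ) : (RatFunc.C p - RatFunc.X : RatFunc ℝ) ≠ 0 := by
  rw [ratC_sub_X]
  exact RatFunc.algebraMap_ne_zero (polC_sub_X_ne_zero p)

lemma down_ne_zero (f : Herglotz) : f.down ≠ 0 := by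
  unfold down
  refine mul_ne_zero (by simpa using f.lead_ne_zero) ?_
  exact Finset.prod_ne_zero_iff.mpr fun p _ => polC_sub_X_ne_zero p

lemma toRatFunc_eq_div (f : Herglotz) :
    f.toRatFunc = algebraMap ℝ[X] (RatFunc ℝ) f.up / algebraMap ℝ[X] (RatFunc ℝ) f.down := by
  rw [eq_div_iff (RatFunc.algebraMap_ne_zero f.down_ne_zero)]
  unfold toRatFunc up
  rw [map_add, map_mul, add_mul, Finset.sum_mul, map_sum]
  congr 1
  · simp
  · refine Finset.sum_congr rfl fun p hp => ?_
    unfold down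
    rw [← Finset.mul_prod_erase _ _ hp]
    simp only [map_mul, ← ratC_sub_X, RatFunc.algebraMap_C]
    field_simp [ratC_sub_X_ne_zero p]

/-- The coefficients are determined by the rational function. -/
lemma toRatFunc_injective : Function.Injective toRatFunc := by
  classical
  intro f g hfg
  set S := f.res.support ∪ g.res.support with hS
  have key : ∀ k : Herglotz, k.res.support ⊆ S →
      k.toRatFunc * algebraMap ℝ[X] (RatFunc ℝ) (∏ q ∈ S, (C q - X)) =
        algebraMap ℝ[X] (RatFunc ℝ) ((C k.slope * X + C k.const) * ∏ q ∈ S, (C q - X)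
          + ∑ p ∈ S, C (k.res p) * ∏ q ∈ S.erase p, (C q - X)) := by
    intro k hk
    unfold toRatFunc
    have hext : ∑ p ∈ k.res.support, RatFunc.C (k.res p) / (RatFunc.C p - RatFunc.X) =
        ∑ p ∈ S, RatFunc.C (k.res p) / (RatFunc.C p - RatFunc.X) := by
      refine Finset.sum_subset hk fun p _ hp => ?_
      rw [Finsupp.notMem_support_iff.mp hp, map_zero, zero_div]
    rw [hext, map_add, map_mul, add_mul, Finset.sum_mul, map_sum]
    congr 1
    · simp
    · refine Finset.sum_congr rfl fun p hp => ?_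
      rw [← Finset.mul_prod_erase _ _ hp]
      simp only [map_mul, ← ratC_sub_X, RatFunc.algebraMap_C]
      field_simp [ratC_sub_X_ne_zero p]
  have h1 := key f Finset.subset_union_left
  have h2 := key g Finset.subset_union_right
  rw [hfg, h2] at h1
  have h3 := RatFunc.algebraMap_injective ℝ h1
  have hres : f.res = g.res := by
    ext p
    by_cases hp : p ∈ S
    · have h4 := congrArg (Polynomial.eval p) h3
      have hz : ∏ q ∈ S, (q - p) = 0 := Finset.prod_eq_zero hp (sub_self p)
      have hsum : ∀ c : ℝ → ℝ, ∑ r ∈ S, c r * ∏ q ∈ S.erase r, (q - p)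
          = c p * ∏ q ∈ S.erase p, (q - p) := by
        intro c
        refine Finset.sum_eq_single p (fun r _ hr => ?_) (fun h => absurd hp h)
        have h0 : ∏ q ∈ S.erase r, (q - p) = 0 :=
          Finset.prod_eq_zero (Finset.mem_erase.mpr ⟨hr.symm, hp⟩) (sub_self p)
        rw [h0, mul_zero]
      simp only [eval_add, eval_mul, eval_prod, eval_sub, eval_C, eval_X, eval_finsetSum, hz,
        hsum, mul_zero, zero_add] at h4
      refine (mul_right_cancel₀ ?_ h4).symm
      refine Finset.prod_ne_zero_iff.mpr fun q hq => sub_ne_zero.mpr ?_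
      exact (Finset.mem_erase.mp hq).1
    · have hp' := hp
      rw [hS, Finset.mem_union, not_or] at hp'
      rw [Finsupp.notMem_support_iff.mp hp'.1, Finsupp.notMem_support_iff.mp hp'.2]
  rw [hres] at h3
  have h5 := mul_right_cancel₀
    (Finset.prod_ne_zero_iff.mpr fun q _ => polC_sub_X_ne_zero q) (add_right_cancel h3)
  have hs : f.slope = g.slope := by
    have := congrArg (fun q => q.coeff 1) h5
    simpa [coeff_C] using this.symm
  have hc : f.const = g.const := by
    have := congrArg (fun q => q.coeff 0) h5
    simpa using this.symm
  cases f; cases g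
  simp_all

end Herglotz

/-! ### Boundary coefficients: a Herglotz function or `∞` (the Dirichlet condition) -/

def up : OnePoint Herglotz → ℝ[X]
  | ∞ => -1
  | OnePoint.some f => f.up

def down : OnePoint Herglotz → ℝ[X]
  | ∞ => 0
  | OnePoint.some f => f.down

def index : OnePoint Herglotz → ℤ
  | ∞ => -1
  | OnePoint.some f => f.index

/-! ### The differential equation and the boundary value problem on `[0, π]` -/

/-- Real functions in `L²(0, π)` with mean value zero. -/
def L2zero : Set (ℝ → ℝ) :=
  {s | MemLp s 2 (volume.restrict (Ioo 0 Real.pi)) ∧ ∫ x in Ioo 0 Real.pi, s x = 0}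

/-- `y` is a solution of `-(y₁)' - s y₁ - s² y = z y` on `[0, π]` whose quasi-derivative
`y' - s y` is (the absolutely continuous function) `y₁`. -/
structure IsSolution {𝕜 : Type*} [RCLike 𝕜] (s : ℝ → ℝ) (z : 𝕜) (y y₁ : ℝ → 𝕜) : Prop where
  ac : AbsolutelyContinuousOnInterval y 0 Real.pi
  ac_quasi : AbsolutelyContinuousOnInterval y₁ 0 Real.pi
  deriv_eq : ∀ᵐ x ∂volume.restrict (Ioo 0 Real.pi), HasDerivAt y (y₁ x + (s x : 𝕜) * y x) x
  deriv_quasi_eq : ∀ᵐ x ∂volume.restrict (Ioo 0 Real.pi),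
    HasDerivAt y₁ (-(s x : 𝕜) * y₁ x - (s x : 𝕜) ^ 2 * y x - z * y x) x

/-- `z` is an eigenvalue of the problem with boundary conditions `y₁(0) / y(0) = -f(z)`,
`y₁(π) / y(π) = F(z)`. The conditions are cleared of denominators: they mean `y(0) = 0`
(or `y(π) = 0`) when the coefficient is `∞` or has a pole at `z`. -/
def IsEigenvalue (s : ℝ → ℝ) (f F : OnePoint Herglotz) (z : ℂ) : Prop :=
  ∃ y y₁ : ℝ → ℂ, IsSolution s z y y₁ ∧ (∃ x ∈ Icc 0 Real.pi, y x ≠ 0) ∧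
    aeval z (down f) * y₁ 0 = -(aeval z (up f) * y 0) ∧
    aeval z (down F) * y₁ Real.pi = aeval z (up F) * y Real.pi

/-- The real solution, together with its quasi-derivative, with values `a`, `b` at `x₀`.
It exists and is unique on `[0, π]` when `s` is square integrable and `x₀ ∈ [0, π]`. -/
def initialSolution (s : ℝ → ℝ) (l x₀ a b : ℝ) : (ℝ → ℝ) × (ℝ → ℝ) :=
  Classical.epsilon fun y => IsSolution s l y.1 y.2 ∧ y.1 x₀ = a ∧ y.2 x₀ = b

/-- `phi` has the value `down f` and the quasi-derivative `-up f` at `0`. -/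
def phi (s : ℝ → ℝ) (f : OnePoint Herglotz) (l : ℝ) : ℝ → ℝ :=
  (initialSolution s l 0 ((down f).eval l) (-(up f).eval l)).1

def phiQuasi (s : ℝ → ℝ) (f : OnePoint Herglotz) (l : ℝ) : ℝ → ℝ :=
  (initialSolution s l 0 ((down f).eval l) (-(up f).eval l)).2

/-- `psi` has the value `down F` and the quasi-derivative `up F` at `π`. -/
def psi (s : ℝ → ℝ) (F : OnePoint Herglotz) (l : ℝ) : ℝ → ℝ :=
  (initialSolution s l Real.pi ((down F).eval l) ((up F).eval l)).1

def psiQuasi (s : ℝ → ℝ) (F : OnePoint Herglotz) (l : ℝ) : ℝ → ℝ :=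
  (initialSolution s l Real.pi ((down F).eval l) ((up F).eval l)).2

/-- `up' * down - up * down'` at `l`, i.e. `f'(l) * down(l)²` off the poles. -/
def wronskian (f : OnePoint Herglotz) (l : ℝ) : ℝ :=
  (derivative (up f)).eval l * (down f).eval l - (up f).eval l * (derivative (down f)).eval l

/-- `g` is the norming constant at the real eigenvalue `l`. Off the poles of `f` and `F` it equals
`∫ phi² + f'(l) * phi(0)² + F'(l) * phi(π)²`, since `phi(π) = down F / b`. -/
def IsNormingConstant (s : ℝ → ℝ) (f F : OnePoint Herglotz) (l g : ℝ) : Prop :=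
  ∃ b : ℝ, b ≠ 0 ∧ (∀ x ∈ Icc 0 Real.pi, psi s F l x = b * phi s f l x) ∧
    g = (∫ x in Ioo 0 Real.pi, phi s f l x ^ 2) + wronskian f l + 1 / b ^ 2 * wronskian F l

/-- The sequence `lam` lists all (complex) eigenvalues in increasing order, without repetition,
and `gam` is the sequence of the corresponding norming constants. -/
structure IsSpectralData (s : ℝ → ℝ) (f F : OnePoint Herglotz) (lam gam : ℕ → ℝ) : Prop where
  strictMono : StrictMono lam
  eigenvalue_iff : ∀ z : ℂ, IsEigenvalue s f F z ↔ ∃ n, z = (lam n : ℂ)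
  norming : ∀ n, IsNormingConstant s f F (lam n) (gam n)

/-- The smallest eigenvalue. -/
def minEigenvalue (s : ℝ → ℝ) (f F : OnePoint Herglotz) : ℝ :=
  sInf {l : ℝ | IsEigenvalue s f F (l : ℂ)}

/-! ### The transformations -/

open Classical in
/-- `(m - X) / (f - t) + r`, which is `∞` if `f` is the constant `t`, and `r` if `f = ∞`. -/
def theta (m t r : ℝ) : OnePoint (RatFunc ℝ) → OnePoint (RatFunc ℝ)
  | ∞ => ((RatFunc.C r : RatFunc ℝ) : OnePoint (RatFunc ℝ))
  | OnePoint.some f =>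
    if f = RatFunc.C t then ∞
    else (((RatFunc.C m - RatFunc.X) / (f - RatFunc.C t) + RatFunc.C r : RatFunc ℝ) :
      OnePoint (RatFunc ℝ))

/-- The condition on `m`, `t`, `f` under which `theta m t r` is applied to `f`: `m` lies below all
poles of `f`, and `f(m) ≤ t` if `f ≠ ∞`. -/
def ThetaAdmissible (m t : ℝ) (f : OnePoint Herglotz) : Prop :=
  ∀ g : Herglotz, f = (g : OnePoint Herglotz) → (∀ p ∈ g.res.support, m < p) ∧ g.eval m ≤ t

/-- A boundary coefficient as a rational function or `∞`. -/
def toRat (f : OnePoint Herglotz) : OnePoint (RatFunc ℝ) := OnePoint.map Herglotz.toRatFunc f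

open Classical in
/-- The parameter `Λ` of the transformation. -/
def bigLambda (s : ℝ → ℝ) (f F : OnePoint Herglotz) : ℝ :=
  if f ≠ ∞ ∧ F ≠ ∞ then minEigenvalue s f F else minEigenvalue s f F - 2

open Classical in
/-- The solution `v` at `Λ` that generates the transformation. -/
def vSol (s : ℝ → ℝ) (f F : OnePoint Herglotz) : ℝ → ℝ :=
  if f ≠ ∞ then phi s f (bigLambda s f F) else psi s F (bigLambda s f F)

open Classical in
def vQuasi (s : ℝ → ℝ) (f F : OnePoint Herglotz) : ℝ → ℝ :=
  if f ≠ ∞ then phiQuasi s f (bigLambda s f F) else psiQuasi s F (bigLambda s f F)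

/-- `(2 / π) * log (v(π) / v(0))` -/
def shift (s : ℝ → ℝ) (f F : OnePoint Herglotz) : ℝ :=
  2 / Real.pi * Real.log (vSol s f F Real.pi / vSol s f F 0)

/-- `-v₁(0) / v(0)`, where `v₁` is the quasi-derivative of `v`. -/
def tauLeft (s : ℝ → ℝ) (f F : OnePoint Herglotz) : ℝ := -(vQuasi s f F 0 / vSol s f F 0)

/-- `v₁(π) / v(π)`, where `v₁` is the quasi-derivative of `v`. -/
def tauRight (s : ℝ → ℝ) (f F : OnePoint Herglotz) : ℝ :=
  vQuasi s f F Real.pi / vSol s f F Real.pi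

/-- The Darboux-type transformation `(s, f, F) ↦ (s - 2 v' / v + shift, theta f, theta F)`. -/
def darboux (s : ℝ → ℝ) (f F : OnePoint Herglotz) :
    (ℝ → ℝ) × OnePoint (RatFunc ℝ) × OnePoint (RatFunc ℝ) :=
  (fun x => s x - 2 * deriv (vSol s f F) x / vSol s f F x + shift s f F,
    theta (bigLambda s f F) (tauLeft s f F) (tauLeft s f F + shift s f F) (toRat f),
    theta (bigLambda s f F) (tauRight s f F) (tauRight s f F - shift s f F) (toRat F))

open Classical in
/-- The exponent `I`: it is `1` if `f ≠ ∞` and `-1` if `f = ∞`. -/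
def expI (f : OnePoint Herglotz) : ℤ := if f ≠ ∞ then 1 else -1

open Classical in
/-- The number `J` of removed eigenvalues: `1` if `f ≠ ∞` and `F ≠ ∞`, and `0` otherwise. -/
def numJ (f F : OnePoint Herglotz) : ℕ := if f ≠ ∞ ∧ F ≠ ∞ then 1 else 0

end

end SturmLiouville

open SturmLiouville

/-! Let `m = Λ` and `r = v₁ / v`, where `v` is the generating solution. Since `v` has no zeros, `r`
is absolutely continuous and solves the Riccati equation `r' = -m - (r + s)²`, and the new
coefficient is `-s - 2 r + c`. The map `y ↦ y₁ - r y` carries solutions for `s` to solutions for the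
new coefficient at the same spectral parameter `z` (`IsDarbouxCoeff.isSolution`). The map back has
the same form, with `r - c` in place of `r`, and the composition multiplies `y` by `m - z`. So the
two equations correspond perfectly off `m`.

At the ends, `f(m)` equals `τ` exactly whenever `f ≠ ∞`, and likewise for `F`. Hence `Θ(f) = k - 1 /
g`, where `g = (f - f(m)) / (λ - m)` is the divided difference. It has positive residues because `m`
lies below the poles, so `k - 1 / g` is again a Herglotz function, or `∞` if `g = 0`
(`exists_divided_difference`, `exists_sub_inv`, `exists_theta`). Numerators and denominators are
then linked by polynomial identities (`ThetaRel`), which say that boundary conditions go to boundary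
conditions. Thus eigenvalues other than `m` are preserved. An integral identity, combined with the
change of the boundary Wronskians, gives the norming constants (`IsNormingConstant.darboux`). At `m`
itself, a sum of nonnegative terms with a positive one excludes an eigenvalue
(`not_isEigenvalue_darboux`). This removes `λ₀` when both coefficients are finite and nothing
otherwise.

It remains to see that `v` is positive and that `m` is below all poles. Both hold for very negative
parameters by a barrier argument for the Riccati equation (`exists_forall_le_pos`), and they persist
up to the lowest eigenvalue by continuity (`phi_pos_of_forall_lt`). The case `f = ∞` follows by
reflecting the interval. -/

namespace SturmLiouville

/-! ### Polynomials `∏ p ∈ S, (p - X)` -/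

/-- The polynomial `∏ p ∈ S, (p - X)`. -/
noncomputable def nodal (S : Finset ℝ) : ℝ[X] := ∏ p ∈ S, (C p - X)

lemma nodal_ne_zero (S : Finset ℝ) : nodal S ≠ 0 :=
  Finset.prod_ne_zero_iff.mpr fun p _ => Herglotz.polC_sub_X_ne_zero p

lemma mul_nodal_erase {S : Finset ℝ} {p : ℝ} (hp : p ∈ S) :
    (C p - X) * nodal (S.erase p) = nodal S := Finset.mul_prod_erase _ _ hp

lemma natDegree_C_sub_X (p : ℝ) : (C p - X : ℝ[X]).natDegree = 1 := by
  rw [← neg_sub, natDegree_neg, natDegree_X_sub_C]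

lemma leadingCoeff_C_sub_X (p : ℝ) : (C p - X : ℝ[X]).leadingCoeff = -1 := by
  rw [← neg_sub, leadingCoeff_neg, leadingCoeff_X_sub_C]

lemma natDegree_nodal (S : Finset ℝ) : (nodal S).natDegree = S.card := by
  unfold nodal
  rw [natDegree_prod _ _ fun p _ => Herglotz.polC_sub_X_ne_zero p]
  simp [natDegree_C_sub_X]

lemma leadingCoeff_nodal (S : Finset ℝ) : (nodal S).leadingCoeff = (-1) ^ S.card := by
  simp [nodal, leadingCoeff_prod, leadingCoeff_C_sub_X]

lemma degree_nodal (S : Finset ℝ) : (nodal S).degree = S.card := by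
  rw [degree_eq_natDegree (nodal_ne_zero S), natDegree_nodal]

lemma coeff_nodal_card (S : Finset ℝ) : (nodal S).coeff S.card = (-1) ^ S.card := by
  rw [← leadingCoeff_nodal, leadingCoeff, natDegree_nodal]

lemma eval_nodal (S : Finset ℝ) (l : ℝ) : (nodal S).eval l = ∏ p ∈ S, (p - l) := by
  simp [nodal, eval_prod]

lemma eval_nodal_of_mem {S : Finset ℝ} {l : ℝ} (h : l ∈ S) : (nodal S).eval l = 0 := by
  rw [eval_nodal]
  exact Finset.prod_eq_zero h (sub_self l)

lemma eval_nodal_ne_zero {S : Finset ℝ} {l : ℝ} (h : l ∉ S) : (nodal S).eval l ≠ 0 := by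
  rw [eval_nodal]
  refine Finset.prod_ne_zero_iff.mpr fun q hq => sub_ne_zero.mpr ?_
  rintro rfl
  exact h hq

lemma eval_nodal_pos {S : Finset ℝ} {l : ℝ} (h : ∀ p ∈ S, l < p) : 0 < (nodal S).eval l := by
  rw [eval_nodal]
  exact Finset.prod_pos fun q hq => sub_pos.mpr (h q hq)

lemma eval_sum_nodal_erase {S : Finset ℝ} (c : ℝ → ℝ) {l : ℝ} (h : l ∈ S) :
    (∑ p ∈ S, C (c p) * nodal (S.erase p)).eval l = c l * (nodal (S.erase l)).eval l := by
  rw [eval_finsetSum, Finset.sum_eq_single l]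
  · simp
  · intro r _ hr
    rw [eval_mul, eval_nodal_of_mem (Finset.mem_erase.mpr ⟨hr.symm, h⟩), mul_zero]
  · exact fun h' => absurd h h'

lemma degree_sum_nodal_erase_lt (S : Finset ℝ) (c : ℝ → ℝ) :
    (∑ p ∈ S, C (c p) * nodal (S.erase p)).degree < S.card := by
  refine (degree_sum_le _ _).trans_lt ((Finset.sup_lt_iff (WithBot.bot_lt_coe _)).mpr ?_)
  intro p hp
  rw [← smul_eq_C_mul]
  refine (degree_smul_le _ _).trans_lt ?_
  rw [degree_nodal]
  exact_mod_cast Finset.card_erase_lt_of_mem hp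

lemma coeff_sum_nodal_erase (S : Finset ℝ) (c : ℝ → ℝ) :
    (∑ p ∈ S, C (c p) * nodal (S.erase p)).coeff (S.card - 1) =
      (∑ p ∈ S, c p) * (-1) ^ (S.card - 1) := by
  rw [finsetSum_coeff, Finset.sum_mul]
  refine Finset.sum_congr rfl fun p hp => ?_
  rw [coeff_C_mul, ← Finset.card_erase_of_mem hp, coeff_nodal_card]

lemma aeval_nodal_ne_zero (S : Finset ℝ) {z : ℂ} (hz : z.im ≠ 0) : aeval z (nodal S) ≠ 0 := by
  unfold nodal
  rw [map_prod]
  refine Finset.prod_ne_zero_iff.mpr fun p _ h => hz ?_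
  have := congrArg Complex.im h
  simpa using this

/-- The fraction `nodal (S.erase p) / nodal S` is `1 / (p - X)`, with derivative `1 / (p - X)²`;
multiply by `nodal S ^ 2`. -/
lemma derivative_nodal_erase {S : Finset ℝ} {p : ℝ} (hp : p ∈ S) :
    derivative (nodal (S.erase p)) * nodal S - nodal (S.erase p) * derivative (nodal S) =
      nodal (S.erase p) ^ 2 := by
  rw [← mul_nodal_erase hp]
  simp only [derivative_mul, derivative_sub, derivative_C, derivative_X]
  ring

/-- A polynomial with simple real roots only is a multiple of a nodal polynomial. -/
lemma exists_eq_C_mul_nodal {N : ℝ[X]} (h0 : N ≠ 0) (hreal : ∀ z : ℂ, aeval z N = 0 → z.im = 0)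
    (hsimple : ∀ l, N.eval l = 0 → (derivative N).eval l ≠ 0) :
    ∃ (Z : Finset ℝ) (a : ℝ), a ≠ 0 ∧ N = C a * nodal Z := by
  classical
  have hsplit : N.Splits := by
    -- All complex roots are real, so the splitting over `ℂ` descends to `ℝ`.
    refine Splits.of_splits_map (algebraMap ℝ ℂ) (IsAlgClosed.splits _) fun z hz => ?_
    have hz' : aeval z N = 0 := by
      rw [mem_roots (by simpa using h0), IsRoot, eval_map_algebraMap] at hz
      exact hz
    exact ⟨z.re, by
      apply Complex.ext <;> simp [hreal z hz']⟩
  have hnodup : N.roots.Nodup := by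
    rw [Multiset.nodup_iff_count_le_one]
    intro l
    by_contra! hl
    rw [count_roots, one_lt_rootMultiplicity_iff_isRoot h0] at hl
    exact hsimple l hl.1 hl.2
  refine ⟨N.roots.toFinset, N.leadingCoeff * (-1) ^ N.roots.toFinset.card, ?_, ?_⟩
  · simpa using h0
  · have h1 : (N.roots.map fun x => X - C x).prod =
        C ((-1) ^ N.roots.toFinset.card) * nodal N.roots.toFinset := by
      have h2 : (N.roots.map fun x => X - C x).prod = ∏ x ∈ N.roots.toFinset, (X - C x) := by
        rw [Finset.prod_multiset_map_count]
        refine Finset.prod_congr rfl fun x hx => ?_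
        rw [Multiset.count_eq_one_of_mem hnodup (Multiset.mem_toFinset.mp hx), pow_one]
      rw [h2, nodal, C_pow, ← Finset.prod_const, ← Finset.prod_mul_distrib]
      refine Finset.prod_congr rfl fun x _ => ?_
      simp
    conv_lhs => rw [hsplit.eq_prod_roots, h1, ← mul_assoc, ← C_mul]

/-! ### Herglotz functions: Wronskian of numerator and denominator, reality of the zeros. -/

namespace Herglotz

lemma lead_pos (f : Herglotz) : 0 < f.lead := by
  unfold lead
  split_ifs with h
  · exact one_div_pos.mpr h
  · exact one_pos

lemma down_eq (f : Herglotz) : f.down = C f.lead * nodal f.res.support := rfl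

lemma up_eq (f : Herglotz) : f.up = (C f.slope * X + C f.const) * f.down +
    C f.lead * ∑ p ∈ f.res.support, C (f.res p) * nodal (f.res.support.erase p) := by
  simp only [up, Finset.mul_sum, C_mul, mul_assoc]
  rfl

lemma res_pos (f : Herglotz) {p : ℝ} (hp : p ∈ f.res.support) : 0 < f.res p :=
  lt_of_le_of_ne (f.res_nonneg p) (Finsupp.mem_support_iff.mp hp).symm

/-- The Wronskian of `up` and `down` as a sum of squares. -/
lemma derivative_up_mul_down_sub (f : Herglotz) :
    derivative f.up * f.down - f.up * derivative f.down =
      C (f.lead ^ 2) * (C f.slope * nodal f.res.support ^ 2 +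
        ∑ p ∈ f.res.support, C (f.res p) * nodal (f.res.support.erase p) ^ 2) := by
  have h : derivative (∑ p ∈ f.res.support, C (f.res p) * nodal (f.res.support.erase p)) *
        nodal f.res.support -
      (∑ p ∈ f.res.support, C (f.res p) * nodal (f.res.support.erase p)) *
        derivative (nodal f.res.support) =
      ∑ p ∈ f.res.support, C (f.res p) * nodal (f.res.support.erase p) ^ 2 := by
    rw [derivative_sum, Finset.sum_mul, Finset.sum_mul, ← Finset.sum_sub_distrib]
    refine Finset.sum_congr rfl fun p hp => ?_
    rw [← derivative_nodal_erase hp, derivative_C_mul]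
    ring
  rw [up_eq, down_eq, ← h]
  simp only [derivative_add, derivative_mul, derivative_C, derivative_X, C_pow]
  ring

lemma wronskian_eq (f : Herglotz) (l : ℝ) :
    wronskian f l = f.lead ^ 2 * (f.slope * (nodal f.res.support).eval l ^ 2 +
        ∑ p ∈ f.res.support, f.res p * (nodal (f.res.support.erase p)).eval l ^ 2) := by
  have := congrArg (Polynomial.eval l) f.derivative_up_mul_down_sub
  change (derivative f.up).eval l * f.down.eval l - f.up.eval l * (derivative f.down).eval l = _
  simpa [eval_finsetSum] using this

lemma wronskian_nonneg (f : Herglotz) (l : ℝ) : 0 ≤ wronskian f l := by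
  rw [wronskian_eq]
  have := f.slope_nonneg
  have h := Finset.sum_nonneg (s := f.res.support) (f := fun p =>
    f.res p * (nodal (f.res.support.erase p)).eval l ^ 2)
    fun p _ => mul_nonneg (f.res_nonneg p) (sq_nonneg _)
  positivity

lemma eval_down_pos (f : Herglotz) {l : ℝ} (h : ∀ p ∈ f.res.support, l < p) :
    0 < f.down.eval l := by
  rw [down_eq, eval_mul, eval_C]
  exact mul_pos f.lead_pos (eval_nodal_pos h)

lemma eval_up_of_mem_support (f : Herglotz) {p : ℝ} (hp : p ∈ f.res.support) :
    f.up.eval p = f.lead * (f.res p * (nodal (f.res.support.erase p)).eval p) := by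
  rw [up_eq, eval_add, eval_mul, eval_mul, eval_sum_nodal_erase _ hp, down_eq, eval_mul,
    eval_nodal_of_mem hp]
  simp

lemma eval_up (f : Herglotz) {l : ℝ} (hl : l ∉ f.res.support) :
    f.up.eval l = f.eval l * f.down.eval l := by
  have h : ∀ p ∈ f.res.support, (nodal (f.res.support.erase p)).eval l =
      (nodal f.res.support).eval l / (p - l) := by
    intro p hp
    have hpl : p - l ≠ 0 := sub_ne_zero.mpr (by rintro rfl; exact hl hp)
    rw [eq_div_iff hpl, ← mul_nodal_erase hp]
    simp [mul_comm]
  rw [up_eq, down_eq]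
  simp only [eval_add, eval_mul, eval_C, eval_X, eval_finsetSum, Herglotz.eval]
  rw [add_mul (f.slope * l + f.const), Finset.sum_mul, Finset.mul_sum]
  congr 1
  refine Finset.sum_congr rfl fun p hp => ?_
  rw [h p hp]
  ring

/-- The zeros of a nonconstant function with zero slope are real. -/
lemma im_eq_zero_of_aeval_up_eq_zero (g : Herglotz) (hne : g.res ≠ 0) {z : ℂ}
    (hz : aeval z g.up = 0) : z.im = 0 := by
  by_contra hi
  set S := g.res.support with hS
  have key : ∀ w : ℂ, aeval w g.up = g.lead * ((g.slope * w + g.const) * aeval w (nodal S) +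
      ∑ p ∈ S, (g.res p : ℂ) * aeval w (nodal (S.erase p))) := by
    intro w
    rw [up_eq, down_eq]
    simp only [map_add, map_mul, map_sum, aeval_C, aeval_X, Complex.coe_algebraMap]
    ring
  -- The coefficients are real, so the conjugate `w` of `z` is a zero as well. The difference
  -- quotient of the function at `z` and `w` would then vanish, whereas `hmain` exhibits it, up to
  -- the common denominator, as a sum of squared moduli with positive weights.
  have hw : aeval (starRingEnd ℂ z) g.up = 0 := by rw [aeval_conj, hz, map_zero]
  rw [key] at hz hw
  have hl : (g.lead : ℂ) ≠ 0 := by exact_mod_cast g.lead_pos.ne'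
  replace hz := (mul_eq_zero.mp hz).resolve_left hl
  replace hw := (mul_eq_zero.mp hw).resolve_left hl
  set w := starRingEnd ℂ z with hwz
  -- This is `1 / (p - z) - 1 / (p - w) = (z - w) / ((p - z) (p - w))`, cleared of denominators.
  have hsum : ∑ p ∈ S, (g.res p : ℂ) * (aeval z (nodal (S.erase p)) * aeval w (nodal S) -
      aeval w (nodal (S.erase p)) * aeval z (nodal S)) =
      (z - w) * ∑ p ∈ S, (g.res p : ℂ) * (aeval z (nodal (S.erase p)) *
        aeval w (nodal (S.erase p))) := by
    rw [Finset.mul_sum]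
    refine Finset.sum_congr rfl fun p hp => ?_
    rw [← mul_nodal_erase hp]
    simp only [map_mul, map_sub, aeval_C, aeval_X, Complex.coe_algebraMap]
    ring
  have hmain : (z - w) * (g.slope * (aeval z (nodal S) * aeval w (nodal S)) +
      ∑ p ∈ S, (g.res p : ℂ) * (aeval z (nodal (S.erase p)) *
        aeval w (nodal (S.erase p)))) = 0 := by
    rw [mul_add, ← hsum]
    simp only [mul_sub, Finset.sum_sub_distrib]
    have h1 := congrArg (· * aeval w (nodal S)) hz
    have h2 := congrArg (· * aeval z (nodal S)) hw
    simp only [add_mul, zero_mul, Finset.sum_mul] at h1 h2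
    have h3 : ∑ p ∈ S, (g.res p : ℂ) * (aeval z (nodal (S.erase p)) * aeval w (nodal S)) =
      ∑ p ∈ S, (g.res p : ℂ) * aeval z (nodal (S.erase p)) * aeval w (nodal S) :=
      Finset.sum_congr rfl fun p _ => (mul_assoc _ _ _).symm
    have h4 : ∑ p ∈ S, (g.res p : ℂ) * (aeval w (nodal (S.erase p)) * aeval z (nodal S)) =
      ∑ p ∈ S, (g.res p : ℂ) * aeval w (nodal (S.erase p)) * aeval z (nodal S) :=
      Finset.sum_congr rfl fun p _ => (mul_assoc _ _ _).symm
    rw [h3, h4]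
    linear_combination h1 - h2
  have hzw : z - w ≠ 0 := by
    intro h
    have := congrArg Complex.im h
    simp [hwz] at this
    exact hi this
  have hsq : ∀ q : ℝ[X], aeval z q * aeval w q = ((Complex.normSq (aeval z q) : ℝ) : ℂ) := by
    intro q
    rw [hwz, aeval_conj, Complex.mul_conj]
  simp only [hsq] at hmain
  have h0 := (mul_eq_zero.mp hmain).resolve_left hzw
  have h0' : g.slope * Complex.normSq (aeval z (nodal S)) +
      ∑ p ∈ S, g.res p * Complex.normSq (aeval z (nodal (S.erase p))) = 0 := by
    exact_mod_cast h0
  have hpos : 0 < ∑ p ∈ S, g.res p * Complex.normSq (aeval z (nodal (S.erase p))) := by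
    refine Finset.sum_pos (fun p hp => mul_pos (g.res_pos hp) ?_) ?_
    · exact Complex.normSq_pos.mpr (aeval_nodal_ne_zero _ hi)
    · exact Finsupp.support_nonempty_iff.mpr hne
  have := mul_nonneg g.slope_nonneg (Complex.normSq_nonneg (aeval z (nodal S)))
  linarith

end Herglotz

end SturmLiouville

/-! ### Divided differences, inversion, and the action of `theta` on boundary coefficients. -/

namespace SturmLiouville
namespace Herglotz

lemma lead_of_slope_eq_zero {g : Herglotz} (hs : g.slope = 0) : g.lead = 1 := by
  simp [lead, hs]

lemma up_of_slope_eq_zero {g : Herglotz} (hs : g.slope = 0) :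
    g.up = C g.const * nodal g.res.support +
      ∑ p ∈ g.res.support, C (g.res p) * nodal (g.res.support.erase p) := by
  rw [up_eq, down_eq, lead_of_slope_eq_zero hs, hs]
  simp

/-- One strictly positive term suffices. It comes from `p = l` if `l` is a pole, and from any pole
otherwise. -/
lemma wronskian_pos (g : Herglotz) (hne : g.res ≠ 0) (l : ℝ) : 0 < wronskian g l := by
  rw [wronskian_eq]
  obtain ⟨p, hp, hpl⟩ : ∃ p ∈ g.res.support, l ∉ g.res.support.erase p := by
    by_cases hl : l ∈ g.res.support
    · exact ⟨l, hl, by simp⟩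
    · obtain ⟨p, hp⟩ := Finsupp.support_nonempty_iff.mpr hne
      exact ⟨p, hp, fun h => hl (Finset.mem_of_mem_erase h)⟩
  have h1 : 0 < ∑ p ∈ g.res.support, g.res p * (nodal (g.res.support.erase p)).eval l ^ 2 := by
    refine Finset.sum_pos' (fun q _ => mul_nonneg (g.res_nonneg q) (sq_nonneg _)) ⟨p, hp, ?_⟩
    exact mul_pos (g.res_pos hp) (sq_pos_of_ne_zero (eval_nodal_ne_zero hpl))
  have h2 := mul_nonneg g.slope_nonneg (sq_nonneg ((nodal g.res.support).eval l))
  have := g.lead_pos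
  positivity

/-- Partial fractions of `k - D / (a * nodal Z)`. -/
lemma exists_down_up_of_nodal {D N : ℝ[X]} {Z : Finset ℝ} {a b : ℝ} (ha : a ≠ 0)
    (hN : N = C a * nodal Z) (hres : ∀ z ∈ Z, 0 < D.eval z * (derivative N).eval z)
    (hdeg : (-D / N).natDegree ≤ 1) (h1 : 0 ≤ (-D / N).coeff 1)
    (hlead : b * (if 0 < (-D / N).coeff 1 then 1 / (-D / N).coeff 1 else 1) = a) (k : ℝ) :
    ∃ h : Herglotz, C b * h.down = N ∧ C b * h.up = C k * N - D ∧
      h.index = 2 * (Z.card : ℤ) + (if 0 < (-D / N).coeff 1 then 1 else 0) := by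
  classical
  have hN0 : N ≠ 0 := by
    rw [hN]
    exact mul_ne_zero (by simpa using ha) (nodal_ne_zero Z)
  have hpos : ∀ z ∈ Z, 0 < D.eval z / (derivative N).eval z := by
    intro z hz
    have h := hres z hz
    have h' : (derivative N).eval z ≠ 0 := right_ne_zero_of_mul h.ne'
    rw [show D.eval z / (derivative N).eval z =
      D.eval z * (derivative N).eval z / (derivative N).eval z ^ 2 by field_simp]
    positivity
  -- `Q` is the Euclidean quotient, the polynomial part of `-D / N`. The hypotheses make it linear
  -- with nonnegative slope, and `hlead` matches the normalization of `down` with the leading factor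
  -- `a`.
  set Q := -D / N with hQ
  -- Near a simple zero `z` of `N` the principal part of `-D / N` is `(D z / N' z) / (z - X)`.
  let r : ℝ →₀ ℝ := Finsupp.onFinset Z
    (fun z => if z ∈ Z then D.eval z / (derivative N).eval z else 0) (by
      intro z hz
      by_contra h
      simp [h] at hz)
  have hr : ∀ z ∈ Z, r z = D.eval z / (derivative N).eval z := fun z hz => by simp [r, hz]
  have hr' : ∀ z, z ∉ Z → r z = 0 := fun z hz => by simp [r, hz]
  have hsupp : r.support = Z := by
    ext z
    rw [Finsupp.mem_support_iff]
    by_cases hz : z ∈ Z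
    · simp only [hz, iff_true]
      rw [hr z hz]
      exact (hpos z hz).ne'
    · simp [hz, hr' z hz]
  let h : Herglotz :=
    { slope := Q.coeff 1
      const := Q.coeff 0 + k
      res := r
      slope_nonneg := h1
      res_nonneg := fun z => by
        by_cases hz : z ∈ Z
        · rw [hr z hz]; exact (hpos z hz).le
        · rw [hr' z hz] }
  have hl : b * h.lead = a := hlead
  have hdown : C b * h.down = N := by
    rw [down_eq, ← mul_assoc, ← C_mul, hl, hN]
    change C a * nodal r.support = _
    rw [hsupp]
  refine ⟨h, hdown, ?_, ?_⟩
  -- Both sides have degree less than the cardinality of `Z` and take the value `-D z` at each `z ∈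
  -- Z`.
  · have hR : -D % N = C a * ∑ z ∈ Z, C (r z) * nodal (Z.erase z) := by
      refine eq_of_degrees_lt_of_eval_finset_eq Z ?_ ?_ fun z hz => ?_
      · refine (degree_mod_lt _ hN0).trans_eq ?_
        rw [hN, degree_C_mul ha, degree_nodal]
      · rw [degree_C_mul ha]
        exact degree_sum_nodal_erase_lt Z _
      · have hNz : N.eval z = 0 := by rw [hN, eval_mul, eval_nodal_of_mem hz, mul_zero]
        have hd := congrArg (Polynomial.eval z) (EuclideanDomain.div_add_mod (-D) N)
        rw [eval_add, eval_mul, hNz, zero_mul, zero_add, eval_neg] at hd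
        rw [hd, eval_mul, eval_sum_nodal_erase _ hz, hr z hz, eval_C]
        have hN' : (derivative N).eval z = -(a * (nodal (Z.erase z)).eval z) := by
          rw [hN, derivative_C_mul, ← mul_nodal_erase hz, derivative_mul]
          simp
        have h' : (derivative N).eval z ≠ 0 := right_ne_zero_of_mul (hres z hz).ne'
        have : a * (D.eval z / (derivative N).eval z * (nodal (Z.erase z)).eval z) =
            (a * (nodal (Z.erase z)).eval z) / (derivative N).eval z * D.eval z := by ring
        rw [this, ← neg_eq_iff_eq_neg.mpr hN', neg_div, div_self h']
        ring
    have hup : h.up = (Q + C k) * h.down + C h.lead * ∑ z ∈ Z, C (r z) * nodal (Z.erase z) := by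
      rw [up_eq]
      change (C (Q.coeff 1) * X + C (Q.coeff 0 + k)) * h.down +
        C h.lead * ∑ p ∈ r.support, C (r p) * nodal (r.support.erase p) = _
      rw [hsupp, C_add, ← add_assoc, ← eq_X_add_C_of_natDegree_le_one hdeg]
    have hdm := EuclideanDomain.div_add_mod (-D) N
    rw [hup, mul_add, ← mul_assoc (C b) (C h.lead), ← C_mul, hl, ← hR]
    linear_combination (Q + C k) * hdown + hdm
  · unfold index
    change 2 * (r.support.card : ℤ) + (if 0 < Q.coeff 1 then 1 else 0) = _
    rw [hsupp]

/-- The function `k - 1 / g` for a nonzero `g` with zero slope and nonnegative constant term. -/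
lemma exists_sub_inv (g : Herglotz) (hs : g.slope = 0) (hc : 0 ≤ g.const)
    (hne : g.const ≠ 0 ∨ g.res ≠ 0) (k : ℝ) :
    ∃ h : Herglotz, C (if 0 < g.const then g.const else 1) * h.down = g.up ∧
      C (if 0 < g.const then g.const else 1) * h.up = C k * g.up - g.down ∧
      h.index = 2 * (g.res.support.card : ℤ) - (if 0 < g.const then 0 else 1) := by
  have hdown : g.down = nodal g.res.support := by
    rw [down_eq, lead_of_slope_eq_zero hs, C_1, one_mul]
  have hup := up_of_slope_eq_zero hs
  -- At a zero of `up` the positive Wronskian reduces to `down * up'`. Hence the zeros are simple,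
  -- and `-1 / g` has positive residues.
  have hsimple : ∀ l, g.up.eval l = 0 → 0 < g.down.eval l * (derivative g.up).eval l := by
    intro l hl
    rcases eq_or_ne g.res 0 with hr | hr
    · exfalso
      rw [hup, hr] at hl
      simp [nodal] at hl
      exact (hne.resolve_right (not_not.mpr hr)) hl
    · have h := wronskian_pos g hr l
      change 0 < (derivative g.up).eval l * g.down.eval l -
        g.up.eval l * (derivative g.down).eval l at h
      rw [hl] at h
      linarith
  set S := g.res.support with hS
  have hlt := degree_sum_nodal_erase_lt S g.res
  have hcoeffS : g.up.coeff S.card = g.const * (-1) ^ S.card := by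
    rw [hup, coeff_add, coeff_C_mul, coeff_nodal_card, coeff_eq_zero_of_degree_lt hlt, add_zero]
  -- The behaviour at infinity decides. If `g` tends to a positive constant, `-1 / g` stays bounded
  -- and has as many poles as `g`. If `g` tends to zero like `-(∑ res) / X`, then `-1 / g` has slope
  -- `1 / ∑ res` and one pole fewer.
  have hcase : (0 < g.const ∧ g.up.natDegree = S.card ∧
        g.up.leadingCoeff = g.const * (-1) ^ S.card) ∨
      (g.const = 0 ∧ g.up.natDegree + 1 = S.card ∧ 0 < ∑ p ∈ S, g.res p ∧
        g.up.leadingCoeff = (∑ p ∈ S, g.res p) * (-1) ^ (S.card - 1)) := by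
    rcases hc.lt_or_eq with hc | hc
    · left
      have hle : g.up.natDegree ≤ S.card := by
        rw [hup]
        refine natDegree_add_le_of_degree_le ?_ (natDegree_le_of_degree_le hlt.le)
        exact (natDegree_C_mul_le _ _).trans (natDegree_nodal S).le
      have hnd : g.up.natDegree = S.card := by
        refine le_antisymm hle (le_natDegree_of_ne_zero ?_)
        rw [hcoeffS]
        positivity
      exact ⟨hc, hnd, by rw [leadingCoeff, hnd, hcoeffS]⟩
    · right
      have hr : g.res ≠ 0 := hne.resolve_left (not_not.mpr hc.symm)
      have hSne : S.Nonempty := Finsupp.support_nonempty_iff.mpr hr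
      have hsum : 0 < ∑ p ∈ S, g.res p := Finset.sum_pos (fun p hp => g.res_pos hp) hSne
      have hcard := Finset.card_pos.mpr hSne
      rw [← hc, C_0, zero_mul, zero_add] at hup
      have hco : g.up.coeff (S.card - 1) = (∑ p ∈ S, g.res p) * (-1) ^ (S.card - 1) := by
        rw [hup, coeff_sum_nodal_erase]
      have h0 : g.up.coeff (S.card - 1) ≠ 0 := by
        rw [hco]
        positivity
      have hu0 : g.up ≠ 0 := by
        intro h
        simp [h] at h0
      have hlt' : g.up.natDegree < S.card := by
        rw [natDegree_lt_iff_degree_lt hu0, hup]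
        exact hlt
      have hge := le_natDegree_of_ne_zero h0
      have hnd : g.up.natDegree = S.card - 1 := by omega
      exact ⟨hc.symm, by omega, hsum, by rw [leadingCoeff, hnd, hco]⟩
  have hu0 : g.up ≠ 0 := by
    rw [← leadingCoeff_ne_zero]
    rcases hcase with ⟨h, -, h'⟩ | ⟨-, -, h, h'⟩ <;> rw [h'] <;> positivity
  obtain ⟨Z, a, ha, hZ⟩ := exists_eq_C_mul_nodal hu0 (fun z hz => by
    rcases eq_or_ne g.res 0 with hr | hr
    · exfalso
      rw [hup, hS, hr] at hz
      simp [nodal] at hz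
      exact (hne.resolve_right (not_not.mpr hr)) hz
    · exact g.im_eq_zero_of_aeval_up_eq_zero hr hz) fun l hl =>
      right_ne_zero_of_mul (hsimple l hl).ne'
  have hnd : g.up.natDegree = Z.card := by
    rw [hZ, natDegree_C_mul ha, natDegree_nodal]
  have hlc : g.up.leadingCoeff = a * (-1) ^ Z.card := by
    rw [hZ, leadingCoeff_mul, leadingCoeff_C, leadingCoeff_nodal]
  have hres : ∀ z ∈ Z, 0 < g.down.eval z * (derivative g.up).eval z := by
    intro z hz
    refine hsimple z ?_
    rw [hZ, eval_mul, eval_nodal_of_mem hz, mul_zero]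
  have hle : g.up.degree ≤ (-g.down).degree := by
    rw [degree_neg, hdown, degree_nodal, degree_eq_natDegree hu0]
    rcases hcase with ⟨-, h, -⟩ | ⟨-, h, -, -⟩
    · exact_mod_cast h.le
    · exact_mod_cast (by omega : g.up.natDegree ≤ S.card)
  have hdd : g.up.natDegree + (-g.down / g.up).natDegree = S.card := by
    have h := degree_add_div hu0 hle
    rw [degree_neg, hdown, degree_nodal] at h
    have hQ0 : -nodal S / g.up ≠ 0 := by
      intro h'
      rw [h', degree_zero, WithBot.add_bot] at h
      exact absurd h WithBot.bot_ne_coe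
    rw [degree_eq_natDegree hu0, degree_eq_natDegree hQ0, ← hdown] at h
    exact_mod_cast h
  rcases hcase with ⟨hpos, h1, h2⟩ | ⟨hzero, h1, hsum, h2⟩
  · have hZS : Z.card = S.card := by omega
    have ha' : a = g.const := by
      rw [hlc, hZS] at h2
      exact mul_right_cancel₀ (by positivity) h2
    have hQ1 : (-g.down / g.up).coeff 1 = 0 := coeff_eq_zero_of_natDegree_lt (by omega)
    obtain ⟨h, hh1, hh2, hh3⟩ := exists_down_up_of_nodal (b := g.const) ha hZ hres (by omega)
      hQ1.ge (by simp [hQ1, ha']) k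
    refine ⟨h, ?_, ?_, ?_⟩
    · rwa [if_pos hpos]
    · rwa [if_pos hpos]
    · rw [hh3, hQ1, hZS]
      simp [hpos]
  · have hZS : Z.card + 1 = S.card := by omega
    have hZS' : S.card - 1 = Z.card := by omega
    have ha' : a = ∑ p ∈ S, g.res p := by
      rw [hlc, hZS'] at h2
      exact mul_right_cancel₀ (by positivity) h2
    have hQ1 : (-g.down / g.up).coeff 1 = 1 / a := by
      have hQ : (-g.down / g.up).natDegree = 1 := by omega
      have := leadingCoeff_div (p := -g.down) (q := g.up) hle
      rw [leadingCoeff, hQ, leadingCoeff_neg, hdown, leadingCoeff_nodal, hlc, ← hZS, pow_succ] at this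
      rw [hdown, this]
      field_simp
    have hapos : 0 < a := ha' ▸ hsum
    have hQpos : 0 < (-g.down / g.up).coeff 1 := by rw [hQ1]; positivity
    obtain ⟨h, hh1, hh2, hh3⟩ := exists_down_up_of_nodal (b := 1) ha hZ hres (by omega)
      hQpos.le (by rw [if_pos hQpos, hQ1]; simp) k
    refine ⟨h, ?_, ?_, ?_⟩
    · rwa [if_neg hzero.not_gt]
    · rwa [if_neg hzero.not_gt]
    · rw [hh3, if_pos hQpos, if_neg hzero.not_gt, ← hZS]
      push_cast
      ring

/-- The divided difference `(f - f(m)) / (X - m)`. -/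
lemma exists_divided_difference (f : Herglotz) {m : ℝ} (hm : ∀ p ∈ f.res.support, m < p) :
    ∃ g : Herglotz, g.slope = 0 ∧ g.const = f.slope ∧ g.res.support = f.res.support ∧
      f.up - C (f.eval m) * f.down = C f.lead * ((X - C m) * g.up) := by
  -- From `1 / (p - X) - 1 / (p - m) = (X - m) / ((p - m) (p - X))`. The new residue is positive
  -- because `m < p`.
  let r : ℝ →₀ ℝ := Finsupp.onFinset f.res.support (fun p => f.res p / (p - m)) (by
    intro p hp
    rw [Finsupp.mem_support_iff]
    intro h
    simp [h] at hp)
  have hr : ∀ p, r p = f.res p / (p - m) := fun p => rfl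
  have hsupp : r.support = f.res.support := by
    ext p
    constructor
    · intro hp
      rw [Finsupp.mem_support_iff] at hp ⊢
      intro h
      simp [hr, h] at hp
    · intro hp
      rw [Finsupp.mem_support_iff, hr]
      exact div_ne_zero (f.res_pos hp).ne' (sub_pos.mpr (hm p hp)).ne'
  let g : Herglotz :=
    { slope := 0
      const := f.slope
      res := r
      slope_nonneg := le_rfl
      res_nonneg := fun p => by
        by_cases hp : p ∈ f.res.support
        · exact div_nonneg (f.res_nonneg p) (sub_pos.mpr (hm p hp)).le
        · rw [hr, Finsupp.notMem_support_iff.mp hp, zero_div] }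
  refine ⟨g, rfl, rfl, hsupp, ?_⟩
  have hgup : g.up = C f.slope * nodal f.res.support +
      ∑ p ∈ f.res.support, C (f.res p / (p - m)) * nodal (f.res.support.erase p) := by
    rw [up_of_slope_eq_zero (g := g) rfl]
    change C f.slope * nodal r.support + ∑ p ∈ r.support, C (r p) * nodal (r.support.erase p) = _
    rw [hsupp]
    rfl
  have hsum : ∑ p ∈ f.res.support, C (f.res p) * nodal (f.res.support.erase p) -
      C (∑ p ∈ f.res.support, f.res p / (p - m)) * nodal f.res.support =
      (X - C m) * ∑ p ∈ f.res.support, C (f.res p / (p - m)) * nodal (f.res.support.erase p) := by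
    rw [map_sum, Finset.sum_mul, Finset.mul_sum, ← Finset.sum_sub_distrib]
    refine Finset.sum_congr rfl fun p hp => ?_
    have hpm : p - m ≠ 0 := (sub_pos.mpr (hm p hp)).ne'
    have : C (f.res p) = C (f.res p / (p - m)) * (C p - C m) := by
      rw [← C_sub, ← C_mul, div_mul_cancel₀ _ hpm]
    rw [← mul_nodal_erase hp, this]
    ring
  rw [up_eq, hgup, down_eq, Herglotz.eval]
  simp only [C_add, C_mul]
  linear_combination C f.lead * hsum

end Herglotz

/-- The factor by which `theta` multiplies the denominator. -/
noncomputable def thetaFactor (m : ℝ) : OnePoint Herglotz → ℝ[X]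
  | ∞ => -1
  | OnePoint.some _ => X - C m

/-- The transformation `theta` acts on the boundary coefficients and changes the index by one. -/
theorem exists_theta (f : OnePoint Herglotz) (m t k : ℝ)
    (hf : ∀ g : Herglotz, f = (g : OnePoint Herglotz) →
      (∀ p ∈ g.res.support, m < p) ∧ g.eval m = t) :
    ∃ f' : OnePoint Herglotz, toRat f' = theta m t k (toRat f) ∧ index f - index f' = expI f ∧
      up f - C t * down f = thetaFactor m f * down f' ∧
      up f' = -down f + C k * down f' := by
  induction f using OnePoint.rec with
  | infty =>
    let h : Herglotz := ⟨0, k, 0, le_rfl, fun _ => le_rfl⟩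
    have hd : h.down = 1 := by simp [h, Herglotz.down, Herglotz.lead]
    have hu : h.up = C k := by simp [h, Herglotz.up, Herglotz.down, Herglotz.lead]
    refine ⟨(h : OnePoint Herglotz), ?_, ?_, ?_, ?_⟩
    · simp [toRat, theta, Herglotz.toRatFunc, h]
    · simp [index, Herglotz.index, expI, h]
    · change (-1 : ℝ[X]) - C t * 0 = -1 * h.down
      rw [hd]; ring
    · change h.up = -0 + C k * h.down
      rw [hd, hu]; ring
  | coe f =>
    obtain ⟨hm, ht⟩ := hf f rfl
    obtain ⟨g, hg0, hgc, hgs, hfg⟩ := f.exists_divided_difference hm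
    rw [ht] at hfg
    -- The constant of the divided difference is the slope of `f`, so the normalizing factor from
    -- `exists_sub_inv` cancels `f.lead`.
    have hlead : f.lead * (if 0 < g.const then g.const else 1) = 1 := by
      rw [hgc, Herglotz.lead]
      split_ifs with h
      · field_simp
      · norm_num
    -- If the divided difference is not zero, `theta` is `k - 1 / g`. If it is zero, `f` is the
    -- constant `t` and `theta` gives `∞`.
    by_cases hne : g.const ≠ 0 ∨ g.res ≠ 0
    · obtain ⟨h, h1, h2, h3⟩ := g.exists_sub_inv hg0 (hgc ▸ f.slope_nonneg) hne k
      have hdown : h.down = C f.lead * g.up := by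
        rw [← h1, ← mul_assoc, ← C_mul, hlead, C_1, one_mul]
      have hgd : g.down = nodal f.res.support := by
        rw [Herglotz.down_eq, Herglotz.lead_of_slope_eq_zero hg0, hgs, C_1, one_mul]
      have hup : h.up = -f.down + C k * h.down := by
        have : h.up = C f.lead * (C k * g.up - g.down) := by
          rw [← h2, ← mul_assoc, ← C_mul, hlead, C_1, one_mul]
        rw [this, hdown, hgd, Herglotz.down_eq]
        ring
      have hrel : f.up - C t * f.down = (X - C m) * h.down := by
        rw [hfg, hdown]
        ring
      refine ⟨(h : OnePoint Herglotz), ?_, ?_, hrel, hup⟩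
      · have hd0 := RatFunc.algebraMap_ne_zero f.down_ne_zero
        have hh0 := RatFunc.algebraMap_ne_zero h.down_ne_zero
        have hX0 : (algebraMap ℝ[X] (RatFunc ℝ)) (X - C m) ≠ 0 :=
          RatFunc.algebraMap_ne_zero (X_sub_C_ne_zero m)
        have hft : f.toRatFunc - RatFunc.C t = algebraMap ℝ[X] (RatFunc ℝ) (X - C m) *
            algebraMap ℝ[X] (RatFunc ℝ) h.down / algebraMap ℝ[X] (RatFunc ℝ) f.down := by
          rw [f.toRatFunc_eq_div, eq_div_iff hd0, sub_mul, div_mul_cancel₀ _ hd0, ← map_mul, ← hrel]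
          simp
        have hne' : f.toRatFunc ≠ RatFunc.C t := by
          rw [← sub_ne_zero, hft]
          exact div_ne_zero (mul_ne_zero hX0 hh0) hd0
        simp only [toRat, OnePoint.map_some, theta, if_neg hne']
        congr 1
        rw [hft, h.toRatFunc_eq_div, hup]
        have : RatFunc.C m - RatFunc.X = -(algebraMap ℝ[X] (RatFunc ℝ)) (X - C m) := by simp
        rw [this, map_add, map_mul, map_neg, RatFunc.algebraMap_C]
        field_simp
      · change f.index - h.index = _
        rw [h3, hgs, hgc, Herglotz.index]
        simp only [expI, ne_eq, OnePoint.coe_ne_infty, not_false_eq_true, if_true]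
        split_ifs <;> ring
    · push Not at hne
      have hs0 : f.slope = 0 := hgc ▸ hne.1
      have hr0 : f.res = 0 := by
        rw [← Finsupp.support_eq_empty, ← hgs, hne.2, Finsupp.support_zero]
      have hgu : g.up = 0 := by
        rw [Herglotz.up_of_slope_eq_zero hg0, hne.1, hne.2]
        simp
      have hfd : f.down = 1 := by simp [Herglotz.down, Herglotz.lead, hs0, hr0]
      rw [hgu, mul_zero, mul_zero, hfd] at hfg
      refine ⟨∞, ?_, ?_, ?_, ?_⟩
      · have : f.toRatFunc = RatFunc.C t := by
          rw [f.toRatFunc_eq_div, hfd, map_one, div_one, sub_eq_zero.mp hfg, mul_one,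
            RatFunc.algebraMap_C]
        simp [toRat, theta, this]
      · change f.index - (-1) = _
        simp [Herglotz.index, hs0, hr0, expI]
      · change f.up - C t * f.down = (X - C m) * 0
        rw [hfd, hfg, mul_zero]
      · change (-1 : ℝ[X]) = -f.down + C k * 0
        rw [hfd, mul_zero, add_zero]

end SturmLiouville

/-! ### Absolutely continuous functions -/

namespace AbsolutelyContinuousOnInterval

variable {a b : ℝ}

lemma of_dist_le {X Y : Type*} [PseudoMetricSpace X] [PseudoMetricSpace Y] {f : ℝ → X} {g : ℝ → Y}
    (hf : AbsolutelyContinuousOnInterval f a b) {K : ℝ} (hK : 0 ≤ K)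
    (h : ∀ x ∈ uIcc a b, ∀ y ∈ uIcc a b, dist (g x) (g y) ≤ K * dist (f x) (f y)) :
    AbsolutelyContinuousOnInterval g a b := by
  rw [absolutelyContinuousOnInterval_iff] at hf ⊢
  intro ε hε
  -- `K + 1` avoids a separate case `K = 0` and makes the final inequality strict.
  obtain ⟨δ, hδ, hδ'⟩ := hf (ε / (K + 1)) (by positivity)
  refine ⟨δ, hδ, fun E hE hlt => ?_⟩
  have h1 := hδ' E hE hlt
  calc ∑ i ∈ Finset.range E.1, dist (g (E.2 i).1) (g (E.2 i).2)
      ≤ ∑ i ∈ Finset.range E.1, K * dist (f (E.2 i).1) (f (E.2 i).2) :=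
        Finset.sum_le_sum fun i hi => h _ (hE.1 i hi).1 _ (hE.1 i hi).2
    _ = K * ∑ i ∈ Finset.range E.1, dist (f (E.2 i).1) (f (E.2 i).2) := by rw [Finset.mul_sum]
    _ ≤ K * (ε / (K + 1)) := by gcongr
    _ < (K + 1) * (ε / (K + 1)) := by gcongr; linarith
    _ = ε := by field_simp

lemma congr {X : Type*} [PseudoMetricSpace X] {f g : ℝ → X}
    (hf : AbsolutelyContinuousOnInterval f a b) (h : ∀ x ∈ uIcc a b, g x = f x) :
    AbsolutelyContinuousOnInterval g a b :=
  hf.of_dist_le zero_le_one fun x hx y hy => by rw [h x hx, h y hy, one_mul]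

lemma const {X : Type*} [PseudoMetricSpace X] (c : X) :
    AbsolutelyContinuousOnInterval (fun _ => c) a b :=
  (LipschitzOnWith.of_dist_le_mul (K := 0) (by simp)).absolutelyContinuousOnInterval

lemma ofReal {𝕜 : Type*} [RCLike 𝕜] {f : ℝ → ℝ} (hf : AbsolutelyContinuousOnInterval f a b) :
    AbsolutelyContinuousOnInterval (fun x => (f x : 𝕜)) a b :=
  hf.of_dist_le zero_le_one fun x _ y _ => by
    rw [dist_eq_norm, ← RCLike.ofReal_sub, RCLike.norm_ofReal, Real.dist_eq, one_mul]

lemma fun_mul' {𝕜 : Type*} [RCLike 𝕜] {f g : ℝ → 𝕜} (hf : AbsolutelyContinuousOnInterval f a b)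
    (hg : AbsolutelyContinuousOnInterval g a b) :
    AbsolutelyContinuousOnInterval (fun x => f x * g x) a b := hf.fun_smul hg

lemma fun_add' {𝕜 : Type*} [RCLike 𝕜] {f g : ℝ → 𝕜} (hf : AbsolutelyContinuousOnInterval f a b)
    (hg : AbsolutelyContinuousOnInterval g a b) :
    AbsolutelyContinuousOnInterval (fun x => f x + g x) a b := hf.fun_add hg

lemma fun_sub' {𝕜 : Type*} [RCLike 𝕜] {f g : ℝ → 𝕜} (hf : AbsolutelyContinuousOnInterval f a b)
    (hg : AbsolutelyContinuousOnInterval g a b) :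
    AbsolutelyContinuousOnInterval (fun x => f x - g x) a b := hf.fun_sub hg

/-- The image of `f` is a compact interval, on which a `C¹` function is Lipschitz. -/
lemma comp_contDiffOn {f φ : ℝ → ℝ} (hf : AbsolutelyContinuousOnInterval f a b)
    (hφ : ContDiffOn ℝ 1 φ (f '' uIcc a b)) :
    AbsolutelyContinuousOnInterval (fun x => φ (f x)) a b := by
  have hconv : Convex ℝ (f '' uIcc a b) :=
    (isPreconnected_uIcc.image f hf.continuousOn).ordConnected.convex
  obtain ⟨K, hK⟩ := hφ.exists_lipschitzOnWith (by decide) hconv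
    (isCompact_uIcc.image_of_continuousOn hf.continuousOn)
  exact hf.of_dist_le K.2 fun x hx y hy =>
    hK.dist_le_mul _ (mem_image_of_mem f hx) _ (mem_image_of_mem f hy)

lemma exp {f : ℝ → ℝ} (hf : AbsolutelyContinuousOnInterval f a b) :
    AbsolutelyContinuousOnInterval (fun x => Real.exp (f x)) a b :=
  hf.comp_contDiffOn Real.contDiff_exp.contDiffOn

lemma log {f : ℝ → ℝ} (hf : AbsolutelyContinuousOnInterval f a b)
    (h0 : ∀ x ∈ uIcc a b, f x ≠ 0) :
    AbsolutelyContinuousOnInterval (fun x => Real.log (f x)) a b :=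
  hf.comp_contDiffOn fun y hy => by
    obtain ⟨x, hx, rfl⟩ := hy
    exact (Real.contDiffAt_log.mpr (h0 x hx)).contDiffWithinAt

lemma inv {f : ℝ → ℝ} (hf : AbsolutelyContinuousOnInterval f a b)
    (h0 : ∀ x ∈ uIcc a b, f x ≠ 0) :
    AbsolutelyContinuousOnInterval (fun x => (f x)⁻¹) a b :=
  hf.comp_contDiffOn fun y hy => by
    obtain ⟨x, hx, rfl⟩ := hy
    exact (contDiffAt_inv ℝ (h0 x hx)).contDiffWithinAt

lemma fun_div {f g : ℝ → ℝ} (hf : AbsolutelyContinuousOnInterval f a b)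
    (hg : AbsolutelyContinuousOnInterval g a b) (h0 : ∀ x ∈ uIcc a b, g x ≠ 0) :
    AbsolutelyContinuousOnInterval (fun x => f x / g x) a b := by
  simpa only [div_eq_mul_inv] using hf.fun_mul (hg.inv h0)

lemma mono_Icc {X : Type*} [PseudoMetricSpace X] {f : ℝ → X} {c d : ℝ}
    (hf : AbsolutelyContinuousOnInterval f a b) (hc : a ≤ c) (hcd : c ≤ d) (hd : d ≤ b) :
    AbsolutelyContinuousOnInterval f c d := by
  refine hf.mono ?_
  rw [uIcc_of_le hcd, uIcc_of_le (hc.trans (hcd.trans hd))]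
  exact Icc_subset_Icc hc hd

lemma ae_eq_deriv {f f' : ℝ → ℝ} (hab : a ≤ b)
    (h : ∀ᵐ x ∂volume.restrict (Ioo a b), HasDerivAt f (f' x) x) :
    deriv f =ᵐ[volume.restrict (uIoc a b)] f' := by
  rw [uIoc_of_le hab, ← Measure.restrict_congr_set Ioo_ae_eq_Ioc]
  filter_upwards [h] with x hx using hx.deriv

lemma intervalIntegrable_of_hasDerivAt {f f' : ℝ → ℝ} (hf : AbsolutelyContinuousOnInterval f a b)
    (hab : a ≤ b) (h : ∀ᵐ x ∂volume.restrict (Ioo a b), HasDerivAt f (f' x) x) :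
    IntervalIntegrable f' volume a b :=
  hf.intervalIntegrable_deriv.congr_ae (ae_eq_deriv hab h)

lemma integral_eq_sub {f f' : ℝ → ℝ} (hf : AbsolutelyContinuousOnInterval f a b)
    (hab : a ≤ b) (h : ∀ᵐ x ∂volume.restrict (Ioo a b), HasDerivAt f (f' x) x) :
    ∫ x in a..b, f' x = f b - f a := by
  rw [← hf.integral_deriv_eq_sub]
  exact (intervalIntegral.integral_congr_ae_restrict (ae_eq_deriv hab h)).symm

lemma le_of_hasDerivAt_nonneg {f f' : ℝ → ℝ} (hf : AbsolutelyContinuousOnInterval f a b)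
    (hab : a ≤ b) (h : ∀ᵐ x ∂volume.restrict (Ioo a b), HasDerivAt f (f' x) x)
    (h0 : ∀ᵐ x ∂volume.restrict (Ioo a b), 0 ≤ f' x) : f a ≤ f b := by
  rw [← sub_nonneg, ← hf.integral_eq_sub hab h, intervalIntegral.integral_of_le hab,
    ← setIntegral_congr_set Ioo_ae_eq_Ioc]
  exact integral_nonneg_of_ae h0

lemma eq_const_of_hasDerivAt_zero {E : Type*} [NormedAddCommGroup E] [NormedSpace ℝ E] {f : ℝ → E}
    (hf : AbsolutelyContinuousOnInterval f a b) (hab : a ≤ b)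
    (h : ∀ᵐ x ∂volume.restrict (Ioo a b), HasDerivAt f 0 x) : ∀ x ∈ Icc a b, f x = f a := by
  have h' : ∀ᵐ x, x ∈ uIcc a b → HasDerivAt f 0 x := by
    rw [uIcc_of_le hab, ← ae_restrict_iff' measurableSet_Icc,
      ← Measure.restrict_congr_set Ioo_ae_eq_Icc]
    exact h
  obtain ⟨C, hC⟩ := hf.const_of_ae_hasDerivAt_zero h'
  rw [uIcc_of_le hab] at hC
  intro x hx
  rw [hC x hx, hC a ⟨le_rfl, hab⟩]

end AbsolutelyContinuousOnInterval

/-! ### Grönwall inequalities. -/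

namespace SturmLiouville

lemma ae_restrict_Ioo_mono {P : ℝ → Prop} {a b c d : ℝ} (hc : a ≤ c) (hd : d ≤ b)
    (h : ∀ᵐ x ∂volume.restrict (Ioo a b), P x) : ∀ᵐ x ∂volume.restrict (Ioo c d), P x :=
  ae_restrict_of_ae_restrict_of_subset (Ioo_subset_Ioo hc hd) h

lemma ae_hasDerivAt_integral {f : ℝ → ℝ} {a b c : ℝ} (hab : a ≤ b) (hc : c ∈ Icc a b)
    (hf : IntervalIntegrable f volume a b) :
    ∀ᵐ x ∂volume.restrict (Ioo a b), HasDerivAt (fun x => ∫ t in c..x, f t) (f x) x := by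
  rw [ae_restrict_iff' measurableSet_Ioo]
  filter_upwards [hf.ae_hasDerivAt_integral] with x hx hx'
  rw [uIcc_of_le hab] at hx
  exact hx (Ioo_subset_Icc_self hx') c hc

/-- Grönwall's inequality for absolutely continuous functions. -/
lemma gronwall {E E' K h : ℝ → ℝ} {a b : ℝ} (hab : a ≤ b)
    (hE : AbsolutelyContinuousOnInterval E a b)
    (hE' : ∀ᵐ x ∂volume.restrict (Ioo a b), HasDerivAt E (E' x) x)
    (hK : IntervalIntegrable K volume a b) (hh : IntervalIntegrable h volume a b)
    (hK0 : ∀ x, 0 ≤ K x) (hh0 : ∀ x, 0 ≤ h x)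
    (hle : ∀ᵐ x ∂volume.restrict (Ioo a b), E' x ≤ K x * E x + h x) :
    E b ≤ Real.exp (∫ x in a..b, K x) * (E a + ∫ x in a..b, h x) := by
  have ha : a ∈ Icc a b := ⟨le_rfl, hab⟩
  have ha' : a ∈ uIcc a b := left_mem_uIcc
  set G : ℝ → ℝ := fun x => ∫ t in a..x, K t with hG
  set H : ℝ → ℝ := fun x => ∫ t in a..x, h t with hH
  have hGac : AbsolutelyContinuousOnInterval G a b :=
    hK.absolutelyContinuousOnInterval_intervalIntegral ha'
  have hHac : AbsolutelyContinuousOnInterval H a b :=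
    hh.absolutelyContinuousOnInterval_intervalIntegral ha'
  -- This function is nondecreasing: its derivative is at least `h (1 - exp (-G))`, and `G ≥ 0`. No
  -- sign of `E` is needed.
  have hac : AbsolutelyContinuousOnInterval (fun x => H x - E x * Real.exp (-G x)) a b :=
    hHac.fun_sub (hE.fun_mul hGac.fun_neg.exp)
  have hGnn : ∀ x ∈ Ioo a b, 0 ≤ G x := fun x hx =>
    intervalIntegral.integral_nonneg_of_forall hx.1.le hK0
  have key := hac.le_of_hasDerivAt_nonneg hab
    (f' := fun x => h x - (E' x * Real.exp (-G x) + E x * (Real.exp (-G x) * -K x)))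
    (by
      filter_upwards [hE', ae_hasDerivAt_integral hab ha hK, ae_hasDerivAt_integral hab ha hh]
        with x h1 h2 h3
      exact h3.sub (h1.mul h2.neg.exp))
    (by
      filter_upwards [hle, ae_restrict_mem measurableSet_Ioo] with x h1 hx
      have h2 : Real.exp (-G x) ≤ 1 := Real.exp_le_one_iff.mpr (neg_nonpos.mpr (hGnn x hx))
      have h3 := Real.exp_pos (-G x)
      have h4 := mul_le_mul_of_nonneg_right h1 h3.le
      have h5 := mul_le_mul_of_nonneg_left h2 (hh0 x)
      nlinarith)
  have hGa : G a = 0 := intervalIntegral.integral_same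
  have hHa : H a = 0 := intervalIntegral.integral_same
  simp only [hGa, hHa, neg_zero, Real.exp_zero, mul_one, zero_sub] at key
  have h6 : E b * Real.exp (-G b) ≤ E a + H b := by linarith
  rw [Real.exp_neg, ← div_eq_mul_inv, div_le_iff₀ (Real.exp_pos _)] at h6
  linarith

/-- Grönwall's inequality, backwards. -/
lemma gronwall_backward {E E' K : ℝ → ℝ} {a b : ℝ} (hab : a ≤ b)
    (hE : AbsolutelyContinuousOnInterval E a b)
    (hE' : ∀ᵐ x ∂volume.restrict (Ioo a b), HasDerivAt E (E' x) x)
    (hK : IntervalIntegrable K volume a b)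
    (hle : ∀ᵐ x ∂volume.restrict (Ioo a b), -(K x * E x) ≤ E' x) :
    E a ≤ E b * Real.exp (∫ x in a..b, K x) := by
  have ha : a ∈ Icc a b := ⟨le_rfl, hab⟩
  set G : ℝ → ℝ := fun x => ∫ t in a..x, K t with hG
  have hGac : AbsolutelyContinuousOnInterval G a b :=
    hK.absolutelyContinuousOnInterval_intervalIntegral left_mem_uIcc
  have key := (hE.fun_mul hGac.exp).le_of_hasDerivAt_nonneg hab
    (f' := fun x => E' x * Real.exp (G x) + E x * (Real.exp (G x) * K x))
    (by
      filter_upwards [hE', ae_hasDerivAt_integral hab ha hK] with x h1 h2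
      exact h1.mul h2.exp)
    (by
      filter_upwards [hle] with x h1
      have := mul_le_mul_of_nonneg_right h1 (Real.exp_pos (G x)).le
      linarith)
  have hGa : G a = 0 := intervalIntegral.integral_same
  simpa [hGa] using key

end SturmLiouville

namespace SturmLiouville

/-! ### Square integrable coefficients -/

lemma intervalIntegrable_of_memLp {s : ℝ → ℝ} (hs : MemLp s 2 (volume.restrict (Ioo 0 Real.pi))) :
    IntervalIntegrable s volume 0 Real.pi := by
  rw [intervalIntegrable_iff_integrableOn_Ioo_of_le Real.pi_pos.le]
  exact hs.integrable one_le_two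

lemma intervalIntegrable_sq_of_memLp {s : ℝ → ℝ}
    (hs : MemLp s 2 (volume.restrict (Ioo 0 Real.pi))) :
    IntervalIntegrable (fun x => s x ^ 2) volume 0 Real.pi := by
  rw [intervalIntegrable_iff_integrableOn_Ioo_of_le Real.pi_pos.le]
  exact hs.integrable_sq

lemma IntervalIntegrable.mono_Icc {f : ℝ → ℝ} {a b : ℝ}
    (hf : IntervalIntegrable f volume 0 Real.pi) (ha : 0 ≤ a) (hab : a ≤ b) (hb : b ≤ Real.pi) :
    IntervalIntegrable f volume a b := by
  refine IntervalIntegrable.mono_set hf ?_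
  rw [uIcc_of_le hab, uIcc_of_le Real.pi_pos.le]
  exact Icc_subset_Icc ha hb

lemma disjoint_uIoc_sub_left {a b c d : ℝ} (e : ℝ) (h : Disjoint (uIoc a b) (uIoc c d)) :
    Disjoint (uIoc (e - a) (e - b)) (uIoc (e - c) (e - d)) := by
  simp only [uIoc, Ioc_disjoint_Ioc, min_sub_sub_left, max_sub_sub_left] at h ⊢
  exact sub_le_sub_left h e

/-! ### Linearity of the equation -/

namespace IsSolution

section
variable {𝕜 : Type*} [RCLike 𝕜] {s : ℝ → ℝ} {z : 𝕜} {y y₁ w w₁ : ℝ → 𝕜}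

lemma sub (h : IsSolution s z y y₁) (h' : IsSolution s z w w₁) :
    IsSolution s z (fun x => y x - w x) (fun x => y₁ x - w₁ x) where
  ac := h.ac.fun_sub h'.ac
  ac_quasi := h.ac_quasi.fun_sub h'.ac_quasi
  deriv_eq := by
    filter_upwards [h.deriv_eq, h'.deriv_eq] with x h1 h2
    exact (h1.sub h2).congr_deriv (by ring)
  deriv_quasi_eq := by
    filter_upwards [h.deriv_quasi_eq, h'.deriv_quasi_eq] with x h1 h2
    exact (h1.sub h2).congr_deriv (by ring)

lemma const_mul (c : 𝕜) (h : IsSolution s z y y₁) :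
    IsSolution s z (fun x => c * y x) (fun x => c * y₁ x) where
  ac := AbsolutelyContinuousOnInterval.const c |>.fun_mul' h.ac
  ac_quasi := AbsolutelyContinuousOnInterval.const c |>.fun_mul' h.ac_quasi
  deriv_eq := by
    filter_upwards [h.deriv_eq] with x h1
    exact (h1.const_mul c).congr_deriv (by ring)
  deriv_quasi_eq := by
    filter_upwards [h.deriv_quasi_eq] with x h1
    exact (h1.const_mul c).congr_deriv (by ring)

lemma continuousOn (h : IsSolution s z y y₁) : ContinuousOn y (Icc 0 Real.pi) := by
  have := h.ac.continuousOn
  rwa [uIcc_of_le Real.pi_pos.le] at this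

lemma continuousOn_quasi (h : IsSolution s z y y₁) : ContinuousOn y₁ (Icc 0 Real.pi) := by
  have := h.ac_quasi.continuousOn
  rwa [uIcc_of_le Real.pi_pos.le] at this

/-- If a solution vanishes identically, then so does its quasi-derivative. -/
lemma quasi_eq_zero (h : IsSolution s z y y₁) (h0 : ∀ x ∈ Icc 0 Real.pi, y x = 0) :
    ∀ x ∈ Icc 0 Real.pi, y₁ x = 0 := by
  have hae : y₁ =ᵐ[volume.restrict (Icc 0 Real.pi)] fun _ => 0 := by
    rw [← Measure.restrict_congr_set Ioo_ae_eq_Icc]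
    filter_upwards [h.deriv_eq, ae_restrict_mem measurableSet_Ioo] with x h1 hx
    have h2 : y =ᶠ[nhds x] fun _ => 0 := by
      filter_upwards [Ioo_mem_nhds hx.1 hx.2] with t ht using h0 t (Ioo_subset_Icc_self ht)
    have h3 := (h1.congr_of_eventuallyEq h2.symm).unique (hasDerivAt_const x (0 : 𝕜))
    rwa [h0 x (Ioo_subset_Icc_self hx), mul_zero, add_zero] at h3
  exact Measure.eqOn_Icc_of_ae_eq volume Real.pi_pos.ne hae h.continuousOn_quasi continuousOn_const

end

lemma ofReal {𝕜 : Type*} [RCLike 𝕜] {s : ℝ → ℝ} {l : ℝ} {y y₁ : ℝ → ℝ}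
    (h : IsSolution s l y y₁) :
    IsSolution s (l : 𝕜) (fun x => (y x : 𝕜)) (fun x => (y₁ x : 𝕜)) where
  ac := h.ac.ofReal
  ac_quasi := h.ac_quasi.ofReal
  deriv_eq := by
    filter_upwards [h.deriv_eq] with x h1
    refine ((RCLike.ofRealCLM (K := 𝕜)).hasFDerivAt.comp_hasDerivAt x h1).congr_deriv ?_
    simp
  deriv_quasi_eq := by
    filter_upwards [h.deriv_quasi_eq] with x h1
    refine ((RCLike.ofRealCLM (K := 𝕜)).hasFDerivAt.comp_hasDerivAt x h1).congr_deriv ?_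
    simp

/-- Reflection of the interval. -/
lemma reflect {𝕜 : Type*} [RCLike 𝕜] {s : ℝ → ℝ} {z : 𝕜} {y y₁ : ℝ → 𝕜}
    (h : IsSolution s z y y₁) :
    IsSolution (fun x => -s (Real.pi - x)) z (fun x => y (Real.pi - x))
      (fun x => -y₁ (Real.pi - x)) := by
  have hae : ∀ {P : ℝ → Prop}, (∀ᵐ x ∂volume.restrict (Ioo 0 Real.pi), P x) →
      ∀ᵐ x ∂volume.restrict (Ioo 0 Real.pi), P (Real.pi - x) := by
    intro P hP
    have hmp : MeasurePreserving (fun x => Real.pi - x) (volume.restrict (Ioo 0 Real.pi))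
        (volume.restrict (Ioo 0 Real.pi)) := by
      have := (Measure.measurePreserving_sub_left volume Real.pi).restrict_preimage
        (s := Ioo 0 Real.pi) measurableSet_Ioo
      simpa using this
    exact hmp.quasiMeasurePreserving.ae hP
  have hac : ∀ {g : ℝ → 𝕜}, AbsolutelyContinuousOnInterval g 0 Real.pi →
      AbsolutelyContinuousOnInterval (fun x => g (Real.pi - x)) 0 Real.pi := by
    intro g hg
    rw [absolutelyContinuousOnInterval_iff] at hg ⊢
    intro ε hε
    obtain ⟨δ, hδ, hδ'⟩ := hg ε hε
    refine ⟨δ, hδ, fun E hE hlt => ?_⟩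
    refine hδ' (E.1, fun i => (Real.pi - (E.2 i).1, Real.pi - (E.2 i).2)) ⟨?_, ?_⟩ ?_
    · intro i hi
      have := hE.1 i hi
      simp only [uIcc_of_le Real.pi_pos.le, mem_Icc] at this ⊢
      refine ⟨⟨?_, ?_⟩, ?_, ?_⟩ <;> linarith [this.1.1, this.1.2, this.2.1, this.2.2]
    · intro i hi j hj hij
      exact disjoint_uIoc_sub_left _ (hE.2 hi hj hij)
    · simpa only [dist_sub_left] using hlt
  have hd : ∀ {g : ℝ → 𝕜} {g' : 𝕜} {x : ℝ}, HasDerivAt g g' (Real.pi - x) →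
      HasDerivAt (fun x => g (Real.pi - x)) (-g') x := by
    intro g g' x hg
    exact (hg.scomp x ((hasDerivAt_id x).const_sub Real.pi)).congr_deriv (by simp)
  refine ⟨hac h.ac, (hac h.ac_quasi).fun_neg, ?_, ?_⟩
  · filter_upwards [hae h.deriv_eq] with x h1
    refine (hd h1).congr_deriv ?_
    push_cast
    ring
  · filter_upwards [hae h.deriv_quasi_eq] with x h1
    refine (hd h1).neg.congr_deriv ?_
    push_cast
    ring

end IsSolution

end SturmLiouville

namespace SturmLiouville

/-! ### Uniqueness and continuous dependence -/

/-- The coefficient in the energy estimates. -/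
def energyCoeff (s : ℝ → ℝ) (B x : ℝ) : ℝ := 3 + 2 * s x ^ 2 + B

lemma intervalIntegrable_energyCoeff {s : ℝ → ℝ}
    (hs : MemLp s 2 (volume.restrict (Ioo 0 Real.pi))) (B : ℝ) :
    IntervalIntegrable (energyCoeff s B) volume 0 Real.pi :=
  (intervalIntegrable_const.add ((intervalIntegrable_sq_of_memLp hs).const_mul 2)).add
    intervalIntegrable_const

lemma energyCoeff_nonneg (s : ℝ → ℝ) {B : ℝ} (hB : 0 ≤ B) (x : ℝ) : 0 ≤ energyCoeff s B x := by
  unfold energyCoeff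
  positivity

/-- The expression is the derivative of `y² + w²` along the system with forcing `g`. Its parts `2 y
w (1 - l)`, `2 σ (y² - w²)`, `2 σ² y w` and `2 w g` are bounded separately; the first three
contribute `1 + B`, `1 + σ²` and `σ²` to the coefficient, the last `1` and the term `g²`. -/
lemma abs_energy_deriv_le {σ l B y w g : ℝ} (hB : |l| ≤ B) :
    |2 * y * (w + σ * y) + 2 * w * (-σ * w - σ ^ 2 * y - l * y - g)| ≤
      (3 + 2 * σ ^ 2 + B) * (y ^ 2 + w ^ 2) + g ^ 2 := by
  obtain ⟨h1, h2⟩ := abs_le.mp hB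
  have hyw1 : 0 ≤ (y - w) ^ 2 := sq_nonneg _
  have hyw2 : 0 ≤ (y + w) ^ 2 := sq_nonneg _
  have hσ1 : 0 ≤ (σ - 1) ^ 2 := sq_nonneg _
  have hσ2 : 0 ≤ (σ + 1) ^ 2 := sq_nonneg _
  have hg1 : 0 ≤ (w - g) ^ 2 := sq_nonneg _
  have hg2 : 0 ≤ (w + g) ^ 2 := sq_nonneg _
  have hy := sq_nonneg y
  have hw := sq_nonneg w
  have a1 : 2 * (y * w) * (1 - l) ≤ (1 + B) * (y ^ 2 + w ^ 2) := by
    rcases le_total 0 (y * w) with h | h <;> nlinarith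
  have a2 : -((1 + B) * (y ^ 2 + w ^ 2)) ≤ 2 * (y * w) * (1 - l) := by
    rcases le_total 0 (y * w) with h | h <;> nlinarith
  have b1 : 2 * σ ^ 2 * (y * w) ≤ σ ^ 2 * (y ^ 2 + w ^ 2) := by nlinarith [sq_nonneg σ]
  have b2 : -(σ ^ 2 * (y ^ 2 + w ^ 2)) ≤ 2 * σ ^ 2 * (y * w) := by nlinarith [sq_nonneg σ]
  have c1 : 2 * σ * (y ^ 2 - w ^ 2) ≤ (1 + σ ^ 2) * (y ^ 2 + w ^ 2) := by nlinarith
  have c2 : -((1 + σ ^ 2) * (y ^ 2 + w ^ 2)) ≤ 2 * σ * (y ^ 2 - w ^ 2) := by nlinarith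
  rw [abs_le]
  constructor <;> nlinarith

lemma hasDerivAt_energy {s d w g : ℝ → ℝ} {l x : ℝ} (h1 : HasDerivAt d (w x + s x * d x) x)
    (h2 : HasDerivAt w (-s x * w x - s x ^ 2 * d x - l * d x - g x) x) :
    HasDerivAt (fun x => d x ^ 2 + w x ^ 2) (2 * d x * (w x + s x * d x) +
      2 * w x * (-s x * w x - s x ^ 2 * d x - l * d x - g x)) x := by
  refine ((h1.pow 2).add (h2.pow 2)).congr_deriv ?_
  push_cast
  ring

lemma energy_ac {d w : ℝ → ℝ} {a b : ℝ} (h1 : AbsolutelyContinuousOnInterval d a b)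
    (h2 : AbsolutelyContinuousOnInterval w a b) :
    AbsolutelyContinuousOnInterval (fun x => d x ^ 2 + w x ^ 2) a b := by
  simpa only [sq] using (h1.fun_mul h1).fun_add (h2.fun_mul h2)

/-- With `g = 0` this yields uniqueness. With `g = (l - m) y` it controls the difference of
solutions for two spectral parameters. -/
lemma energy_le {s : ℝ → ℝ} (hs : MemLp s 2 (volume.restrict (Ioo 0 Real.pi))) {l B : ℝ}
    (hB : |l| ≤ B) {d w g : ℝ → ℝ} (hd : AbsolutelyContinuousOnInterval d 0 Real.pi)
    (hw : AbsolutelyContinuousOnInterval w 0 Real.pi)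
    (hd' : ∀ᵐ x ∂volume.restrict (Ioo 0 Real.pi), HasDerivAt d (w x + s x * d x) x)
    (hw' : ∀ᵐ x ∂volume.restrict (Ioo 0 Real.pi),
      HasDerivAt w (-s x * w x - s x ^ 2 * d x - l * d x - g x) x)
    (hg : IntervalIntegrable (fun x => g x ^ 2) volume 0 Real.pi)
    {a b : ℝ} (ha : 0 ≤ a) (hab : a ≤ b) (hb : b ≤ Real.pi) :
    d b ^ 2 + w b ^ 2 ≤ Real.exp (∫ x in a..b, energyCoeff s B x) *
      (d a ^ 2 + w a ^ 2 + ∫ x in a..b, g x ^ 2) := by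
  refine gronwall (E := fun x => d x ^ 2 + w x ^ 2) hab
    ((energy_ac hd hw).mono_Icc ha hab hb) (E' := fun x => 2 * d x * (w x + s x * d x) +
      2 * w x * (-s x * w x - s x ^ 2 * d x - l * d x - g x)) ?_
    (IntervalIntegrable.mono_Icc (intervalIntegrable_energyCoeff hs B) ha hab hb)
    (IntervalIntegrable.mono_Icc hg ha hab hb)
    (energyCoeff_nonneg s ((abs_nonneg l).trans hB)) (fun x => sq_nonneg _) ?_
  · refine ae_restrict_Ioo_mono ha hb ?_
    filter_upwards [hd', hw'] with x h1 h2 using hasDerivAt_energy h1 h2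
  · exact Filter.Eventually.of_forall fun x => (le_abs_self _).trans (abs_energy_deriv_le hB)

namespace IsSolution

/-- A solution with zero initial values vanishes. -/
lemma eq_zero {s : ℝ → ℝ} (hs : MemLp s 2 (volume.restrict (Ioo 0 Real.pi))) {l : ℝ}
    {y y₁ : ℝ → ℝ} (h : IsSolution s l y y₁) {x₀ : ℝ} (hx₀ : x₀ ∈ Icc 0 Real.pi)
    (h0 : y x₀ = 0) (h1 : y₁ x₀ = 0) : ∀ x ∈ Icc 0 Real.pi, y x = 0 ∧ y₁ x = 0 := by
  intro x hx
  have hd' : ∀ᵐ x ∂volume.restrict (Ioo 0 Real.pi), HasDerivAt y (y₁ x + s x * y x) x := h.deriv_eq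
  have hw' : ∀ᵐ x ∂volume.restrict (Ioo 0 Real.pi),
      HasDerivAt y₁ (-s x * y₁ x - s x ^ 2 * y x - l * y x - (fun _ => (0 : ℝ)) x) x := by
    filter_upwards [h.deriv_quasi_eq] with x h1
    exact h1.congr_deriv (by simp)
  have hle : y x ^ 2 + y₁ x ^ 2 ≤ 0 := by
    rcases le_total x₀ x with hxx | hxx
    · have := energy_le hs le_rfl h.ac h.ac_quasi hd' hw' (by simp) hx₀.1 hxx hx.2
      simpa [h0, h1] using this
    · have := gronwall_backward (E := fun x => y x ^ 2 + y₁ x ^ 2) hxx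
        ((energy_ac h.ac h.ac_quasi).mono_Icc hx.1 hxx hx₀.2) (E' := fun x =>
          2 * y x * (y₁ x + s x * y x) +
          2 * y₁ x * (-s x * y₁ x - s x ^ 2 * y x - l * y x - (fun _ => (0 : ℝ)) x))
        (K := energyCoeff s |l|) (by
          refine ae_restrict_Ioo_mono hx.1 hx₀.2 ?_
          filter_upwards [hd', hw'] with x h1 h2
          exact hasDerivAt_energy (g := fun _ => 0) h1 h2)
        (IntervalIntegrable.mono_Icc (intervalIntegrable_energyCoeff hs |l|) hx.1 hxx hx₀.2)
        (Filter.Eventually.of_forall fun x => by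
          have := neg_le_of_abs_le
            (abs_energy_deriv_le (σ := s x) (y := y x) (w := y₁ x) (g := 0) (le_refl |l|))
          simpa [energyCoeff] using this)
      simpa [h0, h1] using this
  constructor <;> nlinarith [sq_nonneg (y x), sq_nonneg (y₁ x)]

/-- Solutions with equal initial values agree. -/
lemma eqOn {s : ℝ → ℝ} (hs : MemLp s 2 (volume.restrict (Ioo 0 Real.pi))) {l : ℝ}
    {y y₁ w w₁ : ℝ → ℝ} (h : IsSolution s l y y₁) (h' : IsSolution s l w w₁) {x₀ : ℝ}
    (hx₀ : x₀ ∈ Icc 0 Real.pi) (h0 : y x₀ = w x₀) (h1 : y₁ x₀ = w₁ x₀) :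
    ∀ x ∈ Icc 0 Real.pi, y x = w x ∧ y₁ x = w₁ x := by
  intro x hx
  have := (h.sub h').eq_zero hs hx₀ (by simp [h0]) (by simp [h1]) x hx
  exact ⟨sub_eq_zero.mp this.1, sub_eq_zero.mp this.2⟩

/-- Solutions depend continuously on the spectral parameter and the initial values. -/
lemma eventually_near {s : ℝ → ℝ} (hs : MemLp s 2 (volume.restrict (Ioo 0 Real.pi)))
    {y y₁ : ℝ → ℝ → ℝ} (h : ∀ l, IsSolution s l (y l) (y₁ l))
    (h0 : Continuous fun l => y l 0) (h1 : Continuous fun l => y₁ l 0) (m : ℝ) {ε : ℝ}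
    (hε : 0 < ε) :
    ∀ᶠ l in nhds m, ∀ x ∈ Icc 0 Real.pi, |y l x - y m x| < ε ∧ |y₁ l x - y₁ m x| < ε := by
  set M := ∫ x in (0 : ℝ)..Real.pi, y m x ^ 2 with hM
  set Cst := Real.exp (∫ x in (0 : ℝ)..Real.pi, energyCoeff s (|m| + 1) x) with hC
  have hmi : IntervalIntegrable (fun x => y m x ^ 2) volume 0 Real.pi :=
    ContinuousOn.intervalIntegrable (by
      rw [uIcc_of_le Real.pi_pos.le]
      exact (h m).continuousOn.pow 2)
  have hlim : ∀ᶠ l in nhds m,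
      Cst * ((y l 0 - y m 0) ^ 2 + (y₁ l 0 - y₁ m 0) ^ 2 + (l - m) ^ 2 * M) < ε ^ 2 := by
    have hcont : Continuous fun l =>
        Cst * ((y l 0 - y m 0) ^ 2 + (y₁ l 0 - y₁ m 0) ^ 2 + (l - m) ^ 2 * M) := by fun_prop
    refine hcont.continuousAt.eventually_lt continuousAt_const ?_
    simp only [sub_self]
    norm_num
    positivity
  have hball : ∀ᶠ l in nhds m, |l| ≤ |m| + 1 := by
    filter_upwards [continuous_abs.continuousAt.eventually_lt continuousAt_const
      (lt_add_one |m|)] with l hl using hl.le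
  filter_upwards [hlim, hball] with l hl1 hl2 x hx
  have hd := (h l).ac.fun_sub (h m).ac
  have hw := (h l).ac_quasi.fun_sub (h m).ac_quasi
  -- The difference solves the equation at `l` with this forcing, since `l y_l - m y_m = l (y_l -
  -- y_m) + (l - m) y_m`.
  have key := energy_le hs hl2 hd hw (g := fun x => (l - m) * y m x)
    (by
      filter_upwards [(h l).deriv_eq, (h m).deriv_eq] with x h1 h2
      exact (h1.sub h2).congr_deriv (by simp; ring))
    (by
      filter_upwards [(h l).deriv_quasi_eq, (h m).deriv_quasi_eq] with x h1 h2
      exact (h1.sub h2).congr_deriv (by simp; ring))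
    (by simpa only [mul_pow] using hmi.const_mul _) le_rfl hx.1 hx.2
  simp only [mul_pow, intervalIntegral.integral_const_mul] at key
  have hm1 : ∫ x in (0 : ℝ)..x, energyCoeff s (|m| + 1) x ≤
      ∫ x in (0 : ℝ)..Real.pi, energyCoeff s (|m| + 1) x :=
    intervalIntegral.integral_mono_interval le_rfl hx.1 hx.2
      (Filter.Eventually.of_forall (energyCoeff_nonneg s (by positivity)))
      (intervalIntegrable_energyCoeff hs _)
  have hm2 : ∫ x in (0 : ℝ)..x, y m x ^ 2 ≤ M :=
    intervalIntegral.integral_mono_interval le_rfl hx.1 hx.2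
      (Filter.Eventually.of_forall fun x => sq_nonneg _) hmi
  have hm3 : 0 ≤ ∫ x in (0 : ℝ)..x, y m x ^ 2 :=
    intervalIntegral.integral_nonneg_of_forall hx.1 fun x => sq_nonneg _
  have key2 : (y l x - y m x) ^ 2 + (y₁ l x - y₁ m x) ^ 2 < ε ^ 2 := by
    refine (key.trans ?_).trans_lt hl1
    refine mul_le_mul (Real.exp_le_exp.mpr hm1) ?_ (by positivity) (Real.exp_pos _).le
    gcongr
  constructor
  · exact abs_lt_of_sq_lt_sq (by nlinarith [sq_nonneg (y₁ l x - y₁ m x)]) hε.le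
  · exact abs_lt_of_sq_lt_sq (by nlinarith [sq_nonneg (y l x - y m x)]) hε.le

end IsSolution

end SturmLiouville

namespace SturmLiouville

/-! ### Existence -/

/-- A Volterra equation with integrable kernel, by contraction in a weighted norm. -/
lemma exists_volterra {a₁₁ a₁₂ a₂₁ a₂₂ k : ℝ → ℝ} {b : ℝ} (hb : 0 ≤ b)
    (h₁₁ : IntervalIntegrable a₁₁ volume 0 b) (h₁₂ : IntervalIntegrable a₁₂ volume 0 b)
    (h₂₁ : IntervalIntegrable a₂₁ volume 0 b) (h₂₂ : IntervalIntegrable a₂₂ volume 0 b)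
    (hk : IntervalIntegrable k volume 0 b) (hk1 : ∀ x, |a₁₁ x| + |a₁₂ x| ≤ k x)
    (hk2 : ∀ x, |a₂₁ x| + |a₂₂ x| ≤ k x) (c₁ c₂ : ℝ) :
    ∃ y w : ℝ → ℝ, ContinuousOn y (Icc 0 b) ∧ ContinuousOn w (Icc 0 b) ∧
      (∀ x ∈ Icc 0 b, y x = c₁ + ∫ t in (0 : ℝ)..x, (a₁₁ t * y t + a₁₂ t * w t)) ∧
      (∀ x ∈ Icc 0 b, w x = c₂ + ∫ t in (0 : ℝ)..x, (a₂₁ t * y t + a₂₂ t * w t)) := by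
  -- The contraction acts on the unknowns multiplied by `exp (-G)`. The factor `2` makes `∫ exp G *
  -- k = (exp G - 1) / 2`, hence the Lipschitz constant `1 / 2` on the whole interval.
  set G : ℝ → ℝ := fun x => 2 * ∫ t in (0 : ℝ)..x, k t with hG
  have hGac : AbsolutelyContinuousOnInterval G 0 b :=
    (hk.absolutelyContinuousOnInterval_intervalIntegral left_mem_uIcc).const_mul 2
  have hEac : AbsolutelyContinuousOnInterval (fun x => Real.exp (G x)) 0 b := hGac.exp
  have hEcont : ContinuousOn (fun x => Real.exp (G x)) (uIcc 0 b) := hEac.continuousOn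
  have hEint : ∀ x ∈ Icc 0 b, ∫ t in (0 : ℝ)..x, Real.exp (G t) * k t =
      (Real.exp (G x) - 1) / 2 := by
    intro x hx
    have h := (hEac.mono_Icc le_rfl hx.1 hx.2).integral_eq_sub hx.1
      (f' := fun t => Real.exp (G t) * (2 * k t)) (by
        refine ae_restrict_Ioo_mono le_rfl hx.2 ?_
        filter_upwards [ae_hasDerivAt_integral hb ⟨le_rfl, hb⟩ hk] with t ht
        exact (ht.const_mul 2).exp)
    have hG0 : G 0 = 0 := by simp [hG]
    rw [hG0, Real.exp_zero] at h
    rw [← h, eq_div_iff two_ne_zero, ← intervalIntegral.integral_mul_const]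
    exact intervalIntegral.integral_congr fun t _ => by ring
  have hsub : ∀ {f : ℝ → ℝ} {x : ℝ}, IntervalIntegrable f volume 0 b → x ∈ Icc 0 b →
      IntervalIntegrable f volume 0 x := by
    intro f x hf hx
    refine hf.mono_set ?_
    rw [uIcc_of_le hx.1, uIcc_of_le hb]
    exact Icc_subset_Icc_right hx.2
  have : Fact ((0 : ℝ) ≤ b) := ⟨hb⟩
  let ext : C(Icc 0 b, ℝ) → ℝ → ℝ := fun u => IccExtend hb u
  have hext_cont : ∀ u, Continuous (ext u) := fun u => u.continuous.Icc_extend'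
  let F : (ℝ → ℝ) → (ℝ → ℝ) → C(Icc 0 b, ℝ) × C(Icc 0 b, ℝ) → ℝ → ℝ :=
    fun p q u t => Real.exp (G t) * (p t * ext u.1 t + q t * ext u.2 t)
  have hF : ∀ {p q : ℝ → ℝ}, IntervalIntegrable p volume 0 b → IntervalIntegrable q volume 0 b →
      ∀ u, IntervalIntegrable (F p q u) volume 0 b := by
    intro p q hp hq u
    exact ((hp.mul_continuousOn (hext_cont u.1).continuousOn).add
      (hq.mul_continuousOn (hext_cont u.2).continuousOn)).continuousOn_mul hEcont
  have hop : ∀ (p q : ℝ → ℝ), IntervalIntegrable p volume 0 b → IntervalIntegrable q volume 0 b →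
      ∀ c : ℝ, ∃ Φ : C(Icc 0 b, ℝ) × C(Icc 0 b, ℝ) → C(Icc 0 b, ℝ), ∀ u x,
        Φ u x = Real.exp (-G x) * (c + ∫ t in (0 : ℝ)..x, F p q u t) := by
    intro p q hp hq c
    have hc : ∀ u, ContinuousOn
        (fun x => Real.exp (-G x) * (c + ∫ t in (0 : ℝ)..x, F p q u t)) (Icc 0 b) := by
      intro u
      have := hGac.fun_neg.exp.fun_mul ((AbsolutelyContinuousOnInterval.const c).fun_add
        ((hF hp hq u).absolutelyContinuousOnInterval_intervalIntegral left_mem_uIcc))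
      have := this.continuousOn
      rwa [uIcc_of_le hb] at this
    exact ⟨fun u => ⟨_, (hc u).domRestrict⟩, fun u x => rfl⟩
  have hlip : ∀ (p q : ℝ → ℝ), IntervalIntegrable p volume 0 b →
      IntervalIntegrable q volume 0 b → (∀ x, |p x| + |q x| ≤ k x) → ∀ c
      (Φ : C(Icc 0 b, ℝ) × C(Icc 0 b, ℝ) → C(Icc 0 b, ℝ)),
      (∀ u x, Φ u x = Real.exp (-G x) * (c + ∫ t in (0 : ℝ)..x, F p q u t)) →
      ∀ u v, dist (Φ u) (Φ v) ≤ 1 / 2 * dist u v := by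
    intro p q hp hq hpq c Φ hΦ u v
    rw [ContinuousMap.dist_le (by positivity)]
    intro x
    have hx := x.2
    have hu := hsub (hF hp hq u) hx
    have hv := hsub (hF hp hq v) hx
    have hpt : ∀ t, ‖F p q u t - F p q v t‖ ≤ dist u v * (Real.exp (G t) * k t) := by
      intro t
      have hd1 : |ext u.1 t - ext v.1 t| ≤ dist u v :=
        (ContinuousMap.dist_apply_le_dist (f := u.1) (g := v.1) (projIcc 0 b hb t)).trans
          (le_max_left _ _)
      have hd2 : |ext u.2 t - ext v.2 t| ≤ dist u v :=
        (ContinuousMap.dist_apply_le_dist (f := u.2) (g := v.2) (projIcc 0 b hb t)).trans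
          (le_max_right _ _)
      have he : F p q u t - F p q v t = Real.exp (G t) *
          (p t * (ext u.1 t - ext v.1 t) + q t * (ext u.2 t - ext v.2 t)) := by
        simp only [F]; ring
      rw [he, norm_mul, Real.norm_of_nonneg (Real.exp_pos _).le, Real.norm_eq_abs]
      have h1 : |p t * (ext u.1 t - ext v.1 t) + q t * (ext u.2 t - ext v.2 t)| ≤
          (|p t| + |q t|) * dist u v := by
        refine (abs_add_le _ _).trans ?_
        rw [abs_mul, abs_mul, add_mul]
        gcongr
      have h2 := mul_le_mul_of_nonneg_right (hpq t) (dist_nonneg (x := u) (y := v))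
      calc Real.exp (G t) * |p t * (ext u.1 t - ext v.1 t) + q t * (ext u.2 t - ext v.2 t)|
          ≤ Real.exp (G t) * (k t * dist u v) := by gcongr; exact h1.trans h2
        _ = _ := by ring
    rw [hΦ, hΦ, Real.dist_eq, ← mul_sub, add_sub_add_left_eq_sub,
      ← intervalIntegral.integral_sub hu hv, abs_mul, abs_of_pos (Real.exp_pos _)]
    have hbound := intervalIntegral.norm_integral_le_of_norm_le hx.1
      (Filter.Eventually.of_forall fun t _ => hpt t)
      ((hsub (hk.continuousOn_mul hEcont) hx).const_mul (dist u v))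
    rw [intervalIntegral.integral_const_mul, hEint x hx, Real.norm_eq_abs] at hbound
    calc Real.exp (-G x) * |∫ t in (0 : ℝ)..x, F p q u t - F p q v t|
        ≤ Real.exp (-G x) * (dist u v * ((Real.exp (G x) - 1) / 2)) := by gcongr
      _ = 1 / 2 * dist u v * (1 - Real.exp (-G x)) := by
        have : Real.exp (-G x) * Real.exp (G x) = 1 := by rw [← Real.exp_add]; simp
        linear_combination (dist u v / 2) * this
      _ ≤ 1 / 2 * dist u v := by
        have := Real.exp_pos (-G x)
        have := dist_nonneg (x := u) (y := v)
        nlinarith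
  obtain ⟨Φ₁, hΦ₁⟩ := hop a₁₁ a₁₂ h₁₁ h₁₂ c₁
  obtain ⟨Φ₂, hΦ₂⟩ := hop a₂₁ a₂₂ h₂₁ h₂₂ c₂
  have hcontr : ContractingWith (1 / 2) fun u => (Φ₁ u, Φ₂ u) := by
    refine ⟨by norm_num, LipschitzWith.of_dist_le_mul fun u v => ?_⟩
    have h1 := hlip a₁₁ a₁₂ h₁₁ h₁₂ hk1 c₁ Φ₁ hΦ₁ u v
    have h2 := hlip a₂₁ a₂₂ h₂₁ h₂₂ hk2 c₂ Φ₂ hΦ₂ u v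
    rw [Prod.dist_eq]
    simpa using max_le h1 h2
  set u := ContractingWith.fixedPoint _ hcontr with hu
  have hfix : (Φ₁ u, Φ₂ u) = u := hcontr.fixedPoint_isFixedPt
  have hext : ∀ (v : C(Icc 0 b, ℝ)) (x : ℝ) (hx : x ∈ Icc 0 b), ext v x = v ⟨x, hx⟩ :=
    fun v x hx => IccExtend_of_mem hb v hx
  have hc : ∀ v, ContinuousOn (fun x => Real.exp (G x) * ext v x) (Icc 0 b) := by
    intro v
    rw [← uIcc_of_le hb]
    exact hEcont.mul (hext_cont v).continuousOn
  refine ⟨fun x => Real.exp (G x) * ext u.1 x, fun x => Real.exp (G x) * ext u.2 x,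
    hc _, hc _, fun x hx => ?_, fun x hx => ?_⟩
  · have h1 : ext u.1 x = Real.exp (-G x) * (c₁ + ∫ t in (0 : ℝ)..x, F a₁₁ a₁₂ u t) := by
      rw [hext _ x hx, ← hΦ₁ u ⟨x, hx⟩]
      exact (DFunLike.congr_fun (congrArg Prod.fst hfix) _).symm
    simp only [h1]
    rw [← mul_assoc, ← Real.exp_add, add_neg_cancel, Real.exp_zero, one_mul]
    congr 1
    exact intervalIntegral.integral_congr fun t _ => by simp only [F]; ring
  · have h1 : ext u.2 x = Real.exp (-G x) * (c₂ + ∫ t in (0 : ℝ)..x, F a₂₁ a₂₂ u t) := by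
      rw [hext _ x hx, ← hΦ₂ u ⟨x, hx⟩]
      exact (DFunLike.congr_fun (congrArg Prod.snd hfix) _).symm
    simp only [h1]
    rw [← mul_assoc, ← Real.exp_add, add_neg_cancel, Real.exp_zero, one_mul]
    congr 1
    exact intervalIntegral.integral_congr fun t _ => by simp only [F]; ring

lemma exists_isSolution_left {s : ℝ → ℝ} (hs : MemLp s 2 (volume.restrict (Ioo 0 Real.pi)))
    (l a b : ℝ) : ∃ y y₁ : ℝ → ℝ, IsSolution s l y y₁ ∧ y 0 = a ∧ y₁ 0 = b := by
  have hs1 := intervalIntegrable_of_memLp hs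
  have hs2 := intervalIntegrable_sq_of_memLp hs
  have hp := Real.pi_pos.le
  have h₂₁ : IntervalIntegrable (fun x => -s x ^ 2 - l) volume 0 Real.pi :=
    hs2.neg.sub intervalIntegrable_const
  have h₂₂ : IntervalIntegrable (fun x => -s x) volume 0 Real.pi := hs1.neg
  have h₁₂ : IntervalIntegrable (fun _ => (1 : ℝ)) volume 0 Real.pi := intervalIntegrable_const
  obtain ⟨y, w, hyc, hwc, hy, hw⟩ := exists_volterra hp hs1 h₁₂ h₂₁ h₂₂
    -- The energy coefficient also dominates both row sums `|s| + 1` and `|s² + l| + |s|` of the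
    -- first order system.
    (intervalIntegrable_energyCoeff hs |l|)
    (fun x => by
      unfold energyCoeff
      have := sq_nonneg (|s x| - 1)
      have := sq_abs (s x)
      have := abs_nonneg l
      rw [abs_one]
      nlinarith)
    (fun x => by
      unfold energyCoeff
      have h1 := sq_nonneg (|s x| - 1)
      have h2 := sq_abs (s x)
      have h3 := abs_sub (-s x ^ 2) l
      rw [abs_neg, abs_of_nonneg (sq_nonneg (s x))] at h3
      rw [abs_neg]
      nlinarith) a b
  rw [← uIcc_of_le hp] at hyc hwc
  have hi1 := (hs1.mul_continuousOn hyc).add (h₁₂.mul_continuousOn hwc)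
  have hi2 := (h₂₁.mul_continuousOn hyc).add (h₂₂.mul_continuousOn hwc)
  rw [uIcc_of_le hp] at hyc hwc
  have h0 : (0 : ℝ) ∈ Icc 0 Real.pi := ⟨le_rfl, hp⟩
  have hnear : ∀ {x : ℝ}, x ∈ Ioo 0 Real.pi → Icc 0 Real.pi ∈ nhds x :=
    fun hx => Icc_mem_nhds hx.1 hx.2
  refine ⟨y, w, ⟨?_, ?_, ?_, ?_⟩, by simp [hy 0 h0], by simp [hw 0 h0]⟩
  · refine ((AbsolutelyContinuousOnInterval.const a).fun_add
      (hi1.absolutelyContinuousOnInterval_intervalIntegral left_mem_uIcc)).congr fun x hx => ?_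
    rw [uIcc_of_le hp] at hx
    exact hy x hx
  · refine ((AbsolutelyContinuousOnInterval.const b).fun_add
      (hi2.absolutelyContinuousOnInterval_intervalIntegral left_mem_uIcc)).congr fun x hx => ?_
    rw [uIcc_of_le hp] at hx
    exact hw x hx
  · filter_upwards [ae_hasDerivAt_integral hp h0 hi1, ae_restrict_mem measurableSet_Ioo]
      with x h1 hx
    refine ((h1.const_add a).congr_of_eventuallyEq ?_).congr_deriv (by simp; ring)
    filter_upwards [hnear hx] with t ht using hy t ht
  · filter_upwards [ae_hasDerivAt_integral hp h0 hi2, ae_restrict_mem measurableSet_Ioo]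
      with x h1 hx
    refine ((h1.const_add b).congr_of_eventuallyEq ?_).congr_deriv (by simp; ring)
    filter_upwards [hnear hx] with t ht using hw t ht

lemma memLp_reflect {s : ℝ → ℝ} (hs : MemLp s 2 (volume.restrict (Ioo 0 Real.pi))) :
    MemLp (fun x => -s (Real.pi - x)) 2 (volume.restrict (Ioo 0 Real.pi)) := by
  have hmp : MeasurePreserving (fun x => Real.pi - x) (volume.restrict (Ioo 0 Real.pi))
      (volume.restrict (Ioo 0 Real.pi)) := by
    have := (Measure.measurePreserving_sub_left volume Real.pi).restrict_preimage
      (s := Ioo 0 Real.pi) measurableSet_Ioo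
    simpa using this
  exact (hs.comp_measurePreserving hmp).neg

lemma exists_isSolution_right {s : ℝ → ℝ} (hs : MemLp s 2 (volume.restrict (Ioo 0 Real.pi)))
    (l a b : ℝ) : ∃ y y₁ : ℝ → ℝ, IsSolution s l y y₁ ∧ y Real.pi = a ∧ y₁ Real.pi = b := by
  obtain ⟨y, y₁, h, h0, h1⟩ := exists_isSolution_left (memLp_reflect hs) l a (-b)
  refine ⟨_, _, by simpa using h.reflect, by simpa using h0, by simp [h1]⟩

end SturmLiouville

namespace SturmLiouville

/-! ### The solutions `phi` and `psi` -/

lemma initialSolution_spec {s : ℝ → ℝ} {l x₀ a b : ℝ}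
    (h : ∃ y y₁ : ℝ → ℝ, IsSolution s l y y₁ ∧ y x₀ = a ∧ y₁ x₀ = b) :
    IsSolution s l (initialSolution s l x₀ a b).1 (initialSolution s l x₀ a b).2 ∧
      (initialSolution s l x₀ a b).1 x₀ = a ∧ (initialSolution s l x₀ a b).2 x₀ = b := by
  obtain ⟨y, y₁, h⟩ := h
  exact Classical.epsilon_spec
    (p := fun y : (ℝ → ℝ) × (ℝ → ℝ) => IsSolution s l y.1 y.2 ∧ y.1 x₀ = a ∧ y.2 x₀ = b)
    ⟨(y, y₁), h⟩

section
variable {s : ℝ → ℝ} (hs : MemLp s 2 (volume.restrict (Ioo 0 Real.pi))) (f : OnePoint Herglotz)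
  (l : ℝ)
include hs

lemma isSolution_phi : IsSolution s l (phi s f l) (phiQuasi s f l) :=
  (initialSolution_spec (exists_isSolution_left hs _ _ _)).1

lemma phi_zero : phi s f l 0 = (down f).eval l :=
  (initialSolution_spec (exists_isSolution_left hs _ _ _)).2.1

lemma phiQuasi_zero : phiQuasi s f l 0 = -(up f).eval l :=
  (initialSolution_spec (exists_isSolution_left hs _ _ _)).2.2

lemma isSolution_psi : IsSolution s l (psi s f l) (psiQuasi s f l) :=
  (initialSolution_spec (exists_isSolution_right hs _ _ _)).1

lemma psi_pi : psi s f l Real.pi = (down f).eval l :=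
  (initialSolution_spec (exists_isSolution_right hs _ _ _)).2.1

lemma psiQuasi_pi : psiQuasi s f l Real.pi = (up f).eval l :=
  (initialSolution_spec (exists_isSolution_right hs _ _ _)).2.2

lemma eventually_phi_near (m : ℝ) {ε : ℝ} (hε : 0 < ε) :
    ∀ᶠ l in nhds m, ∀ x ∈ Icc 0 Real.pi,
      |phi s f l x - phi s f m x| < ε ∧ |phiQuasi s f l x - phiQuasi s f m x| < ε :=
  IsSolution.eventually_near hs (fun l => isSolution_phi hs f l)
    (by simpa only [phi_zero hs] using (down f).continuous)
    (by simp only [phiQuasi_zero hs]; exact (up f).continuous.neg) m hε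

lemma continuous_phi {x : ℝ} (hx : x ∈ Icc 0 Real.pi) : Continuous fun l => phi s f l x := by
  rw [continuous_iff_continuousAt]
  intro m
  rw [Metric.continuousAt_iff']
  intro ε hε
  filter_upwards [eventually_phi_near hs f m hε] with l hl using (hl x hx).1

lemma continuous_phiQuasi {x : ℝ} (hx : x ∈ Icc 0 Real.pi) :
    Continuous fun l => phiQuasi s f l x := by
  rw [continuous_iff_continuousAt]
  intro m
  rw [Metric.continuousAt_iff']
  intro ε hε
  filter_upwards [eventually_phi_near hs f m hε] with l hl using (hl x hx).2

end

/-! ### Zeros of nonnegative solutions -/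

namespace IsSolution

variable {s : ℝ → ℝ} {l : ℝ} {y y₁ : ℝ → ℝ}

/-- The classical `y'` need not exist at `x₀`, but `y * exp (-∫ s)` has derivative `y₁ * exp (-∫ s)`
almost everywhere. If `y₁ x₀ < 0`, it decreases strictly from zero, and `y` becomes negative to the
right of `x₀`. -/
lemma quasi_nonneg_of_zero (hs : MemLp s 2 (volume.restrict (Ioo 0 Real.pi)))
    (h : IsSolution s l y y₁) (hy : ∀ x ∈ Icc 0 Real.pi, 0 ≤ y x) {x₀ : ℝ}
    (hx₀ : x₀ ∈ Ico 0 Real.pi) (h0 : y x₀ = 0) : 0 ≤ y₁ x₀ := by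
  by_contra! hneg
  have hp := Real.pi_pos.le
  have hs1 := intervalIntegrable_of_memLp hs
  obtain ⟨c, hc, hcneg⟩ : ∃ c ∈ Ioc x₀ Real.pi, ∀ x ∈ Icc x₀ c, y₁ x < 0 := by
    have h1 := (h.continuousOn_quasi x₀ (Ico_subset_Icc_self hx₀)).eventually_lt
      continuousWithinAt_const hneg
    rw [eventually_nhdsWithin_iff] at h1
    obtain ⟨δ, hδ, hδ'⟩ := Metric.eventually_nhds_iff.mp h1
    refine ⟨min (x₀ + δ / 2) Real.pi, ⟨lt_min (by linarith) hx₀.2, min_le_right _ _⟩, ?_⟩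
    intro x hx
    have hx2 := hx.2.trans (min_le_left _ _)
    refine hδ' ?_ ⟨hx₀.1.trans hx.1, hx.2.trans (min_le_right _ _)⟩
    rw [Real.dist_eq, abs_of_nonneg (by linarith [hx.1])]
    linarith
  set σ : ℝ → ℝ := fun x => ∫ t in (0 : ℝ)..x, s t with hσ
  have hσac : AbsolutelyContinuousOnInterval σ 0 Real.pi :=
    hs1.absolutelyContinuousOnInterval_intervalIntegral left_mem_uIcc
  have hac := (h.ac.fun_mul hσac.fun_neg.exp).mono_Icc hx₀.1 hc.1.le hc.2
  have hint := hac.integral_eq_sub hc.1.le (f' := fun x => y₁ x * Real.exp (-σ x)) (by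
    refine ae_restrict_Ioo_mono hx₀.1 hc.2 ?_
    filter_upwards [h.deriv_eq, ae_hasDerivAt_integral hp ⟨le_rfl, hp⟩ hs1] with x h1 h2
    exact (h1.mul h2.neg.exp).congr_deriv (by simp; ring))
  have hcont : ContinuousOn (fun x => -(y₁ x * Real.exp (-σ x))) (Icc x₀ c) := by
    have := (h.ac_quasi.fun_mul hσac.fun_neg.exp).fun_neg.continuousOn
    rw [uIcc_of_le hp] at this
    exact this.mono (Icc_subset_Icc hx₀.1 hc.2)
  have hpos := intervalIntegral.intervalIntegral_pos_of_pos_on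
    (f := fun x => -(y₁ x * Real.exp (-σ x))) (hcont.intervalIntegrable_of_Icc hc.1.le)
    (fun x hx => by
      have := hcneg x (Ioo_subset_Icc_self hx)
      have := Real.exp_pos (-σ x)
      nlinarith) hc.1
  rw [intervalIntegral.integral_neg, hint, h0, zero_mul, sub_zero] at hpos
  have := mul_nonneg (hy c ⟨hx₀.1.trans hc.1.le, hc.2⟩) (Real.exp_pos (-σ c)).le
  linarith

lemma quasi_nonpos_of_zero (hs : MemLp s 2 (volume.restrict (Ioo 0 Real.pi)))
    (h : IsSolution s l y y₁) (hy : ∀ x ∈ Icc 0 Real.pi, 0 ≤ y x) {x₀ : ℝ}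
    (hx₀ : x₀ ∈ Ioc 0 Real.pi) (h0 : y x₀ = 0) : y₁ x₀ ≤ 0 := by
  have := h.reflect.quasi_nonneg_of_zero (memLp_reflect hs)
    (fun x hx => hy _ ⟨by linarith [hx.2], by linarith [hx.1]⟩) (x₀ := Real.pi - x₀)
    ⟨by linarith [hx₀.2], by linarith [hx₀.1]⟩ (by simpa using h0)
  simpa using this

/-- At an interior zero the quasi-derivative is both nonnegative and nonpositive, so the solution
vanishes identically. At `π` only one of these inequalities is available, so that point is left out.
-/
lemma pos_of_nonneg (hs : MemLp s 2 (volume.restrict (Ioo 0 Real.pi)))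
    (h : IsSolution s l y y₁) (hy : ∀ x ∈ Icc 0 Real.pi, 0 ≤ y x) (h0 : 0 < y 0) {x : ℝ}
    (hx : x ∈ Ico 0 Real.pi) : 0 < y x := by
  have hx' := Ico_subset_Icc_self hx
  refine lt_of_le_of_ne (hy x hx') fun hx0 => ?_
  have hx1 : 0 < x := by
    refine lt_of_le_of_ne hx.1 ?_
    rintro rfl
    exact h0.ne hx0
  have h1 := h.quasi_nonneg_of_zero hs hy hx hx0.symm
  have h2 := h.quasi_nonpos_of_zero hs hy ⟨hx1, hx.2.le⟩ hx0.symm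
  exact h0.ne' (h.eq_zero hs hx' hx0.symm (le_antisymm h2 h1) 0 ⟨le_rfl, Real.pi_pos.le⟩).1

end IsSolution

/-! ### Solutions for large negative values of the spectral parameter -/

/-- A barrier `ρ` for `y₁ / y`, rising from `-(K + 1)` at `0` to `K` at `π`. While `y ≥ 0`, the
difference `q = y₁ - ρ y` satisfies `q' ≥ -(ρ + s) q` for `l` negative enough, so `q` stays
positive; then `y' ≥ (ρ + s) y` keeps `y` positive. The bound on `l` does not depend on the
solution, as is needed when the initial values vary with `l`. -/
lemma exists_forall_le_pos {s : ℝ → ℝ} (hs : MemLp s 2 (volume.restrict (Ioo 0 Real.pi)))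
    (K : ℝ) : ∃ L : ℝ, ∀ l ≤ L, ∀ y y₁ : ℝ → ℝ, IsSolution s l y y₁ → 0 < y 0 →
      -(K * y 0) ≤ y₁ 0 → (∀ x ∈ Icc 0 Real.pi, 0 < y x) ∧ K * y Real.pi < y₁ Real.pi := by
  have hp := Real.pi_pos
  have hs1 := intervalIntegrable_of_memLp hs
  have hs2 := intervalIntegrable_sq_of_memLp hs
  have h0 : (0 : ℝ) ∈ Icc 0 Real.pi := ⟨le_rfl, hp.le⟩
  set N := ∫ t in (0 : ℝ)..Real.pi, s t ^ 2 with hN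
  -- `α` is fixed by `ρ π = K`. The term `-2 ∫ s²` in `ρ` turns the `-s²` of the Riccati inequality
  -- into `+s²`, so an unbounded `s` does no harm.
  set α := (2 * K + 1 + 2 * N) / Real.pi with hα
  set ρ : ℝ → ℝ := fun x => -(K + 1) + α * x - 2 * ∫ t in (0 : ℝ)..x, s t ^ 2 with hρ
  have hlin : AbsolutelyContinuousOnInterval (fun x : ℝ => -(K + 1) + α * x) 0 Real.pi :=
    (contDiff_const.add (contDiff_const.mul contDiff_id)).contDiffOn.absolutelyContinuousOnInterval
  have hρac : AbsolutelyContinuousOnInterval ρ 0 Real.pi := hlin.fun_sub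
    ((hs2.absolutelyContinuousOnInterval_intervalIntegral left_mem_uIcc).const_mul 2)
  have hρ' : ∀ᵐ x ∂volume.restrict (Ioo 0 Real.pi), HasDerivAt ρ (α - 2 * s x ^ 2) x := by
    filter_upwards [ae_hasDerivAt_integral hp.le h0 hs2] with x hx
    exact ((((hasDerivAt_id x).const_mul α).const_add (-(K + 1))).sub
      (hx.const_mul 2)).congr_deriv (by simp)
  have hρπ : ρ Real.pi = K := by
    simp only [hρ, hα, ← hN]
    field_simp
    ring
  obtain ⟨R, hR⟩ := hρac.exists_bound
  rw [uIcc_of_le hp.le] at hR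
  have hi : IntervalIntegrable (fun x => ρ x + s x) volume 0 Real.pi :=
    hρac.continuousOn.intervalIntegrable.add hs1
  set P : ℝ → ℝ := fun x => ∫ t in (0 : ℝ)..x, (ρ t + s t) with hP
  have hPac : AbsolutelyContinuousOnInterval P 0 Real.pi :=
    hi.absolutelyContinuousOnInterval_intervalIntegral left_mem_uIcc
  have hP0 : P 0 = 0 := intervalIntegral.integral_same
  -- `R` bounds `|ρ|`; the coefficient of `y` in the inequality for `q` is `-l - α - 2 ρ² + (ρ -
  -- s)²`, nonnegative for these `l`.
  refine ⟨-(2 * R ^ 2 + α), fun l hl y y₁ h hy0 hy1 => ?_⟩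
  have step : ∀ c ∈ Icc 0 Real.pi, (∀ x ∈ Icc 0 c, 0 ≤ y x) → 0 < y c ∧ ρ c * y c < y₁ c := by
    have hq : ∀ c ∈ Icc 0 Real.pi, (∀ x ∈ Icc 0 c, 0 ≤ y x) → 0 < y₁ c - ρ c * y c := by
      intro c hc hy
      have hac := ((h.ac_quasi.fun_sub (hρac.fun_mul h.ac)).fun_mul hPac.exp).mono_Icc
        le_rfl hc.1 hc.2
      have hder : ∀ᵐ x ∂volume.restrict (Ioo 0 c),
          HasDerivAt (fun x => (y₁ x - ρ x * y x) * Real.exp (P x))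
            (y x * (-l - s x ^ 2 - ρ x ^ 2 - 2 * ρ x * s x - (α - 2 * s x ^ 2)) *
              Real.exp (P x)) x := by
        refine ae_restrict_Ioo_mono le_rfl hc.2 ?_
        filter_upwards [h.deriv_eq, h.deriv_quasi_eq, hρ', ae_hasDerivAt_integral hp.le h0 hi]
          with x h1 h2 h3 h4
        refine ((h2.sub (h3.mul h1)).mul h4.exp).congr_deriv ?_
        simp only [RCLike.ofReal_real_eq_id, id_eq, Pi.sub_apply, Pi.mul_apply]
        ring
      have hmono := hac.le_of_hasDerivAt_nonneg hc.1 hder (by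
        filter_upwards [ae_restrict_mem measurableSet_Ioo] with x hx
        have h1 := hR x ⟨hx.1.le, hx.2.le.trans hc.2⟩
        rw [Real.norm_eq_abs] at h1
        have h2 : ρ x ^ 2 ≤ R ^ 2 := by
          rw [← sq_abs]
          exact pow_le_pow_left₀ (abs_nonneg _) h1 2
        have h3 := sq_nonneg (ρ x - s x)
        refine mul_nonneg (mul_nonneg (hy x ⟨hx.1.le, hx.2.le⟩) ?_) (Real.exp_pos _).le
        nlinarith)
      have hstart : 0 < (y₁ 0 - ρ 0 * y 0) * Real.exp (P 0) := by
        have : ρ 0 = -(K + 1) := by simp [hρ]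
        rw [this, hP0, Real.exp_zero]
        nlinarith
      exact pos_of_mul_pos_left (hstart.trans_le hmono) (Real.exp_pos _).le
    intro c hc hy
    refine ⟨?_, by linarith [hq c hc hy]⟩
    have hac := (h.ac.fun_mul hPac.fun_neg.exp).mono_Icc le_rfl hc.1 hc.2
    have hder : ∀ᵐ x ∂volume.restrict (Ioo 0 c),
        HasDerivAt (fun x => y x * Real.exp (-P x))
          ((y₁ x - ρ x * y x) * Real.exp (-P x)) x := by
      refine ae_restrict_Ioo_mono le_rfl hc.2 ?_
      filter_upwards [h.deriv_eq, ae_hasDerivAt_integral hp.le h0 hi] with x h1 h4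
      refine (h1.mul h4.neg.exp).congr_deriv ?_
      simp only [RCLike.ofReal_real_eq_id, id_eq, Pi.neg_apply, hP]
      ring
    have hmono := hac.le_of_hasDerivAt_nonneg hc.1 hder (by
      filter_upwards [ae_restrict_mem measurableSet_Ioo] with x hx
      exact (mul_pos (hq x ⟨hx.1.le, hx.2.le.trans hc.2⟩
        fun t ht => hy t ⟨ht.1, ht.2.trans hx.2.le⟩) (Real.exp_pos _)).le)
    rw [hP0, neg_zero, Real.exp_zero, mul_one] at hmono
    exact pos_of_mul_pos_left (hy0.trans_le hmono) (Real.exp_pos _).le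
  have hpos : ∀ x ∈ Icc 0 Real.pi, 0 < y x := by
    by_contra! hcon
    -- At the first point `c` where `y ≤ 0`, the solution is nonnegative on `[0, c]`, so `step`
    -- gives the contradiction `0 < y c`.
    have hcomp : IsCompact (Icc 0 Real.pi ∩ y ⁻¹' Iic 0) :=
      isCompact_Icc.of_isClosed_subset
        (h.continuousOn.preimage_isClosed_of_isClosed isClosed_Icc isClosed_Iic) inter_subset_left
    obtain ⟨c, ⟨hc, hyc⟩, hmin⟩ := hcomp.exists_isLeast (by
      obtain ⟨x, hx, hx'⟩ := hcon
      exact ⟨x, hx, hx'⟩)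
    have hlt : ∀ x ∈ Icc 0 Real.pi, x < c → 0 < y x := by
      intro x hx hxc
      by_contra! hyx
      exact hxc.not_ge (hmin ⟨hx, hyx⟩)
    have hyc0 : 0 ≤ y c := by
      by_contra! hneg
      obtain ⟨t, ht, hyt⟩ := intermediate_value_Icc' hc.1
        (h.continuousOn.mono (Icc_subset_Icc_right hc.2)) ⟨hneg.le, hy0.le⟩
      have htc : t < c := lt_of_le_of_ne ht.2 (by rintro rfl; exact hneg.ne hyt)
      exact (hlt t ⟨ht.1, ht.2.trans hc.2⟩ htc).ne' hyt
    have := (step c hc fun x hx => by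
      rcases hx.2.lt_or_eq with hxc | rfl
      · exact (hlt x ⟨hx.1, hx.2.trans hc.2⟩ hxc).le
      · exact hyc0).1
    exact this.not_ge hyc
  refine ⟨hpos, ?_⟩
  have := (step Real.pi ⟨hp.le, le_rfl⟩ fun x hx => (hpos x hx).le).2
  rwa [hρπ] at this

end SturmLiouville

namespace SturmLiouville

/-! ### Eigenvalues -/

lemma aeval_ofReal_complex (p : ℝ[X]) (l : ℝ) : aeval (l : ℂ) p = ((p.eval l : ℝ) : ℂ) := by
  rw [← Complex.coe_algebraMap, aeval_algebraMap_apply]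
  simp

lemma isEigenvalue_of_real {s : ℝ → ℝ} {f F : OnePoint Herglotz} {l : ℝ} {y y₁ : ℝ → ℝ}
    (h : IsSolution s l y y₁) (hne : ∃ x ∈ Icc 0 Real.pi, y x ≠ 0)
    (h0 : (down f).eval l * y₁ 0 = -((up f).eval l * y 0))
    (h1 : (down F).eval l * y₁ Real.pi = (up F).eval l * y Real.pi) :
    IsEigenvalue s f F l := by
  refine ⟨_, _, h.ofReal (𝕜 := ℂ), ?_, ?_, ?_⟩
  · obtain ⟨x, hx, hx'⟩ := hne
    exact ⟨x, hx, by simpa using hx'⟩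
  · rw [aeval_ofReal_complex, aeval_ofReal_complex]
    have := congrArg Complex.ofReal h0
    push_cast at this
    exact this
  · rw [aeval_ofReal_complex, aeval_ofReal_complex]
    have := congrArg Complex.ofReal h1
    push_cast at this
    exact this

lemma IsEigenvalue.reflect {s : ℝ → ℝ} {f F : OnePoint Herglotz} {z : ℂ}
    (h : IsEigenvalue s f F z) : IsEigenvalue (fun x => -s (Real.pi - x)) F f z := by
  obtain ⟨y, y₁, hy, ⟨x, hx, hx'⟩, h0, h1⟩ := h
  refine ⟨_, _, hy.reflect, ⟨Real.pi - x, ⟨by linarith [hx.2], by linarith [hx.1]⟩, ?_⟩, ?_, ?_⟩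
  · simpa using hx'
  · simp only [sub_zero]
    rw [mul_neg, h1]
  · simp only [sub_self]
    rw [mul_neg, h0, neg_neg]

/-! ### Bounds and signs of Herglotz functions to the left of their poles. -/

namespace Herglotz

/-- For `l ≤ 0` at distance at least one below the poles, the linear term is nonpositive and each
fraction is at most its residue. -/
lemma exists_eval_le (f : Herglotz) : ∃ K, 0 ≤ K ∧ ∃ L, ∀ l ≤ L,
    (∀ p ∈ f.res.support, l < p) ∧ f.eval l ≤ K := by
  obtain ⟨M, hM⟩ := f.res.support.bddBelow
  refine ⟨|f.const| + ∑ p ∈ f.res.support, f.res p, ?_, min 0 (M - 1), fun l hl => ⟨?_, ?_⟩⟩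
  · exact add_nonneg (abs_nonneg _) (Finset.sum_nonneg fun p _ => f.res_nonneg p)
  · intro p hp
    have := hM hp
    linarith [min_le_right 0 (M - 1)]
  · unfold eval
    have h1 := mul_nonneg f.slope_nonneg (neg_nonneg.mpr (hl.trans (min_le_left _ _)))
    have h2 : ∑ p ∈ f.res.support, f.res p / (p - l) ≤ ∑ p ∈ f.res.support, f.res p := by
      refine Finset.sum_le_sum fun p hp => div_le_self (f.res_nonneg p) ?_
      have := hM hp
      linarith [min_le_right 0 (M - 1)]
    linarith [le_abs_self f.const]

lemma eval_up_pos_of_mem (f : Herglotz) {l : ℝ} (h : ∀ p ∈ f.res.support, l ≤ p)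
    (hl : l ∈ f.res.support) : 0 < f.up.eval l := by
  rw [f.eval_up_of_mem_support hl]
  refine mul_pos f.lead_pos (mul_pos (f.res_pos hl) (eval_nodal_pos fun q hq => ?_))
  exact lt_of_le_of_ne (h q (Finset.mem_of_mem_erase hq)) (Finset.ne_of_mem_erase hq).symm

lemma lt_of_le_of_notMem (f : Herglotz) {l : ℝ} (h : ∀ p ∈ f.res.support, l ≤ p)
    (hl : l ∉ f.res.support) : ∀ p ∈ f.res.support, l < p := fun p hp =>
  lt_of_le_of_ne (h p hp) (by rintro rfl; exact hl hp)

lemma eval_down_of_mem (f : Herglotz) {l : ℝ} (hl : l ∈ f.res.support) : f.down.eval l = 0 := by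
  rw [down_eq, eval_mul, eval_nodal_of_mem hl, mul_zero]

end Herglotz

/-! ### Positivity of `phi` and `psi` up to the lowest eigenvalue, by continuity in the parameter.
-/

/-- The characteristic function of the problem. -/
noncomputable def charFun (s : ℝ → ℝ) (f F : OnePoint Herglotz) (l : ℝ) : ℝ :=
  (down F).eval l * phiQuasi s f l Real.pi - (up F).eval l * phi s f l Real.pi

/-- The parameter `l` is below all poles of `f`. -/
def BelowPoles (l : ℝ) (f : OnePoint Herglotz) : Prop :=
  ∀ g : Herglotz, f = (g : OnePoint Herglotz) → ∀ p ∈ g.res.support, l < p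

lemma belowPoles_infty (l : ℝ) : BelowPoles l ∞ := fun g h => absurd h.symm (OnePoint.coe_ne_infty g)

lemma belowPoles_coe {l : ℝ} {g : Herglotz} :
    BelowPoles l (g : OnePoint Herglotz) ↔ ∀ p ∈ g.res.support, l < p :=
  ⟨fun h => h g rfl, fun h g' hg => by rwa [← OnePoint.coe_injective hg]⟩

/-- The solution `phi` is positive and its logarithmic derivative at `π` exceeds `F`. -/
structure IsSubcritical (s : ℝ → ℝ) (f F : OnePoint Herglotz) (l : ℝ) : Prop where
  phi_pos : ∀ x ∈ Icc 0 Real.pi, 0 < phi s f l x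
  left : BelowPoles l f
  right : BelowPoles l F
  charFun_pos : 0 < charFun s f F l

section
variable {s : ℝ → ℝ} (hs : MemLp s 2 (volume.restrict (Ioo 0 Real.pi)))
include hs

lemma continuous_charFun (f F : OnePoint Herglotz) : Continuous (charFun s f F) :=
  have hp : Real.pi ∈ Icc 0 Real.pi := ⟨Real.pi_pos.le, le_rfl⟩
  ((down F).continuous.mul (continuous_phiQuasi hs f hp)).sub
    ((up F).continuous.mul (continuous_phi hs f hp))

lemma isEigenvalue_of_charFun_eq_zero {f F : OnePoint Herglotz} {l : ℝ}
    (hne : ∃ x ∈ Icc 0 Real.pi, phi s f l x ≠ 0) (h : charFun s f F l = 0) :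
    IsEigenvalue s f F l := by
  refine isEigenvalue_of_real (isSolution_phi hs f l) hne ?_ (sub_eq_zero.mp h)
  rw [phi_zero hs, phiQuasi_zero hs]
  ring

/-- Openness: `phi` has a positive minimum and varies uniformly, and the remaining conditions are
finitely many strict inequalities. -/
lemma IsSubcritical.eventually {f F : OnePoint Herglotz} {m : ℝ} (h : IsSubcritical s f F m) :
    ∀ᶠ l in nhds m, IsSubcritical s f F l := by
  have hpoles : ∀ {k : OnePoint Herglotz}, BelowPoles m k → ∀ᶠ l in nhds m, BelowPoles l k := by
    intro k hk
    induction k using OnePoint.rec with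
    | infty => exact Filter.Eventually.of_forall belowPoles_infty
    | coe g =>
      simp only [belowPoles_coe] at hk ⊢
      exact (Filter.eventually_all_finset _).mpr fun p hp => eventually_lt_nhds (hk p hp)
  obtain ⟨x₀, hx₀, hmin⟩ := isCompact_Icc.exists_isMinOn (nonempty_Icc.mpr Real.pi_pos.le)
    (isSolution_phi hs f m).continuousOn
  filter_upwards [hpoles h.left, hpoles h.right, eventually_phi_near hs f m (h.phi_pos x₀ hx₀),
    (continuous_charFun hs f F).continuousAt.eventually (lt_mem_nhds h.charFun_pos)]
    with l h1 h2 h3 h4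
  refine ⟨fun x hx => ?_, h1, h2, h4⟩
  have h5 := neg_lt_of_abs_lt (h3 x hx).1
  have h6 : phi s f m x₀ ≤ phi s f m x := hmin hx
  linarith

/-- At a limit of subcritical parameters that is not a Dirichlet eigenvalue the solution `phi` is
still positive. -/
lemma phi_pos_of_frequently {g : Herglotz} {F : OnePoint Herglotz} {m : ℝ}
    (h : ∃ᶠ l in nhds m, IsSubcritical s g F l) (hF : F = ∞ → ¬ IsEigenvalue s g F m) :
    (∀ x ∈ Icc 0 Real.pi, 0 < phi s g m x) ∧ BelowPoles m g ∧ BelowPoles m F ∧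
      0 ≤ charFun s g F m := by
  have hp := Real.pi_pos
  have hπ : Real.pi ∈ Icc 0 Real.pi := ⟨hp.le, le_rfl⟩
  have h0 : (0 : ℝ) ∈ Icc 0 Real.pi := ⟨le_rfl, hp.le⟩
  have hlim : ∀ {u : ℝ → ℝ}, Continuous u → (∀ l, IsSubcritical s g F l → 0 ≤ u l) → 0 ≤ u m := by
    intro u hu hul
    by_contra! hneg
    obtain ⟨l, hl1, hl2⟩ := (h.and_eventually (hu.continuousAt.eventually (gt_mem_nhds hneg))).exists
    exact (hul l hl1).not_gt hl2
  have hsol := isSolution_phi hs (g : OnePoint Herglotz) m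
  have hnn : ∀ x ∈ Icc 0 Real.pi, 0 ≤ phi s g m x := fun x hx =>
    hlim (continuous_phi hs _ hx) fun l hl => (hl.phi_pos x hx).le
  have hD : 0 ≤ charFun s g F m := hlim (continuous_charFun hs _ F) fun l hl => hl.charFun_pos.le
  have hgle : ∀ p ∈ g.res.support, m ≤ p := fun p hp =>
    sub_nonneg.mp (hlim (u := fun l => p - l) (by fun_prop) fun l hl =>
      (sub_pos.mpr (belowPoles_coe.mp hl.left p hp)).le)
  -- At the lowest pole `phi` would start at zero with quasi-derivative `-up < 0` and become
  -- negative.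
  have hgm : m ∉ g.res.support := by
    intro hm
    have h1 := hsol.quasi_nonneg_of_zero hs hnn (x₀ := 0) ⟨le_rfl, hp⟩
      (by rw [phi_zero hs]; exact g.eval_down_of_mem hm)
    rw [phiQuasi_zero hs] at h1
    have h2 := g.eval_up_pos_of_mem hgle hm
    change 0 ≤ -(g.up).eval m at h1
    linarith
  have hg := g.lt_of_le_of_notMem hgle hgm
  have hphi0 : 0 < phi s g m 0 := by
    rw [phi_zero hs]
    exact g.eval_down_pos hg
  have hpi_ne : phi s g m Real.pi = 0 → phiQuasi s g m Real.pi < 0 := by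
    intro hz
    refine lt_of_le_of_ne (hsol.quasi_nonpos_of_zero hs hnn ⟨hp, le_rfl⟩ hz) fun hz' => ?_
    exact hphi0.ne' (hsol.eq_zero hs hπ hz hz' 0 h0).1
  have hright : 0 < phi s g m Real.pi ∧ BelowPoles m F := by
    induction F using OnePoint.rec with
    | infty =>
      refine ⟨lt_of_le_of_ne (hnn _ hπ) fun hz => ?_, belowPoles_infty m⟩
      refine hF rfl (isEigenvalue_of_charFun_eq_zero hs ⟨0, h0, hphi0.ne'⟩ ?_)
      simp [charFun, down, up, ← hz]
    | coe k =>
      have hkle : ∀ p ∈ k.res.support, m ≤ p := fun p hp =>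
        sub_nonneg.mp (hlim (u := fun l => p - l) (by fun_prop) fun l hl =>
          (sub_pos.mpr (belowPoles_coe.mp hl.right p hp)).le)
      have hD' : 0 ≤ k.down.eval m * phiQuasi s g m Real.pi - k.up.eval m * phi s g m Real.pi := hD
      by_cases hkm : m ∈ k.res.support
      -- At a pole of `F` the limit inequality forces `phi π = 0`, hence `phiQuasi π < 0`. Nearby
      -- subcritical parameters then have a negative characteristic function, which is impossible.
      · exfalso
        have hup := k.eval_up_pos_of_mem hkle hkm
        rw [k.eval_down_of_mem hkm, zero_mul, zero_sub] at hD'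
        have hz : phi s g m Real.pi = 0 := le_antisymm (by nlinarith) (hnn _ hπ)
        have hneg := hpi_ne hz
        have hev := (k.up.continuous.continuousAt.eventually (lt_mem_nhds hup)).and
          ((continuous_phiQuasi hs (g : OnePoint Herglotz) hπ).continuousAt.eventually
            (gt_mem_nhds hneg))
        obtain ⟨l, hl1, hl2, hl3⟩ := (h.and_eventually hev).exists
        have h1 := k.eval_down_pos (belowPoles_coe.mp hl1.right)
        have h2 := hl1.phi_pos _ hπ
        have h3 : 0 < k.down.eval l * phiQuasi s g l Real.pi - k.up.eval l * phi s g l Real.pi :=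
          hl1.charFun_pos
        have h4 := mul_pos hl2 h2
        have h5 := mul_pos h1 (neg_pos.mpr hl3)
        linarith
      · have hk := k.lt_of_le_of_notMem hkle hkm
        refine ⟨lt_of_le_of_ne (hnn _ hπ) fun hz => ?_, belowPoles_coe.mpr hk⟩
        have h1 := hpi_ne hz.symm
        rw [← hz, mul_zero, sub_zero] at hD'
        have h2 := k.eval_down_pos hk
        have := mul_pos h2 (neg_pos.mpr h1)
        linarith
  refine ⟨fun x hx => ?_, belowPoles_coe.mpr hg, hright.2, hD⟩
  rcases hx.2.lt_or_eq with hx' | rfl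
  · exact hsol.pos_of_nonneg hs hnn hphi0 ⟨hx.1, hx'⟩
  · exact hright.1

/-- Bounds `K` and `K'` for the coefficients near `-∞` are added, so that `exists_forall_le_pos`
with `K + K'` serves both ends: the initial slope is at least `-K`, and at `π` the logarithmic
derivative exceeds `K'`. -/
lemma exists_isSubcritical (g : Herglotz) (F : OnePoint Herglotz) (B : ℝ) :
    ∃ l < B, IsSubcritical s g F l := by
  obtain ⟨K, hK, L, hL⟩ := g.exists_eval_le
  have hmain : ∀ {K' : ℝ}, 0 ≤ K' → ∃ L', ∀ l ≤ L', (∀ x ∈ Icc 0 Real.pi, 0 < phi s g l x) ∧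
      BelowPoles l (g : OnePoint Herglotz) ∧
      K' * phi s g l Real.pi < phiQuasi s g l Real.pi := by
    intro K' hK'
    obtain ⟨L', hL'⟩ := exists_forall_le_pos hs (K + K')
    refine ⟨min L L', fun l hl => ?_⟩
    obtain ⟨h1, h2⟩ := hL l (hl.trans (min_le_left _ _))
    have hd := g.eval_down_pos h1
    have hup := g.eval_up fun hm => (h1 l hm).false
    have h3 := hL' l (hl.trans (min_le_right _ _)) _ _ (isSolution_phi hs (g : OnePoint Herglotz) l)
      (by rw [phi_zero hs]; exact hd)
      (by
        rw [phi_zero hs, phiQuasi_zero hs]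
        change -((K + K') * g.down.eval l) ≤ -g.up.eval l
        rw [hup]
        nlinarith)
    refine ⟨h3.1, belowPoles_coe.mpr h1, lt_of_le_of_lt ?_ h3.2⟩
    have := h3.1 Real.pi ⟨Real.pi_pos.le, le_rfl⟩
    nlinarith
  induction F using OnePoint.rec with
  | infty =>
    obtain ⟨L', hL'⟩ := hmain le_rfl
    have hl : min L' (B - 1) < B := by linarith [min_le_right L' (B - 1)]
    obtain ⟨h1, h2, -⟩ := hL' _ (min_le_left L' (B - 1))
    refine ⟨_, hl, h1, h2, belowPoles_infty _, ?_⟩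
    simpa [charFun, down, up] using h1 _ ⟨Real.pi_pos.le, le_rfl⟩
  | coe k =>
    obtain ⟨K', hK', M, hM⟩ := k.exists_eval_le
    obtain ⟨L', hL'⟩ := hmain hK'
    set l := min (min L' M) (B - 1) with hldef
    have hl : l < B := by linarith [min_le_right (min L' M) (B - 1)]
    obtain ⟨h1, h2, h3⟩ := hL' l ((min_le_left _ _).trans (min_le_left _ _))
    obtain ⟨h4, h5⟩ := hM l ((min_le_left _ _).trans (min_le_right _ _))
    refine ⟨l, hl, h1, h2, belowPoles_coe.mpr h4, ?_⟩
    change 0 < k.down.eval l * phiQuasi s g l Real.pi - k.up.eval l * phi s g l Real.pi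
    rw [k.eval_up fun hm => (h4 l hm).false]
    have h6 := k.eval_down_pos h4
    have h7 := h1 Real.pi ⟨Real.pi_pos.le, le_rfl⟩
    have h8 := mul_le_mul_of_nonneg_right h5 h7.le
    have h9 := mul_pos h6 (sub_pos.mpr (h8.trans_lt h3))
    linarith

/-- The solution `phi` is positive up to the smallest eigenvalue. -/
theorem phi_pos_of_forall_lt {g : Herglotz} {F : OnePoint Herglotz} {m : ℝ}
    (hm : ∀ l < m, ¬ IsEigenvalue s g F l) (hF : F = ∞ → ¬ IsEigenvalue s g F m) :
    (∀ x ∈ Icc 0 Real.pi, 0 < phi s g m x) ∧ BelowPoles m g ∧ BelowPoles m F := by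
  have h0 : (0 : ℝ) ∈ Icc 0 Real.pi := ⟨le_rfl, Real.pi_pos.le⟩
  obtain ⟨a, ha, hsub⟩ := exists_isSubcritical hs g F m
  have hall : ∀ l ∈ Ico a m, IsSubcritical s g F l := by
    intro b hb
    -- A limit of subcritical parameters can fail to be subcritical only if `charFun` vanishes
    -- there, that is, at an eigenvalue. Being also open to the right, the set is all of `[a, b]`.
    have hclosed : IsClosed ({l | IsSubcritical s g F l} ∩ Icc a b) := by
      rw [isClosed_iff_frequently]
      intro l hl
      have hl2 : l ∈ Icc a b := isClosed_Icc.mem_of_frequently_of_tendsto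
        (hl.mono fun _ h => h.2) Filter.tendsto_id
      have hne := hm l (hl2.2.trans_lt hb.2)
      obtain ⟨h1, h2, h3, h4⟩ := phi_pos_of_frequently hs (hl.mono fun _ h => h.1) fun _ => hne
      refine ⟨⟨h1, h2, h3, lt_of_le_of_ne h4 fun h => hne ?_⟩, hl2⟩
      exact isEigenvalue_of_charFun_eq_zero hs ⟨0, h0, (h1 0 h0).ne'⟩ h.symm
    exact hclosed.Icc_subset_of_forall_mem_nhdsWithin hsub
      (fun l hl => mem_nhdsWithin_of_mem_nhds (IsSubcritical.eventually hs hl.1)) ⟨hb.1, le_rfl⟩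
  have hfreq : ∃ᶠ l in nhds m, IsSubcritical s g F l := by
    have : ∀ᶠ l in nhdsWithin m (Iio m), IsSubcritical s g F l := by
      filter_upwards [Ico_mem_nhdsLT ha] with l hl using hall l hl
    exact this.frequently.filter_mono nhdsWithin_le_nhds
  obtain ⟨h1, h2, h3, -⟩ := phi_pos_of_frequently hs hfreq hF
  exact ⟨h1, h2, h3⟩

/-- Below the smallest eigenvalue of a problem with a Dirichlet condition at `0` the solution `psi`
is positive. -/
theorem psi_pos_of_forall_le {g : Herglotz} {m : ℝ} (hm : ∀ l ≤ m, ¬ IsEigenvalue s ∞ g l) :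
    (∀ x ∈ Icc 0 Real.pi, 0 < psi s g m x) ∧ BelowPoles m g := by
  have hs' := memLp_reflect hs
  have hm' : ∀ l ≤ m, ¬ IsEigenvalue (fun x => -s (Real.pi - x)) g ∞ l := by
    intro l hl h
    exact hm l hl (by simpa using h.reflect)
  obtain ⟨h1, h2, -⟩ := phi_pos_of_forall_lt hs' (fun l hl => hm' l hl.le) fun _ => hm' m le_rfl
  refine ⟨fun x hx => ?_, h2⟩
  have hx' : Real.pi - x ∈ Icc 0 Real.pi := ⟨by linarith [hx.2], by linarith [hx.1]⟩
  have heq := ((isSolution_psi hs (g : OnePoint Herglotz) m).reflect.eqOn hs'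
    (isSolution_phi hs' (g : OnePoint Herglotz) m) (x₀ := 0) ⟨le_rfl, Real.pi_pos.le⟩
    (by simp [psi_pi hs, phi_zero hs']) (by simp [psiQuasi_pi hs, phiQuasi_zero hs']) _ hx').1
  rw [sub_sub_cancel] at heq
  rw [heq]
  exact h1 _ hx'

end

end SturmLiouville

namespace SturmLiouville

/-! ### The Darboux transformation of solutions -/

/-- The function `r` is absolutely continuous and solves the Riccati equation
`r' = -m - (r + s)²`. -/
structure IsRiccati (s : ℝ → ℝ) (m : ℝ) (r : ℝ → ℝ) : Prop where
  ac : AbsolutelyContinuousOnInterval r 0 Real.pi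
  deriv_eq : ∀ᵐ x ∂volume.restrict (Ioo 0 Real.pi), HasDerivAt r (-m - (r x + s x) ^ 2) x

/-- Passing to `v₁ / v` makes the transformation depend on `v` only through the Riccati equation, so
its inverse needs no separate solution. -/
lemma IsSolution.isRiccati {s : ℝ → ℝ} {m : ℝ} {v v₁ : ℝ → ℝ} (h : IsSolution s m v v₁)
    (hv : ∀ x ∈ Icc 0 Real.pi, v x ≠ 0) : IsRiccati s m (fun x => v₁ x / v x) where
  ac := h.ac_quasi.fun_div h.ac (by rwa [uIcc_of_le Real.pi_pos.le])
  deriv_eq := by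
    filter_upwards [h.deriv_eq, h.deriv_quasi_eq, ae_restrict_mem measurableSet_Ioo]
      with x h1 h2 hx
    have hvx := hv x (Ioo_subset_Icc_self hx)
    refine (h2.div h1 hvx).congr_deriv ?_
    simp only [RCLike.ofReal_real_eq_id, id_eq]
    field_simp
    ring

/-- The coefficient `-s - 2 r + c` of the transformed equation, almost everywhere. -/
def IsDarbouxCoeff (s r : ℝ → ℝ) (c : ℝ) (t : ℝ → ℝ) : Prop :=
  ∀ᵐ x ∂volume.restrict (Ioo 0 Real.pi), t x = -s x - 2 * r x + c

lemma _root_.HasDerivAt.ofReal_rclike {𝕜 : Type*} [RCLike 𝕜] {g : ℝ → ℝ} {g' x : ℝ}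
    (hg : HasDerivAt g g' x) : HasDerivAt (fun x => (g x : 𝕜)) (g' : 𝕜) x := by
  refine ((RCLike.ofRealCLM (K := 𝕜)).hasFDerivAt.comp_hasDerivAt x hg).congr_deriv ?_
  simp

namespace IsDarbouxCoeff

variable {s r t : ℝ → ℝ} {c m : ℝ}

/-- Since `(r - c) + t = -(r + s)`, the function `r - c` solves the Riccati equation for `t`. The
inverse is therefore a transformation of the same kind, with shift `-c`. -/
lemma symm (ht : IsDarbouxCoeff s r c t) : IsDarbouxCoeff t (fun x => r x - c) (-c) s := by
  filter_upwards [ht] with x hx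
  rw [hx]
  ring

lemma isRiccati (ht : IsDarbouxCoeff s r c t) (hr : IsRiccati s m r) :
    IsRiccati t m (fun x => r x - c) where
  ac := hr.ac.fun_sub (AbsolutelyContinuousOnInterval.const c)
  deriv_eq := by
    filter_upwards [hr.deriv_eq, ht] with x h1 h2
    refine (h1.sub_const c).congr_deriv ?_
    rw [h2]
    ring

/-- The transformation maps solutions to solutions. -/
lemma isSolution {𝕜 : Type*} [RCLike 𝕜] {z : 𝕜} {y y₁ : ℝ → 𝕜} (ht : IsDarbouxCoeff s r c t)
    (hr : IsRiccati s m r) (h : IsSolution s z y y₁) :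
    IsSolution t z (fun x => y₁ x - r x * y x)
      (fun x => (m - z) * y x + (r x - c) * (y₁ x - r x * y x)) := by
  have hac : AbsolutelyContinuousOnInterval (fun x => y₁ x - r x * y x) 0 Real.pi :=
    h.ac_quasi.fun_sub' (hr.ac.ofReal.fun_mul' h.ac)
  have hac₁ : AbsolutelyContinuousOnInterval (fun x => ((m : 𝕜) - z) * y x) 0 Real.pi :=
    (AbsolutelyContinuousOnInterval.const ((m : 𝕜) - z)).fun_mul' h.ac
  have hac₂ : AbsolutelyContinuousOnInterval (fun x => (r x : 𝕜) - c) 0 Real.pi :=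
    hr.ac.ofReal.fun_sub' (AbsolutelyContinuousOnInterval.const (c : 𝕜))
  have hd : ∀ᵐ x ∂volume.restrict (Ioo 0 Real.pi), HasDerivAt (fun x => y₁ x - r x * y x)
      ((m - z) * y x - (r x + s x) * (y₁ x - r x * y x)) x := by
    filter_upwards [h.deriv_eq, h.deriv_quasi_eq, hr.deriv_eq] with x h1 h2 h3
    refine (h2.sub (h3.ofReal_rclike.mul h1)).congr_deriv ?_
    push_cast
    ring
  refine ⟨hac, hac₁.fun_add' (hac₂.fun_mul' hac), ?_, ?_⟩
  · filter_upwards [hd, ht] with x h1 h4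
    refine h1.congr_deriv ?_
    rw [h4]
    push_cast
    ring
  · filter_upwards [h.deriv_eq, hd, hr.deriv_eq, ht] with x h1 h2 h3 h4
    refine ((h1.const_mul ((m : 𝕜) - z)).add ((h3.ofReal_rclike.sub_const (c : 𝕜)).mul h2)).congr_deriv ?_
    rw [h4]
    push_cast
    ring

end IsDarbouxCoeff

/-! ### The transformation of the boundary conditions -/

/-- The relation between the boundary coefficients `f` and `f' = theta m t k f`. -/
structure ThetaRel (m t k : ℝ) (f f' : OnePoint Herglotz) : Prop where
  up_sub : up f - C t * down f = thetaFactor m f * down f'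
  up_eq : up f' = -down f + C k * down f'

/-- For `∞` both sides are zero. This identity is what allows finite coefficients and `∞` to be
treated together. -/
lemma thetaFactor_mul_down (m : ℝ) (f : OnePoint Herglotz) :
    thetaFactor m f * down f = (X - C m) * down f := by
  induction f using OnePoint.rec with
  | infty => change -1 * (0 : ℝ[X]) = _ * 0; simp
  | coe g => rfl

lemma aeval_thetaFactor_ne_zero {m : ℝ} (f : OnePoint Herglotz) {z : ℂ} (hz : z ≠ m) :
    aeval z (thetaFactor m f) ≠ 0 := by
  induction f using OnePoint.rec with
  | infty => change aeval z (-1 : ℝ[X]) ≠ 0; simp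
  | coe g =>
    change aeval z (X - C m) ≠ 0
    simpa [sub_eq_zero] using hz

lemma eval_thetaFactor_ne_zero {m : ℝ} (f : OnePoint Herglotz) {l : ℝ} (hl : l ≠ m) :
    (thetaFactor m f).eval l ≠ 0 := by
  have := aeval_thetaFactor_ne_zero (m := m) f (z := l) (by exact_mod_cast hl)
  rw [aeval_ofReal_complex] at this
  exact_mod_cast this

namespace ThetaRel

variable {m t k : ℝ} {f f' : OnePoint Herglotz}

/-- Differentiate the two polynomial relations and eliminate; for `f = ∞` all terms vanish. The
mixed term will cancel an endpoint term of the integral identity in the norming constants. -/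
lemma wronskian_eq (h : ThetaRel m t k f f') (l : ℝ) :
    (thetaFactor m f).eval l ^ 2 * wronskian f' l +
      (thetaFactor m f).eval l * ((down f).eval l * (down f').eval l) =
      (l - m) * wronskian f l := by
  obtain ⟨h1, h2⟩ := h
  induction f using OnePoint.rec with
  | infty =>
    change up f' = -0 + _ at h2
    have h3 : wronskian ∞ l = 0 := by simp [wronskian, up, down]
    have h4 : (down ∞).eval l = 0 := by simp [down]
    have h5 : wronskian f' l = 0 := by
      rw [wronskian, h2]
      simp
      ring
    rw [h3, h4, h5]
    ring
  | coe g =>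
    change up (g : OnePoint Herglotz) - _ = (X - C m) * _ at h1
    have h3 := eq_add_of_sub_eq h1
    change (X - C m).eval l ^ 2 * _ + (X - C m).eval l * _ = _
    simp only [wronskian, h3, h2, derivative_add, derivative_mul, derivative_sub, derivative_neg,
      derivative_C, derivative_X, eval_add, eval_mul, eval_sub, eval_neg, eval_C, eval_X,
      eval_zero, eval_one]
    ring

lemma aeval_rel {𝕜 : Type*} [RCLike 𝕜] (h : ThetaRel m t k f f') (z : 𝕜) :
    aeval z (up f) = t * aeval z (down f) + aeval z (thetaFactor m f) * aeval z (down f') ∧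
    aeval z (up f') = -aeval z (down f) + k * aeval z (down f') ∧
    aeval z (thetaFactor m f) * aeval z (down f) = (z - m) * aeval z (down f) := by
  have h1 := congrArg (aeval z) (eq_add_of_sub_eq h.up_sub)
  have h2 := congrArg (aeval z) h.up_eq
  have h3 := congrArg (aeval z) (thetaFactor_mul_down m f)
  simp only [map_add, map_mul, map_neg, map_sub, aeval_C, aeval_X] at h1 h2 h3
  exact ⟨by rw [h1, add_comm], h2, h3⟩

lemma eval_rel (h : ThetaRel m t k f f') (l : ℝ) :
    (up f).eval l = t * (down f).eval l + (thetaFactor m f).eval l * (down f').eval l ∧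
    (up f').eval l = -(down f).eval l + k * (down f').eval l ∧
    (thetaFactor m f).eval l * (down f).eval l = (l - m) * (down f).eval l := by
  simpa using h.aeval_rel (𝕜 := ℝ) l

/-- For finite `f`, the first relation and its derivative at `m` give `wronskian f m = down f * down
f'` there, and the Wronskian is nonnegative. These signs exclude the eigenvalue `m` of the
transformed problem. -/
lemma eval_down_nonneg (h : ThetaRel m t k f f') (hm : BelowPoles m f) :
    0 ≤ (down f').eval m ∧ 0 ≤ (down f).eval m ∧
      ((down f).eval m = 0 → (down f').eval m ≠ 0) ∧ (f ≠ ∞ → (down f).eval m ≠ 0) := by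
  have h1 := h.up_sub
  have hw := h.wronskian_eq
  induction f using OnePoint.rec with
  | infty =>
    change (-1 : ℝ[X]) - C t * 0 = -1 * _ at h1
    have : down f' = 1 := by linear_combination h1
    rw [this]
    simp [down]
  | coe g =>
    have hd := g.eval_down_pos (belowPoles_coe.mp hm)
    change up (g : OnePoint Herglotz) - _ = (X - C m) * _ at h1
    have h2 := congrArg (Polynomial.eval m) h1
    have h3 := congrArg (fun p => (derivative p).eval m) h1
    have h4 := g.wronskian_nonneg m
    simp only [wronskian, derivative_mul, derivative_sub, derivative_C, derivative_X, eval_add,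
      eval_mul, eval_sub, eval_C, eval_X, eval_zero, eval_one] at h2 h3 h4
    have hd' : 0 < (down (g : OnePoint Herglotz)).eval m := hd
    refine ⟨?_, hd'.le, fun h => absurd h hd'.ne', fun _ => hd'.ne'⟩
    refine nonneg_of_mul_nonneg_right (h4.trans_eq ?_) hd'
    linear_combination (down (g : OnePoint Herglotz)).eval m * h3 -
      (derivative (down (g : OnePoint Herglotz))).eval m * h2

/-- The transformation of the boundary condition under the transformation of solutions. -/
lemma boundary_iff {z y y₁ : ℂ} (h : ThetaRel m t k f f') (hz : z ≠ m) :
    aeval z (down f) * y₁ = -(aeval z (up f) * y) ↔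
      aeval z (down f') * ((m - z) * y - k * (y₁ + t * y)) =
        -(aeval z (up f') * (y₁ + t * y)) := by
  obtain ⟨h1, h2, h3⟩ := h.aeval_rel z
  have hE := aeval_thetaFactor_ne_zero f hz
  have key : aeval z (thetaFactor m f) * (aeval z (down f') * ((m - z) * y - k * (y₁ + t * y)) +
      aeval z (up f') * (y₁ + t * y)) =
      (m - z) * (aeval z (down f) * y₁ + aeval z (up f) * y) := by
    simp only [RCLike.ofReal_eq_complex_ofReal] at h1 h2
    linear_combination (aeval z (thetaFactor m f) * (y₁ + t * y)) * h2 - ((m - z) * y) * h1 -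
      (y₁ + t * y) * h3
  rw [← add_eq_zero_iff_eq_neg, ← add_eq_zero_iff_eq_neg]
  constructor
  · intro h'
    rw [h', mul_zero] at key
    exact (mul_eq_zero.mp key).resolve_left hE
  · intro h'
    rw [h', mul_zero] at key
    exact (mul_eq_zero.mp key.symm).resolve_left (sub_ne_zero.mpr hz.symm)

end ThetaRel

end SturmLiouville

namespace SturmLiouville

/-! ### The transformation of eigenvalues -/

section
variable {s r t : ℝ → ℝ} {m c : ℝ} {f F f' F' : OnePoint Herglotz}

/-- Off the parameter `m` the transformation maps eigenfunctions to eigenfunctions. -/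
lemma IsEigenvalue.darboux (ht : IsDarbouxCoeff s r c t) (hr : IsRiccati s m r)
    (hf : ThetaRel m (-r 0) (-r 0 + c) f f')
    (hF : ThetaRel m (r Real.pi) (r Real.pi - c) F F') {z : ℂ} (hz : z ≠ m)
    (h : IsEigenvalue s f F z) : IsEigenvalue t f' F' z := by
  obtain ⟨y, y₁, hy, ⟨x, hx, hxne⟩, h0, h1⟩ := h
  have hsol := ht.isSolution hr hy
  refine ⟨_, _, hsol, ?_, ?_, ?_⟩
  -- If the transformed function were zero, so would be its quasi-derivative, which then reduces to
  -- `(m - z) y`.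
  · by_contra! hzero
    have h2 := hsol.quasi_eq_zero hzero x hx
    have h3 := hzero x hx
    rw [h3, mul_zero, add_zero] at h2
    exact (mul_ne_zero (sub_ne_zero.mpr hz.symm) hxne) h2
  · have := (hf.boundary_iff hz).mp h0
    simp only [RCLike.ofReal_eq_complex_ofReal]
    push_cast at this
    linear_combination this
  -- The condition at `π` has the opposite sign, hence `-y π`.
  · have := (hF.boundary_iff (y := -y Real.pi) hz).mp (by rw [h1]; ring)
    simp only [RCLike.ofReal_eq_complex_ofReal]
    push_cast at this
    linear_combination -this

/-- Off the parameter `m` every eigenfunction of the transformed problem arises from an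
eigenfunction of the original one. -/
lemma IsEigenvalue.of_darboux (ht : IsDarbouxCoeff s r c t) (hr : IsRiccati s m r)
    (hf : ThetaRel m (-r 0) (-r 0 + c) f f')
    (hF : ThetaRel m (r Real.pi) (r Real.pi - c) F F') {z : ℂ} (hz : z ≠ m)
    (h : IsEigenvalue t f' F' z) : IsEigenvalue s f F z := by
  obtain ⟨y, y₁, hy, ⟨x, hx, hxne⟩, h0, h1⟩ := h
  have hsol := ht.symm.isSolution (ht.isRiccati hr) hy
  refine ⟨_, _, hsol, ?_, ?_, ?_⟩
  · by_contra! hzero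
    have h2 := hsol.quasi_eq_zero hzero x hx
    have h3 := hzero x hx
    rw [h3, mul_zero, add_zero] at h2
    exact (mul_ne_zero (sub_ne_zero.mpr hz.symm) hxne) h2
  · refine (hf.boundary_iff hz).mpr ?_
    simp only [RCLike.ofReal_eq_complex_ofReal]
    push_cast
    linear_combination (m - z) * h0
  · have := (hF.boundary_iff (y := -(y₁ Real.pi - ((r Real.pi - c : ℝ) : ℂ) * y Real.pi)) (y₁ :=
      (m - z) * y Real.pi + (((r Real.pi - c : ℝ) : ℂ) - ((-c : ℝ) : ℂ)) *
        (y₁ Real.pi - ((r Real.pi - c : ℝ) : ℂ) * y Real.pi)) hz).mpr (by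
      push_cast
      linear_combination (-(m - z)) * h1)
    simp only [RCLike.ofReal_eq_complex_ofReal]
    linear_combination this

/-- The parameter `m` itself is not an eigenvalue of the transformed problem. -/
lemma not_isEigenvalue_darboux {v v₁ : ℝ → ℝ} (hv : IsSolution s m v v₁)
    (hv0 : ∀ x ∈ Icc 0 Real.pi, v x ≠ 0) (ht : IsDarbouxCoeff s (fun x => v₁ x / v x) c t)
    (hf : ThetaRel m (-(v₁ 0 / v 0)) (-(v₁ 0 / v 0) + c) f f')
    (hF : ThetaRel m (v₁ Real.pi / v Real.pi) (v₁ Real.pi / v Real.pi - c) F F')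
    (hmf : BelowPoles m f) (hmF : BelowPoles m F) (hfF : f ≠ ∞ ∨ F ≠ ∞) :
    ¬ IsEigenvalue t f' F' m := by
  rintro ⟨y, y₁, hy, ⟨x, hx, hxne⟩, h0, h1⟩
  have hp := Real.pi_pos
  have hr := hv.isRiccati hv0
  set r : ℝ → ℝ := fun x => v₁ x / v x with hrdef
  have hsol := ht.symm.isSolution (ht.isRiccati hr) hy
  set w : ℝ → ℂ := fun x => y₁ x - ((r x - c : ℝ) : ℂ) * y x with hw
  have hv0' : ∀ x ∈ uIcc 0 Real.pi, v x ≠ 0 := by rwa [uIcc_of_le hp.le]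
  have hrv : ∀ x ∈ Icc 0 Real.pi, (r x : ℂ) * v x = v₁ x := by
    intro x hx
    have := div_mul_cancel₀ (v₁ x) (hv0 x hx)
    exact_mod_cast this
  have hvC : ∀ x ∈ Icc 0 Real.pi, (v x : ℂ) ≠ 0 := fun x hx => by exact_mod_cast hv0 x hx
  -- At `z = m` the quasi-derivative of `w` is `r w`, so `w` and `v` satisfy the same first order
  -- equation.
  obtain ⟨Cw, hCw⟩ : ∃ Cw : ℂ, ∀ x ∈ Icc 0 Real.pi, w x = Cw * v x := by
    have hac : AbsolutelyContinuousOnInterval (fun x => w x * ((v x)⁻¹ : ℝ)) 0 Real.pi :=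
      hsol.ac.fun_mul' (hv.ac.inv hv0').ofReal
    have hconst := hac.eq_const_of_hasDerivAt_zero hp.le (by
      filter_upwards [hsol.deriv_eq, hv.deriv_eq, ae_restrict_mem measurableSet_Ioo]
        with x h2 h3 hx
      have hx' := Ioo_subset_Icc_self hx
      refine (h2.mul ((h3.inv (hv0 x hx')).ofReal_rclike (𝕜 := ℂ))).congr_deriv ?_
      have h4 := hvC x hx'
      simp only [RCLike.ofReal_eq_complex_ofReal, RCLike.ofReal_real_eq_id, id_eq, Pi.inv_apply]
      push_cast
      have h5 := hrv x hx'
      field_simp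
      rw [← h5]
      ring)
    refine ⟨w 0 * ((v 0)⁻¹ : ℝ), fun x hx => ?_⟩
    rw [← hconst x hx, mul_assoc]
    push_cast
    rw [inv_mul_cancel₀ (hvC x hx), mul_one]
  set H : ℝ → ℝ := fun x => ∫ t in (0 : ℝ)..x, v t ^ 2 with hH
  have hv2 : ContinuousOn (fun x => v x ^ 2) (Icc 0 Real.pi) := hv.continuousOn.pow 2
  have hv2i : IntervalIntegrable (fun x => v x ^ 2) volume 0 Real.pi :=
    hv2.intervalIntegrable_of_Icc hp.le
  have hHpos : 0 < H Real.pi := intervalIntegral.intervalIntegral_pos_of_pos_on hv2i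
    (fun x hx => sq_pos_of_ne_zero (hv0 x (Ioo_subset_Icc_self hx))) hp
  have hH0 : H 0 = 0 := intervalIntegral.integral_same
  -- Here `(y v)' = w v = Cw v²`.
  have hyv : ∀ x ∈ Icc 0 Real.pi, y x * v x - Cw * H x = y 0 * v 0 := by
    have hac : AbsolutelyContinuousOnInterval (fun x => y x * v x - Cw * H x) 0 Real.pi :=
      (hy.ac.fun_mul' hv.ac.ofReal).fun_sub' ((AbsolutelyContinuousOnInterval.const Cw).fun_mul'
        (hv2i.absolutelyContinuousOnInterval_intervalIntegral left_mem_uIcc).ofReal)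
    have hconst := hac.eq_const_of_hasDerivAt_zero hp.le (by
      filter_upwards [hy.deriv_eq, hv.deriv_eq, ht,
        ae_hasDerivAt_integral hp.le ⟨le_rfl, hp.le⟩ hv2i, ae_restrict_mem measurableSet_Ioo]
        with x h2 h3 h4 h5 hx
      have hx' := Ioo_subset_Icc_self hx
      refine ((h2.mul (h3.ofReal_rclike (𝕜 := ℂ))).sub
        ((h5.ofReal_rclike (𝕜 := ℂ)).const_mul Cw)).congr_deriv ?_
      have h6 := hCw x hx'
      have h7 := hrv x hx'
      simp only [hw] at h6
      rw [h4]
      simp only [RCLike.ofReal_eq_complex_ofReal, RCLike.ofReal_real_eq_id, id_eq]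
      push_cast at h6 ⊢
      linear_combination v x * h6 - y x * h7)
    intro x hx
    rw [hconst x hx, hH0]
    simp
  have hπ : Real.pi ∈ Icc 0 Real.pi := ⟨hp.le, le_rfl⟩
  have hz : (0 : ℝ) ∈ Icc 0 Real.pi := ⟨le_rfl, hp.le⟩
  obtain ⟨ha', ha, haa, hane⟩ := hf.eval_down_nonneg hmf
  obtain ⟨hb', hb, hbb, hbne⟩ := hF.eval_down_nonneg hmF
  have hu := (hf.eval_rel m).2.1
  have hU := (hF.eval_rel m).2.1
  rw [aeval_ofReal_complex, aeval_ofReal_complex] at h0 h1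
  rw [hu] at h0
  rw [hU] at h1
  set a := (down f).eval m
  set a' := (down f').eval m
  set b := (down F).eval m
  set b' := (down F').eval m
  have hleft : a' * (Cw * v 0) = a * y 0 := by
    rw [← hCw 0 hz]
    simp only [hw, hrdef]
    push_cast at h0 ⊢
    linear_combination h0
  have hright : b' * (Cw * v Real.pi) = -(b * y Real.pi) := by
    rw [← hCw _ hπ]
    simp only [hw, hrdef]
    push_cast at h1 ⊢
    linear_combination h1
  have hend := hyv _ hπ
  -- The two boundary conditions inserted into `hyv` at `π`. The bracket is positive, so `Cw = 0`
  -- and `y v` is constant; a nonzero `a` or `b` makes it zero at one end.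
  have hsum : Cw * ((a * b * H Real.pi + a * b' * v Real.pi ^ 2 + b * a' * v 0 ^ 2 : ℝ) : ℂ) = 0 := by
    push_cast
    linear_combination -(a * b : ℂ) * hend + a * v Real.pi * hright + b * v 0 * hleft
  have hvπ := sq_pos_of_ne_zero (hv0 _ hπ)
  have hvz := sq_pos_of_ne_zero (hv0 _ hz)
  have hpos : 0 < a * b * H Real.pi + a * b' * v Real.pi ^ 2 + b * a' * v 0 ^ 2 := by
    rcases ha.eq_or_lt with h | h
    · have hb0 : 0 < b := lt_of_le_of_ne hb (hbne (hfF.resolve_left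
        fun hne => hane hne h.symm)).symm
      have := lt_of_le_of_ne ha' (haa h.symm).symm
      rw [← h]
      positivity
    · rcases hb.eq_or_lt with h' | h'
      · have := lt_of_le_of_ne hb' (hbb h'.symm).symm
        rw [← h']
        positivity
      · positivity
  have hC0 : Cw = 0 := (mul_eq_zero.mp hsum).resolve_right (by exact_mod_cast hpos.ne')
  rw [hC0] at hleft hright hyv
  simp only [zero_mul, mul_zero, sub_zero] at hleft hright hyv
  have hy0 : y 0 * v 0 = 0 := by
    rcases ha.eq_or_lt with h | h
    · have hb0 : b ≠ 0 := hbne (hfF.resolve_left fun hne => hane hne h.symm)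
      have : y Real.pi = 0 := (mul_eq_zero.mp (neg_eq_zero.mp hright.symm)).resolve_left
        (by exact_mod_cast hb0)
      rw [← hyv _ hπ, this, zero_mul]
    · have : y 0 = 0 := (mul_eq_zero.mp hleft.symm).resolve_left (by exact_mod_cast h.ne')
      rw [this, zero_mul]
  have := hyv x hx
  rw [hy0] at this
  exact hxne ((mul_eq_zero.mp this).resolve_right (hvC x hx))

end

end SturmLiouville

namespace SturmLiouville

/-! ### The transformation of norming constants -/

section
variable {s r t : ℝ → ℝ} {m c : ℝ} {f F f' F' : OnePoint Herglotz}

/-- The transformation maps `phi` to a multiple of `phi`. -/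
lemma phi_darboux (hs : MemLp s 2 (volume.restrict (Ioo 0 Real.pi)))
    (hts : MemLp t 2 (volume.restrict (Ioo 0 Real.pi))) (ht : IsDarbouxCoeff s r c t)
    (hr : IsRiccati s m r) (hf : ThetaRel m (-r 0) (-r 0 + c) f f') {l : ℝ} (hl : l ≠ m) :
    ∀ x ∈ Icc 0 Real.pi, phiQuasi s f l x - r x * phi s f l x =
      -((thetaFactor m f).eval l * phi t f' l x) := by
  have ha := eval_thetaFactor_ne_zero f hl
  obtain ⟨h1, h2, h3⟩ := hf.eval_rel l
  set a := (thetaFactor m f).eval l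
  have hsol := ht.isSolution hr (isSolution_phi hs f l)
  have hsol' := (isSolution_phi hts f' l).const_mul (-a)
  intro x hx
  have := (hsol.eqOn hts hsol' (x₀ := 0) ⟨le_rfl, Real.pi_pos.le⟩
    (by
      rw [phi_zero hs, phiQuasi_zero hs, phi_zero hts, h1]
      simp only [RCLike.ofReal_real_eq_id, id_eq]
      ring)
    (by
      rw [phi_zero hs, phiQuasi_zero hs, phiQuasi_zero hts, h1, h2]
      simp only [RCLike.ofReal_real_eq_id, id_eq]
      linear_combination h3) x hx).1
  simp only [RCLike.ofReal_real_eq_id, id_eq] at this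
  rw [this, neg_mul]

/-- The transformation maps `psi` to a multiple of `psi`. -/
lemma psi_darboux (hs : MemLp s 2 (volume.restrict (Ioo 0 Real.pi)))
    (hts : MemLp t 2 (volume.restrict (Ioo 0 Real.pi))) (ht : IsDarbouxCoeff s r c t)
    (hr : IsRiccati s m r) (hF : ThetaRel m (r Real.pi) (r Real.pi - c) F F') {l : ℝ} :
    ∀ x ∈ Icc 0 Real.pi, psiQuasi s F l x - r x * psi s F l x =
      (thetaFactor m F).eval l * psi t F' l x := by
  obtain ⟨h1, h2, h3⟩ := hF.eval_rel l
  set b := (thetaFactor m F).eval l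
  have hsol := ht.isSolution hr (isSolution_psi hs F l)
  have hsol' := (isSolution_psi hts F' l).const_mul b
  intro x hx
  exact (hsol.eqOn hts hsol' (x₀ := Real.pi) ⟨Real.pi_pos.le, le_rfl⟩
    (by
      rw [psi_pi hs, psiQuasi_pi hs, psi_pi hts, h1]
      simp only [RCLike.ofReal_real_eq_id, id_eq]
      ring)
    (by
      rw [psi_pi hs, psiQuasi_pi hs, psiQuasi_pi hts, h1, h2]
      simp only [RCLike.ofReal_real_eq_id, id_eq]
      linear_combination h3) x hx).1

/-- The integral of the square of a transformed solution. -/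
lemma integral_darboux_sq {l : ℝ} {y y₁ : ℝ → ℝ} (hr : IsRiccati s m r)
    (h : IsSolution s l y y₁) :
    ∫ x in (0 : ℝ)..Real.pi, (y₁ x - r x * y x) ^ 2 =
      y Real.pi * (y₁ Real.pi - r Real.pi * y Real.pi) - y 0 * (y₁ 0 - r 0 * y 0) +
        (l - m) * ∫ x in (0 : ℝ)..Real.pi, y x ^ 2 := by
  have hp := Real.pi_pos.le
  have hacw := h.ac_quasi.fun_sub (hr.ac.fun_mul h.ac)
  -- With `w = y₁ - r y` one has `y' = w + (r + s) y` and `w' = (m - l) y - (r + s) w`, so the mixed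
  -- terms cancel in `(y w)'`.
  have hint := (h.ac.fun_mul hacw).integral_eq_sub hp
    (f' := fun x => (y₁ x - r x * y x) ^ 2 - (l - m) * y x ^ 2) (by
      filter_upwards [h.deriv_eq, h.deriv_quasi_eq, hr.deriv_eq] with x h1 h2 h3
      refine (h1.mul (h2.sub (h3.mul h1))).congr_deriv ?_
      simp only [RCLike.ofReal_real_eq_id, id_eq, Pi.sub_apply, Pi.mul_apply]
      ring)
  rw [intervalIntegral.integral_sub, intervalIntegral.integral_const_mul] at hint
  · linear_combination hint
  · exact (hacw.continuousOn.pow 2).intervalIntegrable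
  · exact (h.ac.continuousOn.pow 2).intervalIntegrable.const_mul _

/-- With `a`, `b` the theta factors at the two ends, `phi` goes to `-a phi` and `psi` to `b psi`, so
the new ratio is `-(a β / b)`. The integral identity and the two Wronskian relations add up to `a²
γ' = (l - m) γ`. -/
lemma IsNormingConstant.darboux (hs : MemLp s 2 (volume.restrict (Ioo 0 Real.pi)))
    (hts : MemLp t 2 (volume.restrict (Ioo 0 Real.pi))) (ht : IsDarbouxCoeff s r c t)
    (hr : IsRiccati s m r) (hf : ThetaRel m (-r 0) (-r 0 + c) f f')
    (hF : ThetaRel m (r Real.pi) (r Real.pi - c) F F') {l g : ℝ} (hl : l ≠ m)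
    (h : IsNormingConstant s f F l g) :
    IsNormingConstant t f' F' l (g / (l - m) ^ expI f) := by
  obtain ⟨β, hβ, hpsi, hg⟩ := h
  have hp := Real.pi_pos.le
  have hπ : Real.pi ∈ Icc 0 Real.pi := ⟨hp, le_rfl⟩
  have hz : (0 : ℝ) ∈ Icc 0 Real.pi := ⟨le_rfl, hp⟩
  have ha := eval_thetaFactor_ne_zero f hl
  have hb := eval_thetaFactor_ne_zero F hl
  have hW := hf.wronskian_eq l
  have hW' := hF.wronskian_eq l
  have hphi := phi_darboux hs hts ht hr hf hl
  have hpsi' := psi_darboux hs hts ht hr hF (l := l)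
  -- The factor is `l - m` for finite `f` and `-1` for `∞`; this is the source of the exponent `expI
  -- f`.
  have hpow : (thetaFactor m f).eval l ^ 2 = (l - m) * (l - m) ^ expI f := by
    induction f using OnePoint.rec with
    | infty =>
      have : l - m ≠ 0 := sub_ne_zero.mpr hl
      simp [thetaFactor, expI, this]
    | coe k =>
      have : (thetaFactor m (k : OnePoint Herglotz)).eval l = l - m := by
        change (X - C m).eval l = _
        simp
      rw [this]
      simp [expI, sq]
  set a := (thetaFactor m f).eval l
  set b := (thetaFactor m F).eval l
  have hquasi : ∀ x ∈ Icc 0 Real.pi, psiQuasi s F l x = β * phiQuasi s f l x := by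
    intro x hx
    refine sub_eq_zero.mp (((isSolution_psi hs F l).sub
      ((isSolution_phi hs f l).const_mul β)).quasi_eq_zero (fun x hx => ?_) x hx)
    rw [hpsi x hx, sub_self]
  have hlink : ∀ x ∈ Icc 0 Real.pi, psi t F' l x = -(a * β / b) * phi t f' l x := by
    intro x hx
    have h1 := hphi x hx
    have h2 := hpsi' x hx
    rw [hpsi x hx, hquasi x hx] at h2
    field_simp
    linear_combination -h2 + β * h1
  refine ⟨-(a * β / b), neg_ne_zero.mpr (div_ne_zero (mul_ne_zero ha hβ) hb), hlink, ?_⟩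
  have hI := integral_darboux_sq hr (isSolution_phi hs f l)
  have hI' : ∫ x in (0 : ℝ)..Real.pi, (phiQuasi s f l x - r x * phi s f l x) ^ 2 =
      a ^ 2 * ∫ x in (0 : ℝ)..Real.pi, phi t f' l x ^ 2 := by
    rw [← intervalIntegral.integral_const_mul]
    refine intervalIntegral.integral_congr fun x hx => ?_
    rw [uIcc_of_le hp] at hx
    simp only [hphi x hx]
    ring
  have hioo : ∀ u : ℝ → ℝ, ∫ x in Ioo 0 Real.pi, u x = ∫ x in (0 : ℝ)..Real.pi, u x := by
    intro u
    rw [intervalIntegral.integral_of_le hp, integral_Ioc_eq_integral_Ioo]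
  rw [hI', hphi 0 hz, hphi _ hπ, phi_zero hs, phi_zero hts] at hI
  have hphiπ : phi s f l Real.pi = (down F).eval l / β := by
    rw [eq_div_iff hβ, ← psi_pi hs, hpsi _ hπ, mul_comm]
  have hphiπ' : phi t f' l Real.pi = -(b * (down F').eval l / (a * β)) := by
    have := hlink _ hπ
    rw [psi_pi hts] at this
    rw [this]
    field_simp
  rw [hphiπ, hphiπ'] at hI
  rw [hioo] at hg ⊢
  have hlm : (l - m) ^ expI f ≠ 0 := zpow_ne_zero _ (sub_ne_zero.mpr hl)
  have hlm' := sub_ne_zero.mpr hl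
  have hmain : a ^ 2 * ((∫ x in (0 : ℝ)..Real.pi, phi t f' l x ^ 2) + wronskian f' l +
      1 / (-(a * β / b)) ^ 2 * wronskian F' l) = (l - m) * g := by
    have e1 : a ^ 2 * (1 / (-(a * β / b)) ^ 2 * wronskian F' l) =
        b ^ 2 * wronskian F' l / β ^ 2 := by
      field_simp
    have e2 : (down F).eval l / β * -(a * -(b * (down F').eval l / (a * β))) =
        b * ((down F).eval l * (down F').eval l) / β ^ 2 := by
      field_simp
    rw [mul_add, mul_add, e1, hI, e2, hg]
    linear_combination hW + hW' / β ^ 2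
  rw [div_eq_iff hlm]
  have : (l - m) * g = (l - m) * (((∫ x in (0 : ℝ)..Real.pi, phi t f' l x ^ 2) + wronskian f' l +
      1 / (-(a * β / b)) ^ 2 * wronskian F' l) * (l - m) ^ expI f) := by
    rw [← hmain, hpow]
    ring
  exact mul_left_cancel₀ hlm' this

end

/-! ### The generating solution -/

section
variable {s : ℝ → ℝ} {f F : OnePoint Herglotz} {lam gam : ℕ → ℝ}

lemma IsSpectralData.minEigenvalue_eq (h : IsSpectralData s f F lam gam) :
    minEigenvalue s f F = lam 0 := by
  refine IsLeast.csInf_eq ⟨(h.eigenvalue_iff _).mpr ⟨0, rfl⟩, fun l hl => ?_⟩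
  obtain ⟨n, hn⟩ := (h.eigenvalue_iff _).mp hl
  rw [Complex.ofReal_injective hn]
  exact h.strictMono.monotone (Nat.zero_le n)

lemma IsSpectralData.not_isEigenvalue_of_lt (h : IsSpectralData s f F lam gam) {l : ℝ}
    (hl : l < lam 0) : ¬ IsEigenvalue s f F l := by
  intro hl'
  obtain ⟨n, hn⟩ := (h.eigenvalue_iff _).mp hl'
  rw [Complex.ofReal_injective hn] at hl
  exact (h.strictMono.monotone (Nat.zero_le n)).not_gt hl

lemma bigLambda_of_ne (h : f ≠ ∞ ∧ F ≠ ∞) : bigLambda s f F = minEigenvalue s f F := if_pos h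

lemma bigLambda_of_not (h : ¬ (f ≠ ∞ ∧ F ≠ ∞)) : bigLambda s f F = minEigenvalue s f F - 2 :=
  if_neg h

/-- The properties of the solution that generates the transformation. -/
lemma generating_solution (hs : MemLp s 2 (volume.restrict (Ioo 0 Real.pi)))
    (hfF : f ≠ ∞ ∨ F ≠ ∞) (hdata : IsSpectralData s f F lam gam) :
    IsSolution s (bigLambda s f F) (vSol s f F) (vQuasi s f F) ∧
      (∀ x ∈ Icc 0 Real.pi, 0 < vSol s f F x) ∧
      BelowPoles (bigLambda s f F) f ∧ BelowPoles (bigLambda s f F) F ∧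
      (∀ g : Herglotz, f = g → g.eval (bigLambda s f F) = tauLeft s f F) ∧
      (∀ g : Herglotz, F = g → g.eval (bigLambda s f F) = tauRight s f F) := by
  have hπ : Real.pi ∈ Icc 0 Real.pi := ⟨Real.pi_pos.le, le_rfl⟩
  have hmin := hdata.minEigenvalue_eq
  have hle : bigLambda s f F ≤ lam 0 := by
    unfold bigLambda
    split_ifs <;> linarith
  induction f using OnePoint.rec with
  | infty =>
    obtain ⟨k, rfl⟩ := OnePoint.ne_infty_iff_exists.mp (hfF.resolve_left fun h => h rfl)
    have hlt : bigLambda s ∞ k < lam 0 := by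
      rw [bigLambda_of_not (by simp), hmin]
      linarith
    obtain ⟨h1, h2⟩ := psi_pos_of_forall_le hs fun l hl =>
      hdata.not_isEigenvalue_of_lt (hl.trans_lt hlt)
    have hv : vSol s ∞ k = psi s k (bigLambda s ∞ k) := if_neg (by simp)
    have hv₁ : vQuasi s ∞ k = psiQuasi s k (bigLambda s ∞ k) := if_neg (by simp)
    rw [tauLeft, tauRight, hv, hv₁]
    refine ⟨isSolution_psi hs _ _, h1, belowPoles_infty _, h2,
      fun g hg => absurd hg.symm (OnePoint.coe_ne_infty g), fun g hg => ?_⟩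
    obtain rfl := OnePoint.coe_injective hg
    rw [psi_pi hs, psiQuasi_pi hs]
    have h3 := belowPoles_coe.mp h2
    change _ = k.up.eval _ / k.down.eval _
    rw [k.eval_up fun hm => (h3 _ hm).false, mul_div_cancel_right₀ _ (k.eval_down_pos h3).ne']
  | coe g =>
    obtain ⟨h1, h2, h3⟩ := phi_pos_of_forall_lt hs (g := g) (F := F) (m := bigLambda s g F)
      (fun l hl => hdata.not_isEigenvalue_of_lt (hl.trans_le hle)) (fun hF => by
        refine hdata.not_isEigenvalue_of_lt ?_
        rw [bigLambda_of_not (by simp [hF]), hmin]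
        linarith)
    have hv : vSol s g F = phi s g (bigLambda s g F) := if_pos (by simp)
    have hv₁ : vQuasi s g F = phiQuasi s g (bigLambda s g F) := if_pos (by simp)
    rw [tauLeft, tauRight, hv, hv₁]
    refine ⟨isSolution_phi hs _ _, h1, h2, h3, fun g' hg => ?_, fun k hk => ?_⟩
    · obtain rfl := OnePoint.coe_injective hg
      rw [phi_zero hs, phiQuasi_zero hs]
      have h4 := belowPoles_coe.mp h2
      change _ = -(-g.up.eval _ / g.down.eval _)
      rw [neg_div, neg_neg, g.eval_up fun hm => (h4 _ hm).false,
        mul_div_cancel_right₀ _ (g.eval_down_pos h4).ne']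
    · subst hk
      rw [bigLambda_of_ne (by simp), hmin] at h1 h3 ⊢
      -- Here `m = λ₀` is an eigenvalue, so `phi` is proportional to `psi` and satisfies the
      -- condition at `π` as well.
      obtain ⟨β, hβ, hpsi, -⟩ := hdata.norming 0
      have hquasi := ((isSolution_psi hs (k : OnePoint Herglotz) (lam 0)).sub
        ((isSolution_phi hs (g : OnePoint Herglotz) (lam 0)).const_mul β)).quasi_eq_zero
        (fun x hx => by rw [hpsi x hx, sub_self]) _ hπ
      have h4 := belowPoles_coe.mp h3
      have h5 := hpsi _ hπ
      rw [psi_pi hs] at h5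
      rw [psiQuasi_pi hs] at hquasi
      change k.up.eval _ - _ = 0 at hquasi
      change k.down.eval _ = _ at h5
      rw [k.eval_up fun hm => (h4 _ hm).false, h5] at hquasi
      rw [eq_div_iff (h1 _ hπ).ne']
      exact mul_left_cancel₀ hβ (by linear_combination hquasi)

lemma integral_log_deriv {m : ℝ} {v v₁ : ℝ → ℝ} (hv : IsSolution s m v v₁)
    (hv0 : ∀ x ∈ Icc 0 Real.pi, 0 < v x) :
    IntervalIntegrable (fun x => deriv v x / v x) volume 0 Real.pi ∧
      ∫ x in (0 : ℝ)..Real.pi, deriv v x / v x = Real.log (v Real.pi / v 0) := by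
  have hp := Real.pi_pos.le
  have hac := hv.ac.log (by
    rw [uIcc_of_le hp]
    exact fun x hx => (hv0 x hx).ne')
  have hd : ∀ᵐ x ∂volume.restrict (Ioo 0 Real.pi),
      HasDerivAt (fun x => Real.log (v x)) (deriv v x / v x) x := by
    filter_upwards [hv.deriv_eq, ae_restrict_mem measurableSet_Ioo] with x h1 hx
    rw [h1.deriv]
    exact h1.log (hv0 x (Ioo_subset_Icc_self hx)).ne'
  refine ⟨hac.intervalIntegrable_of_hasDerivAt hp hd, ?_⟩
  rw [hac.integral_eq_sub hp hd, Real.log_div (hv0 _ ⟨hp, le_rfl⟩).ne' (hv0 _ ⟨le_rfl, hp⟩).ne']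

/-- Almost everywhere `v' / v = r + s`, so the new coefficient is `-s - 2 r + c` with `r` bounded.
The value of `c` is the one that makes its mean zero, as `∫ v' / v = log (v π / v 0)`. -/
lemma darboux_mem_L2zero {m c : ℝ} {v v₁ : ℝ → ℝ} (hs : s ∈ L2zero) (hv : IsSolution s m v v₁)
    (hv0 : ∀ x ∈ Icc 0 Real.pi, 0 < v x)
    (hc : c = 2 / Real.pi * Real.log (v Real.pi / v 0)) :
    (fun x => s x - 2 * deriv v x / v x + c) ∈ L2zero ∧
      IsDarbouxCoeff s (fun x => v₁ x / v x) c (fun x => s x - 2 * deriv v x / v x + c) := by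
  have hp := Real.pi_pos
  have hcoeff : IsDarbouxCoeff s (fun x => v₁ x / v x) c
      (fun x => s x - 2 * deriv v x / v x + c) := by
    filter_upwards [hv.deriv_eq, ae_restrict_mem measurableSet_Ioo] with x h1 hx
    have := (hv0 x (Ioo_subset_Icc_self hx)).ne'
    rw [h1.deriv]
    simp only [RCLike.ofReal_real_eq_id, id_eq]
    field_simp
    ring
  refine ⟨⟨?_, ?_⟩, hcoeff⟩
  · have hr := (hv.isRiccati fun x hx => (hv0 x hx).ne').ac
    obtain ⟨R, hR⟩ := hr.exists_bound
    have hcont := hr.continuousOn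
    rw [uIcc_of_le hp.le] at hR hcont
    have hrL : MemLp (fun x => v₁ x / v x) 2 (volume.restrict (Ioo 0 Real.pi)) := by
      refine MemLp.of_bound
        ((hcont.mono Ioo_subset_Icc_self).aestronglyMeasurable measurableSet_Ioo) R ?_
      filter_upwards [ae_restrict_mem measurableSet_Ioo] with x hx
      exact hR x (Ioo_subset_Icc_self hx)
    have := (hs.1.neg.sub (hrL.const_mul 2)).add (memLp_const c)
    refine (memLp_congr_ae ?_).mpr this
    filter_upwards [hcoeff] with x hx using hx
  · obtain ⟨h1, h2⟩ := integral_log_deriv hv hv0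
    have hs1 := intervalIntegrable_of_memLp hs.1
    have hs0 := hs.2
    rw [← integral_Ioc_eq_integral_Ioo, ← intervalIntegral.integral_of_le hp.le] at hs0 ⊢
    have h3 : ∫ x in (0 : ℝ)..Real.pi, (s x - 2 * deriv v x / v x + c) =
        ∫ x in (0 : ℝ)..Real.pi, (s x - 2 * (deriv v x / v x) + c) :=
      intervalIntegral.integral_congr fun x _ => by simp only [mul_div_assoc]
    rw [h3, intervalIntegral.integral_add (hs1.sub (h1.const_mul 2)) intervalIntegrable_const,
      intervalIntegral.integral_sub hs1 (h1.const_mul 2), intervalIntegral.integral_const_mul,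
      h2, hs0, hc]
    simp
    field_simp
    ring

end

end SturmLiouville

/-! ### Assembly of the theorem. -/

open SturmLiouville
theorem theorem3p1 (s : ℝ → ℝ) (hs : s ∈ L2zero) (f F : OnePoint Herglotz)
    (hfF : -1 ≤ index f + index F) (lam gam : ℕ → ℝ) (hdata : IsSpectralData s f F lam gam) :
    -- the transformation is well defined at `(s, f, F)`
    (∀ x ∈ Set.Icc 0 Real.pi, vSol s f F x ≠ 0) ∧
    ThetaAdmissible (bigLambda s f F) (tauLeft s f F) f ∧
    ThetaAdmissible (bigLambda s f F) (tauRight s f F) F ∧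
    (darboux s f F).1 ∈ L2zero ∧
    -- the transformed boundary coefficients, and the spectral data of the transformed problem
    ∃ f' F' : OnePoint Herglotz,
      toRat f' = (darboux s f F).2.1 ∧ toRat F' = (darboux s f F).2.2 ∧
      index f - index f' = expI f ∧
      (index f + index F) - (index f' + index F') = 2 * (numJ f F : ℤ) ∧
      IsSpectralData (darboux s f F).1 f' F' (fun n => lam (n + numJ f F))
        (fun n => gam (n + numJ f F) / (lam (n + numJ f F) - bigLambda s f F) ^ expI f) := by
  have hne : f ≠ ∞ ∨ F ≠ ∞ := by
    by_contra! h
    rw [h.1, h.2] at hfF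
    change (-1 : ℤ) ≤ -1 + -1 at hfF
    norm_num at hfF
  obtain ⟨hv, hpos, hbf, hbF, htl, htr⟩ := generating_solution hs.1 hne hdata
  have hv0 : ∀ x ∈ Icc 0 Real.pi, vSol s f F x ≠ 0 := fun x hx => (hpos x hx).ne'
  obtain ⟨htL2, ht⟩ := darboux_mem_L2zero hs hv hpos (c := shift s f F) rfl
  have hr := hv.isRiccati hv0
  obtain ⟨f', hf1, hf2, hf3, hf4⟩ := exists_theta f (bigLambda s f F) (tauLeft s f F)
    (tauLeft s f F + shift s f F) fun g hg => ⟨hbf g hg, htl g hg⟩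
  obtain ⟨F', hF1, hF2, hF3, hF4⟩ := exists_theta F (bigLambda s f F) (tauRight s f F)
    (tauRight s f F - shift s f F) fun g hg => ⟨hbF g hg, htr g hg⟩
  have hf : ThetaRel (bigLambda s f F) (tauLeft s f F) (tauLeft s f F + shift s f F) f f' :=
    ⟨hf3, hf4⟩
  have hF : ThetaRel (bigLambda s f F) (tauRight s f F) (tauRight s f F - shift s f F) F F' :=
    ⟨hF3, hF4⟩
  have hlam : ∀ n, bigLambda s f F < lam (n + numJ f F) := by
    intro n
    by_cases h : f ≠ ∞ ∧ F ≠ ∞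
    · rw [bigLambda_of_ne h, hdata.minEigenvalue_eq]
      exact hdata.strictMono (by simp [numJ, h])
    · rw [bigLambda_of_not h, hdata.minEigenvalue_eq]
      linarith [hdata.strictMono.monotone (Nat.zero_le (n + numJ f F))]
  have hshift : ∀ n, lam n ≠ bigLambda s f F → ∃ k, n = k + numJ f F := by
    intro n hn
    by_cases h : f ≠ ∞ ∧ F ≠ ∞
    · rw [bigLambda_of_ne h, hdata.minEigenvalue_eq] at hn
      have hn0 : n ≠ 0 := by
        rintro rfl
        exact hn rfl
      exact ⟨n - 1, by simp only [numJ, if_pos h]; omega⟩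
    · exact ⟨n, by simp only [numJ, if_neg h]; omega⟩
  refine ⟨hv0, fun g hg => ⟨hbf g hg, (htl g hg).le⟩, fun g hg => ⟨hbF g hg, (htr g hg).le⟩, htL2,
    f', F', hf1, hF1, hf2, ?_, ?_, ?_, ?_⟩
  -- The index at each end changes by its own `expI`; two finite coefficients give `1 + 1`, and one
  -- `∞` gives `1 - 1`.
  · have : expI f + expI F = 2 * (numJ f F : ℤ) := by
      unfold expI numJ
      by_cases h1 : f = ∞ <;> by_cases h2 : F = ∞ <;> simp_all
    linarith
  · exact fun i j hij => hdata.strictMono (by simpa using hij)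
  · intro z
    -- At `Λ` the composition with the inverse transformation is zero, so this value needs its own
    -- argument.
    rcases eq_or_ne z (bigLambda s f F : ℂ) with rfl | hz
    · refine iff_of_false (not_isEigenvalue_darboux hv hv0 ht hf hF hbf hbF hne) ?_
      rintro ⟨n, hn⟩
      exact (hlam n).ne (Complex.ofReal_injective hn)
    · constructor
      · intro h
        obtain ⟨n, rfl⟩ := (hdata.eigenvalue_iff z).mp (h.of_darboux ht hr hf hF hz)
        obtain ⟨k, rfl⟩ := hshift n fun h => hz (by rw [h])
        exact ⟨k, rfl⟩
      · rintro ⟨n, rfl⟩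
        exact ((hdata.eigenvalue_iff _).mpr ⟨_, rfl⟩).darboux ht hr hf hF hz
  · exact fun n => (hdata.norming _).darboux hs.1 htL2.1 ht hr hf hF (hlam n).ne'
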